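/- Let $U\subset\mathbb{R}^2$ be a simply connected open set with coordinates $x^{A'}$, $A'=0,1$, and let $[\gamma]$ be a smooth projective structure on $U$: a class of smooth torsion-free connections on $TU$ modulo $\gamma^{C'}_{A'B'}\sim\gamma^{C'}_{A'B'}+\delta^{C'}_{A'}\beta_{B'}+\delta^{C'}_{B'}\beta_{A'}$, with $\beta$ a smooth one-form on $U$. It is called metrisable if it contains the Levi-Civita connection of some smooth Riemannian or pseudo-Riemannian metric $h$ on $U$ (one then says that $[\gamma]$ is metrised by $h$). Put $$\Pi^{C'}_{A'B'}=\gamma^{C'}_{A'B'}-\tfrac13\gamma^{D'}_{D'A'}\delta^{C'}_{B'}-\tfrac13\gamma^{D'}_{D'B'}\delta^{C'}_{A'},$$ and on $TU=U\times\mathbb{R}^2$, with coordinates $(x^{A'},z^{A'})$ and $z_{A'}=z^{B'}\varepsilon_{B'A'}$, where $\varepsilon_{A'B'}=-\varepsilon_{B'A'}$ and $\varepsilon_{01}=1$, let $$g=dz_{A'}\,dx^{A'}-\Pi^{C'}_{A'B'}\,z_{C'}\,dx^{A'}dx^{B'},$$ where juxtaposition of one-forms denotes the symmetric product $ab=\tfrac12(a\otimes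 b+b\otimes a)$. A Kähler metric on a manifold $M$ is a smooth, possibly indefinite, metric $\hat g$ for which there is an integrable complex structure $J$ with $\hat g(JX,JY)=\hat g(X,Y)$ such that the two-form $\hat g(X,JY)$ is closed. A para-Kähler metric is a smooth metric $\hat g$ for which there is a smooth $J:TM\to TM$ with $J^2=\mathrm{Id}$, with integrable $\pm1$-eigendistributions and with $\hat g(JX,JY)=-\hat g(X,Y)$, such that the two-form $\hat g(JX,Y)$ is closed. The conformal class of $g$ is $\{cg\mid c:TU\to\mathbb{R}^+\text{ smooth}\}$. Then: 1. $g$ depends only on the projective structure $[\gamma]$, and it is a smooth metric of signature $(2,2)$ on $TU$. 2. $[\gamma]$ is metrisable if and only if the conformal class of $g$ on $TU$ contains a Kähler or a para-Kähler metric. 3. If $[\gamma]$ is metrised by a Riemannian metric, then the conformal class of $g$ contains a Kähler metric; if $[\gamma]$ is metrised by a Lorentzian metric, then it contains a para-Kähler metric. -/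

import Mathlib

open scoped ContDiff

noncomputable section

/-! ### Projective structures on a surface (in a coordinate domain) -/

/-- The coordinate plane. -/
abbrev Plane : Type := Fin 2 → ℝ

/-- The partial derivative `∂f/∂x^A`. -/
def partialD (A : Fin 2) (f : Plane → ℝ) (x : Plane) : ℝ :=
  fderiv ℝ f x (Pi.single A 1)

/-- Kronecker delta. -/
def kron (A B : Fin 2) : ℝ := if A = B then 1 else 0

/-- A smooth torsion-free affine connection on the tangent bundle of `U ⊆ ℝ²`, given by its
connection symbols: `Γ C A B` is the function `γ^C_{AB}`. -/
structure TorsionFreeConnection (U : Set Plane) where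
  Γ : Fin 2 → Fin 2 → Fin 2 → Plane → ℝ
  smooth : ∀ C A B, ContDiffOn ℝ ∞ (Γ C A B) U
  symm : ∀ C A B, ∀ x ∈ U, Γ C A B x = Γ C B A x

/-- Projective equivalence:
`γ'^C_{AB} = γ^C_{AB} + δ_A^C β_B + δ_B^C β_A` on `U` for some smooth one-form `β` on `U`. A
projective structure `[γ]` is an equivalence class for this relation. -/
def ProjEquiv {U : Set Plane} (γ γ' : TorsionFreeConnection U) : Prop :=
  ∃ β : Fin 2 → Plane → ℝ, (∀ A, ContDiffOn ℝ ∞ (β A) U) ∧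
    ∀ x ∈ U, ∀ C A B,
      γ'.Γ C A B x = γ.Γ C A B x + kron A C * β B x + kron B C * β A x

theorem ProjEquiv.equivalence (U : Set Plane) :
    Equivalence (ProjEquiv : TorsionFreeConnection U → TorsionFreeConnection U → Prop) where
  refl γ := ⟨fun _ _ => 0, fun _ => contDiffOn_const, by intros; simp⟩
  symm := by
    rintro γ γ' ⟨β, hβ, h⟩
    refine ⟨fun A x => -β A x, fun A => (hβ A).neg, fun x hx C A B => ?_⟩
    rw [h x hx]; ring
  trans := by
    rintro γ γ' γ'' ⟨β, hβ, h⟩ ⟨β', hβ', h'⟩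
    refine ⟨fun A x => β A x + β' A x, fun A => (hβ A).add (hβ' A), fun x hx C A B => ?_⟩
    rw [h' x hx, h x hx]; ring

/-- A smooth pseudo-Riemannian metric on `U ⊆ ℝ²`, given by its matrix of components. -/
structure SurfaceMetric (U : Set Plane) where
  h : Plane → Matrix (Fin 2) (Fin 2) ℝ
  smooth : ∀ A B, ContDiffOn ℝ ∞ (fun x => h x A B) U
  symm : ∀ x ∈ U, (h x).IsSymm
  nondeg : ∀ x ∈ U, (h x).det ≠ 0

/-- The metric is Riemannian (positive definite). -/
def SurfaceMetric.IsRiemannian {U : Set Plane} (h : SurfaceMetric U) : Prop :=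
  ∀ x ∈ U, (h.h x).PosDef

/-- The metric is Lorentzian, i.e. of signature `(1,1)`. -/
def SurfaceMetric.IsLorentzian {U : Set Plane} (h : SurfaceMetric U) : Prop :=
  ∀ x ∈ U, (h.h x).det < 0

/-- `γ` is the Levi-Civita connection of `h`: it is torsion-free and `∇h = 0`. -/
def IsLeviCivita {U : Set Plane} (γ : TorsionFreeConnection U) (h : SurfaceMetric U) : Prop :=
  ∀ x ∈ U, ∀ C A B, partialD C (fun y => h.h y A B) x =
    ∑ D, (γ.Γ D C A x * h.h x D B + γ.Γ D C B x * h.h x A D)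

/-- The projective structure `[γ]` contains the Levi-Civita connection of `h`. -/
def IsMetrisedBy {U : Set Plane} (γ : TorsionFreeConnection U) (h : SurfaceMetric U) : Prop :=
  ∃ γ' : TorsionFreeConnection U, ProjEquiv γ γ' ∧ IsLeviCivita γ' h

/-- The projective structure `[γ]` is metrisable (by a Riemannian or pseudo-Riemannian metric). -/
def IsMetrisable {U : Set Plane} (γ : TorsionFreeConnection U) : Prop :=
  ∃ h : SurfaceMetric U, IsMetrisedBy γ h

/-! ### Kähler and para-Kähler metrics in a conformal class

`M` is an open subset of a finite-dimensional real vector space `E`; tensor fields on `M` are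
functions on `E` of which only the values on `M` matter. -/

section Kahler

variable {E : Type*} [NormedAddCommGroup E] [NormedSpace ℝ E]

/-- `g` is a smooth pseudo-Riemannian metric on `M`. -/
structure IsMetricOn (M : Set E) (g : E → E →L[ℝ] E →L[ℝ] ℝ) : Prop where
  smooth : ContDiffOn ℝ ∞ g M
  symm : ∀ p ∈ M, ∀ v w, g p v w = g p w v
  nondeg : ∀ p ∈ M, ∀ v, (∀ w, g p v w = 0) → v = 0

/-- The bilinear form `b` on a four-dimensional space has signature `(2,2)`. -/
def HasNeutralSignature (b : E →L[ℝ] E →L[ℝ] ℝ) : Prop :=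
  ∃ e : Module.Basis (Fin 4) ℝ E, ∀ i j,
    b (e i) (e j) = Matrix.diagonal (![1, 1, -1, -1] : Fin 4 → ℝ) i j

/-- `g'` belongs to the conformal class of `g` on `M`: `g' = c g` with `c > 0` smooth. -/
def InConformalClass (M : Set E) (g g' : E → E →L[ℝ] E →L[ℝ] ℝ) : Prop :=
  ∃ c : E → ℝ, ContDiffOn ℝ ∞ c M ∧ (∀ p ∈ M, 0 < c p) ∧ ∀ p ∈ M, g' p = c p • g p

/-- The alternating two-form `(v, w) ↦ (b(v, w) - b(w, v)) / 2` of a bilinear form `b`. -/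
def twoForm (b : E →L[ℝ] E →L[ℝ] ℝ) : E [⋀^Fin 2]→L[ℝ] ℝ :=
  (1 / 2 : ℝ) • ContinuousAlternatingMap.alternatizeUncurryFin
    (((ContinuousAlternatingMap.ofSubsingletonLIE (𝕜 := ℝ) (E := E) (F := ℝ) (0 : Fin 1)).toContinuousLinearEquiv.toContinuousLinearMap :
      (E →L[ℝ] ℝ) →L[ℝ] (E [⋀^Fin 1]→L[ℝ] ℝ)).comp b)

theorem twoForm_apply (b : E →L[ℝ] E →L[ℝ] ℝ) (v : Fin 2 → E) :
    twoForm b v = (b (v 0) (v 1) - b (v 1) (v 0)) / 2 := by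
  simp [twoForm, ContinuousAlternatingMap.alternatizeUncurryFin_apply, Fin.removeNth]
  ring

/-- The two-form on `M` defined by a skew field of bilinear forms `Σ` is closed. -/
def IsClosedOn (M : Set E) (S : E → E →L[ℝ] E →L[ℝ] ℝ) : Prop :=
  ∀ p ∈ M, extDeriv (fun q => twoForm (S q)) p = 0

/-- `J` is a complex structure on `M`: a smooth field of endomorphisms with `J² = -Id` whose
Nijenhuis tensor `[JX, JY] - J[JX, Y] - J[X, JY] - [X, Y]` vanishes. -/
structure IsComplexStructureOn (M : Set E) (J : E → E →L[ℝ] E) : Prop where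
  smooth : ContDiffOn ℝ ∞ J M
  sq : ∀ p ∈ M, ∀ v, J p (J p v) = -v
  nijenhuis : ∀ X Y : E → E, ContDiffOn ℝ ∞ X M → ContDiffOn ℝ ∞ Y M → ∀ p ∈ M,
    VectorField.lieBracket ℝ (fun q => J q (X q)) (fun q => J q (Y q)) p
      - J p (VectorField.lieBracket ℝ (fun q => J q (X q)) Y p)
      - J p (VectorField.lieBracket ℝ X (fun q => J q (Y q)) p)
      - VectorField.lieBracket ℝ X Y p = 0

/-- `J` is an integrable almost product structure on `M`: a smooth field of endomorphisms with
`J² = Id` such that the distributions of eigenspaces for the eigenvalues `s = 1` and `s = -1`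
are involutive. -/
structure IsProductStructureOn (M : Set E) (J : E → E →L[ℝ] E) : Prop where
  smooth : ContDiffOn ℝ ∞ J M
  sq : ∀ p ∈ M, ∀ v, J p (J p v) = v
  involutive : ∀ s : ℝ, s = 1 ∨ s = -1 →
    ∀ X Y : E → E, ContDiffOn ℝ ∞ X M → ContDiffOn ℝ ∞ Y M →
      (∀ p ∈ M, J p (X p) = s • X p) → (∀ p ∈ M, J p (Y p) = s • Y p) →
      ∀ p ∈ M, J p (VectorField.lieBracket ℝ X Y p) = s • VectorField.lieBracket ℝ X Y p

/-- `(g, J)` is a (pseudo-)Kähler structure on `M`: `J` is a complex structure,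
`g(JX, JY) = g(X, Y)`, and the two-form `g(X, JY)` is closed. -/
structure IsKahlerOn (M : Set E) (g : E → E →L[ℝ] E →L[ℝ] ℝ) (J : E → E →L[ℝ] E) : Prop where
  metric : IsMetricOn M g
  complex : IsComplexStructureOn M J
  compatible : ∀ p ∈ M, ∀ v w, g p (J p v) (J p w) = g p v w
  closed : IsClosedOn M (fun p => ((g p).flip.comp (J p)).flip)

/-- `(g, J)` is a para-Kähler structure on `M`: `J` is an integrable almost product structure,
`g(JX, JY) = -g(X, Y)`, and the two-form `g(JX, Y)` is closed. -/
structure IsParaKahlerOn (M : Set E) (g : E → E →L[ℝ] E →L[ℝ] ℝ) (J : E → E →L[ℝ] E) :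
    Prop where
  metric : IsMetricOn M g
  product : IsProductStructureOn M J
  compatible : ∀ p ∈ M, ∀ v w, g p (J p v) (J p w) = -g p v w
  closed : IsClosedOn M (fun p => (g p).comp (J p))

/-- The conformal class of `g` on `M` contains a Kähler metric. -/
def ContainsKahler (M : Set E) (g : E → E →L[ℝ] E →L[ℝ] ℝ) : Prop :=
  ∃ g' J, InConformalClass M g g' ∧ IsKahlerOn M g' J

/-- The conformal class of `g` on `M` contains a para-Kähler metric. -/
def ContainsParaKahler (M : Set E) (g : E → E →L[ℝ] E →L[ℝ] ℝ) : Prop :=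
  ∃ g' J, InConformalClass M g g' ∧ IsParaKahlerOn M g' J

end Kahler

/-! ### The projectively invariant Riemannian extension -/

/-- The symbols `Π^C_{AB} = γ^C_{AB} - (1/3) γ^D_{DA} δ_B^C - (1/3) γ^D_{DB} δ_A^C`. -/
def thomas {U : Set Plane} (γ : TorsionFreeConnection U) (C A B : Fin 2) (x : Plane) : ℝ :=
  γ.Γ C A B x - (1 / 3) * (∑ D, γ.Γ D D A x) * kron B C - (1 / 3) * (∑ D, γ.Γ D D B x) * kron A C

/-- The total space `TU = U × ℝ²`, with coordinates `(x^A, z^A)`. -/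
def tangentTotal (U : Set Plane) : Set (Plane × Plane) := U ×ˢ Set.univ

/-- The skew symbol `ε_{AB}`, with `ε_{01} = 1`. -/
def epsLow (A B : Fin 2) : ℝ := !![0, 1; -1, 0] A B

/-- The one-form `dx^A` on `TU`. -/
def dx (A : Fin 2) : Plane × Plane →L[ℝ] ℝ :=
  (ContinuousLinearMap.proj A).comp (ContinuousLinearMap.fst ℝ Plane Plane)

/-- The one-form `dz_A` on `TU`, where `z_A = z^B ε_{BA}`. It is linear, so that `dzLow A p` is
also the value of the function `z_A` at the point `p`. -/
def dzLow (A : Fin 2) : Plane × Plane →L[ℝ] ℝ :=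
  ∑ B, epsLow B A • (ContinuousLinearMap.proj B).comp (ContinuousLinearMap.snd ℝ Plane Plane)

/-- The symmetric product `a b = (a ⊗ b + b ⊗ a) / 2` of one-forms. -/
def symProd (a b : Plane × Plane →L[ℝ] ℝ) :
    Plane × Plane →L[ℝ] Plane × Plane →L[ℝ] ℝ :=
  (1 / 2 : ℝ) • (a.smulRight b + b.smulRight a)

/-- The metric `g = dz_A dx^A - Π^C_{AB} z_C dx^A dx^B` on `TU`. -/
def riemannianExtension {U : Set Plane} (γ : TorsionFreeConnection U) (p : Plane × Plane) :
    Plane × Plane →L[ℝ] Plane × Plane →L[ℝ] ℝ :=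
  ∑ A, symProd (dzLow A) (dx A)
    - ∑ A, ∑ B, ∑ C, (thomas γ C A B p.1 * dzLow C p) • symProd (dx A) (dx B)

end

/-! Both kinds of structure are treated at once through J² = e, with e = -1 for Kähler and e = 1 for
para-Kähler (`isKahlerOn_iff`, `isParaKahlerOn_iff`). In the frame of horizontal lifts h_A = ∂/∂x^A
+ Π^C_{AB} z_C ∂/∂z_B and vertical fields v^A = ∂/∂z_A, the metric g only pairs h_A with v^A. The
Nijenhuis tensor and the exterior derivative of the fundamental form become explicit expressions in
this frame.

Let κg and J be such a structure. Compatibility together with J² = e makes J skew for g. As so(2,2)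
is a sum of two copies of sl(2), and the square of J is scalar, J lies in one of the summands at
each point, and in the same one everywhere because TU is connected
(`IsHermitianKahlerOn.dual_or_antidual`).

In the first case J preserves the horizontal and the vertical distribution and is given by a
trace-free j_A^B. Integrability and closedness imply 2κ ∇_C j_{AB} = κ_A j_{CB} + κ_B j_{AC} - κ_C
j_{AB}, where κ_A is the derivative of κ along h_A (`weylParallel_of_dual`). No vertical derivative
occurs, so the equation restricts to the zero section, and there κ^{3/2} j_{AB} is a metric whose
Levi-Civita connection lies in [γ] (`isMetrisable_of_weylParallel`). The passage is reversible: from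
a metric h one takes κ = |det h|^{1/3} and j = |det h|^{-1/2} h with an index raised, both pulled
back to TU (`exists_isHermitianKahlerOn_of_isMetrisedBy`). The sign of det h decides between e = -1
and e = 1.

In the second case J acts on each pair (h_A, ε_{AB} v^B) by one and the same 2×2 matrix of
functions. Multiplied by κ^{-1/2}, its entries solve an overdetermined linear system
(`isTwistorSolution_of_asd`), whose integrability conditions force the projective Cotton tensor to
vanish (`IsTwistorSolution.cotton_eq_zero`). Thus [γ] is flat, and it is metrisable for another
reason: the flat tractor connection has three independent parallel sections on U, and the sum of
their squares is a nondegenerate solution of the metrisability equation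
(`isMetrisable_of_cotton_eq_zero`). Only here is simple connectivity needed; elsewhere connectedness
is enough. -/

noncomputable section

open scoped Topology
open Filter VectorField

/-! ### Kähler and para-Kähler structures as one notion with J² = e. -/

section FrameCalculus

variable {E : Type*} [NormedAddCommGroup E] [NormedSpace ℝ E]

/-- The torsion expression `[JX, JY] - J[JX, Y] - J[X, JY] + e [X, Y]` of vector fields. -/
def nijenhuis (e : ℝ) (J : E → E →L[ℝ] E) (X Y : E → E) (p : E) : E :=
  lieBracket ℝ (fun q => J q (X q)) (fun q => J q (Y q)) p
    - J p (lieBracket ℝ (fun q => J q (X q)) Y p)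
    - J p (lieBracket ℝ X (fun q => J q (Y q)) p)
    + e • lieBracket ℝ X Y p

/-- The algebraic expression of the Nijenhuis tensor through the derivative of `J`. -/
def nijenhuisForm (J : E → E →L[ℝ] E) (p v w : E) : E :=
  fderiv ℝ J p (J p v) w - fderiv ℝ J p (J p w) v + J p (fderiv ℝ J p w v)
    - J p (fderiv ℝ J p v w)

/-- The derivatives of X and Y cancel in pairs, directly or by J² = e, and only the derivative of J
survives. The expression is therefore tensorial. -/
theorem nijenhuis_eq {e : ℝ} {J : E → E →L[ℝ] E} {X Y : E → E} {p : E}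
    (hJ : DifferentiableAt ℝ J p) (hX : DifferentiableAt ℝ X p) (hY : DifferentiableAt ℝ Y p)
    (hsq : ∀ v, J p (J p v) = e • v) :
    nijenhuis e J X Y p = nijenhuisForm J p (X p) (Y p) := by
  simp only [nijenhuis, nijenhuisForm, lieBracket_eq]
  rw [fderiv_clm_apply hJ hX, fderiv_clm_apply hJ hY]
  simp only [add_apply, ContinuousLinearMap.comp_apply,
    ContinuousLinearMap.flip_apply, map_add, map_sub, hsq, smul_sub]
  abel

/-- `J² = e`, and the torsion of `J` vanishes: for `e = -1` a complex structure, for `e = 1` an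
integrable product structure. -/
structure IsIntegrableOn (e : ℝ) (M : Set E) (J : E → E →L[ℝ] E) : Prop where
  smooth : ContDiffOn ℝ ∞ J M
  sq : ∀ p ∈ M, ∀ v, J p (J p v) = e • v
  nijenhuis : ∀ X Y : E → E, ContDiffOn ℝ ∞ X M → ContDiffOn ℝ ∞ Y M → ∀ p ∈ M,
    nijenhuis e J X Y p = 0

theorem ContDiffOn.differentiableAt_of_isOpen {F : Type*} [NormedAddCommGroup F]
    [NormedSpace ℝ F] {M : Set E} {f : E → F} (h : ContDiffOn ℝ ∞ f M) (hM : IsOpen M) {p : E}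
    (hp : p ∈ M) : DifferentiableAt ℝ f p :=
  (h.contDiffAt (hM.mem_nhds hp)).differentiableAt (by simp)

theorem isComplexStructureOn_iff {M : Set E} {J : E → E →L[ℝ] E} :
    IsComplexStructureOn M J ↔ IsIntegrableOn (-1) M J := by
  constructor
  · rintro ⟨h1, h2, h3⟩
    refine ⟨h1, fun p hp v => by simp [h2 p hp], fun X Y hX hY p hp => ?_⟩
    rw [_root_.nijenhuis, neg_one_smul, ← sub_eq_add_neg]
    exact h3 X Y hX hY p hp
  · rintro ⟨h1, h2, h3⟩
    refine ⟨h1, fun p hp v => by simp [h2 p hp], fun X Y hX hY p hp => ?_⟩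
    have := h3 X Y hX hY p hp
    rwa [_root_.nijenhuis, neg_one_smul, ← sub_eq_add_neg] at this

theorem lieBracket_add_add {V W V' W' : E → E} {p : E} (hV : DifferentiableAt ℝ V p)
    (hW : DifferentiableAt ℝ W p) (hV' : DifferentiableAt ℝ V' p)
    (hW' : DifferentiableAt ℝ W' p) :
    lieBracket ℝ (fun q => V q + V' q) (fun q => W q + W' q) p =
      lieBracket ℝ V W p + lieBracket ℝ V W' p + lieBracket ℝ V' W p + lieBracket ℝ V' W' p := by
  simp only [lieBracket_eq]
  rw [fderiv_fun_add hV hV', fderiv_fun_add hW hW']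
  simp only [add_apply, map_add]
  abel

theorem lieBracket_sub_sub {V W V' W' : E → E} {p : E} (hV : DifferentiableAt ℝ V p)
    (hW : DifferentiableAt ℝ W p) (hV' : DifferentiableAt ℝ V' p)
    (hW' : DifferentiableAt ℝ W' p) :
    lieBracket ℝ (fun q => V q - V' q) (fun q => W q - W' q) p =
      lieBracket ℝ V W p - lieBracket ℝ V W' p - lieBracket ℝ V' W p + lieBracket ℝ V' W' p := by
  simp only [lieBracket_eq]
  rw [fderiv_fun_sub hV hV', fderiv_fun_sub hW hW']
  simp only [sub_apply, map_sub]
  abel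

/-- Forwards, involutivity is applied to the eigenfields X ± JX and Y ± JY. Half the sum of the two
identities reads J([X,Y] + [JX,JY]) = [X,JY] + [JX,Y], and J applied to it is the vanishing of the
torsion. Backwards, on eigenfields for s the torsion collapses to 2[X,Y] - 2sJ[X,Y]. -/
theorem isProductStructureOn_iff {M : Set E} (hM : IsOpen M) {J : E → E →L[ℝ] E} :
    IsProductStructureOn M J ↔ IsIntegrableOn 1 M J := by
  constructor
  · rintro ⟨h1, h2, h3⟩
    refine ⟨h1, fun p hp v => by simp [h2 p hp], fun X Y hX hY p hp => ?_⟩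
    have hJX : ContDiffOn ℝ ∞ (fun q => J q (X q)) M := h1.clm_apply hX
    have hJY : ContDiffOn ℝ ∞ (fun q => J q (Y q)) M := h1.clm_apply hY
    have dX := hX.differentiableAt_of_isOpen hM hp
    have dY := hY.differentiableAt_of_isOpen hM hp
    have dJX := hJX.differentiableAt_of_isOpen hM hp
    have dJY := hJY.differentiableAt_of_isOpen hM hp
    have e1 := h3 1 (Or.inl rfl) (fun q => X q + J q (X q)) (fun q => Y q + J q (Y q))
      (hX.add hJX) (hY.add hJY) (fun q hq => by simp [h2 q hq, add_comm])
      (fun q hq => by simp [h2 q hq, add_comm]) p hp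
    have e2 := h3 (-1) (Or.inr rfl) (fun q => X q - J q (X q)) (fun q => Y q - J q (Y q))
      (hX.sub hJX) (hY.sub hJY) (fun q hq => by simp [h2 q hq])
      (fun q hq => by simp [h2 q hq]) p hp
    rw [lieBracket_add_add dX dY dJX dJY] at e1
    rw [lieBracket_sub_sub dX dY dJX dJY] at e2
    rw [_root_.nijenhuis]
    simp only [map_add, map_sub] at e1 e2
    have e3 : J p (lieBracket ℝ X Y p) +
        J p (lieBracket ℝ (fun q => J q (X q)) (fun q => J q (Y q)) p) =
        lieBracket ℝ X (fun q => J q (Y q)) p + lieBracket ℝ (fun q => J q (X q)) Y p := by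
      linear_combination (norm := module) (1 / 2 : ℝ) • e1 + (1 / 2 : ℝ) • e2
    have e4 := congrArg (J p) e3
    simp only [map_add, h2 p hp] at e4
    linear_combination (norm := module) (1 : ℝ) • e4
  · rintro ⟨h1, h2, h3⟩
    refine ⟨h1, fun p hp v => by simp [h2 p hp], fun s hs X Y hX hY hJX hJY p hp => ?_⟩
    have := h3 X Y hX hY p hp
    have eX : (fun q => J q (X q)) =ᶠ[𝓝 p] fun q => s • X q :=
      (hM.eventually_mem hp).mono fun q hq => hJX q hq
    have eY : (fun q => J q (Y q)) =ᶠ[𝓝 p] fun q => s • Y q :=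
      (hM.eventually_mem hp).mono fun q hq => hJY q hq
    have dX := hX.differentiableAt_of_isOpen hM hp
    have dY := hY.differentiableAt_of_isOpen hM hp
    rw [_root_.nijenhuis, eX.lieBracket_vectorField_eq eY,
      eX.lieBracket_vectorField_eq EventuallyEq.rfl,
      (EventuallyEq.rfl).lieBracket_vectorField_eq eY] at this
    have l1 : ∀ W, lieBracket ℝ (fun q => s • X q) W p = s • lieBracket ℝ X W p := fun W =>
      lieBracket_const_smul_left dX
    have l2 : ∀ W, lieBracket ℝ W (fun q => s • Y q) p = s • lieBracket ℝ W Y p := fun W =>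
      lieBracket_const_smul_right dY
    rw [l1, l1, l2, map_smul] at this
    have hss : s * s = 1 := by rcases hs with rfl | rfl <;> norm_num
    rw [smul_smul, hss] at this
    have h4 : (2 : ℝ) • (s • J p (lieBracket ℝ X Y p)) = (2 : ℝ) • lieBracket ℝ X Y p := by
      rw [two_smul, two_smul, ← sub_eq_zero, ← neg_eq_zero, ← this]
      module
    have h5 := smul_right_injective E (two_ne_zero' ℝ) h4
    calc J p (lieBracket ℝ X Y p) = (s * s) • J p (lieBracket ℝ X Y p) := by rw [hss, one_smul]
      _ = s • lieBracket ℝ X Y p := by rw [mul_smul, h5]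

/-- `(g, J)` with `J² = e`: pseudo-Kähler for `e = -1`, para-Kähler for `e = 1`. -/
structure IsHermitianKahlerOn (e : ℝ) (M : Set E) (g : E → E →L[ℝ] E →L[ℝ] ℝ)
    (J : E → E →L[ℝ] E) : Prop where
  metric : IsMetricOn M g
  integrable : IsIntegrableOn e M J
  compatible : ∀ p ∈ M, ∀ v w, g p (J p v) (J p w) = -e * g p v w
  closed : IsClosedOn M (fun p => (g p).comp (J p))

theorem twoForm_neg (b : E →L[ℝ] E →L[ℝ] ℝ) : twoForm (-b) = -twoForm b := by
  ext v
  simp only [twoForm_apply, ContinuousAlternatingMap.neg_apply, neg_apply]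
  ring

theorem twoForm_eq_toCLM : ∃ L : (E →L[ℝ] E →L[ℝ] ℝ) →L[ℝ] (E [⋀^Fin 2]→L[ℝ] ℝ),
    ∀ b, twoForm b = L b :=
  ⟨(1 / 2 : ℝ) • (ContinuousAlternatingMap.alternatizeUncurryFinCLM ℝ E ℝ).comp
    (ContinuousLinearMap.compL ℝ E (E →L[ℝ] ℝ) (E [⋀^Fin 1]→L[ℝ] ℝ)
      ((ContinuousAlternatingMap.ofSubsingletonLIE (𝕜 := ℝ) (E := E) (F := ℝ)
        (0 : Fin 1)).toContinuousLinearEquiv.toContinuousLinearMap)), fun _ => rfl⟩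

theorem ContDiffOn.twoForm {M : Set E} {S : E → E →L[ℝ] E →L[ℝ] ℝ} (hS : ContDiffOn ℝ ∞ S M) :
    ContDiffOn ℝ ∞ (fun q => twoForm (S q)) M := by
  obtain ⟨L, hL⟩ := twoForm_eq_toCLM (E := E)
  simp only [hL]
  exact L.contDiff.comp_contDiffOn hS

/-- The value of the exterior derivative of a skew field on vector fields. -/
def cyclicDeriv (S : E → E →L[ℝ] E →L[ℝ] ℝ) (X Y Z : E → E) (p : E) : ℝ :=
  fderiv ℝ (fun q => S q (Y q) (Z q)) p (X p) - fderiv ℝ (fun q => S q (X q) (Z q)) p (Y p)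
    + fderiv ℝ (fun q => S q (X q) (Y q)) p (Z p)
    - S p (lieBracket ℝ X Y p) (Z p) + S p (lieBracket ℝ X Z p) (Y p)
    - S p (lieBracket ℝ Y Z p) (X p)

/-- Cartan's formula. For skew S the antisymmetrisation in `twoForm` gives back S, so no factor
appears. -/
theorem extDeriv_twoForm {M : Set E} (hM : IsOpen M) {S : E → E →L[ℝ] E →L[ℝ] ℝ}
    (hS : ContDiffOn ℝ ∞ S M) (hskew : ∀ q ∈ M, ∀ v w, S q v w = -S q w v) {X Y Z : E → E} {p : E}
    (hp : p ∈ M) (hX : DifferentiableAt ℝ X p) (hY : DifferentiableAt ℝ Y p)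
    (hZ : DifferentiableAt ℝ Z p) :
    extDeriv (fun q => twoForm (S q)) p ![X p, Y p, Z p] = cyclicDeriv S X Y Z p := by
  have h2 : ∀ q ∈ M, ∀ v, twoForm (S q) v = S q (v 0) (v 1) := fun q hq v => by
    rw [twoForm_apply, hskew q hq (v 1)]; ring
  have key := extDeriv_apply_vectorField (V := ![X, Y, Z])
    (hS.twoForm.differentiableAt_of_isOpen hM hp) (by intro i; fin_cases i <;> assumption)
  have e0 : (fun i => (![X, Y, Z] : Fin 3 → E → E) i p) = ![X p, Y p, Z p] := by
    ext i; fin_cases i <;> rfl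
  rw [e0] at key
  rw [key]
  have cg : ∀ (i : Fin 3) (V W : E → E),
      (∀ q, i.removeNth (fun j => (![X, Y, Z] : Fin 3 → E → E) j q) = ![V q, W q]) →
      fderiv ℝ (fun q => twoForm (S q)
        (i.removeNth (fun j => (![X, Y, Z] : Fin 3 → E → E) j q))) p =
      fderiv ℝ (fun q => S q (V q) (W q)) p := fun i V W h => by
    refine EventuallyEq.fderiv_eq ((hM.eventually_mem hp).mono fun q hq => ?_)
    simp only []
    rw [h, h2 q hq]; rfl
  rw [Fin.sum_univ_three, cg 0 Y Z, cg 1 X Z, cg 2 X Y]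
  · have hI0 : (Finset.Ici (0 : Fin 2)) = {0, 1} := by decide
    have hI1 : (Finset.Ici (1 : Fin 2)) = {1} := by decide
    rw [Fin.sum_univ_two, hI0, hI1, Finset.sum_pair (by decide), Finset.sum_singleton]
    simp only [h2 p hp]
    simp [cyclicDeriv, Fin.removeNth, Fin.succAbove]
    ring
  · intro q; ext i; fin_cases i <;> rfl
  · intro q; ext i; fin_cases i <;> rfl
  · intro q; ext i; fin_cases i <;> rfl

theorem IsClosedOn.neg_iff {M : Set E} (hM : IsOpen M) {S T : E → E →L[ℝ] E →L[ℝ] ℝ}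
    (h : ∀ p ∈ M, T p = -S p) : IsClosedOn M T ↔ IsClosedOn M S := by
  refine forall₂_congr fun p hp => ?_
  have e1 : (fun q => twoForm (T q)) =ᶠ[𝓝 p] fun q => (-1 : ℝ) • twoForm (S q) :=
    (hM.eventually_mem hp).mono fun q hq => by
      ext v; simp [h q hq, twoForm_neg]
  have e2 := extDeriv_fun_smul (x := p) (-1 : ℝ) fun q => twoForm (S q)
  rw [e1.extDeriv_eq]
  erw [e2]
  simp

/-- Replacing w by Jw in the compatibility and cancelling e turns an (anti-)isometry into a skew
endomorphism. -/
theorem compatible_skew {e : ℝ} (he : e ≠ 0) {b : E →L[ℝ] E →L[ℝ] ℝ} {j : E →L[ℝ] E}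
    (hsq : ∀ v, j (j v) = e • v) (hc : ∀ v w, b (j v) (j w) = -e * b v w) (v w : E) :
    b (j v) w = -b v (j w) := by
  have := hc v (j w)
  rw [hsq, map_smul, smul_eq_mul] at this
  exact mul_left_cancel₀ he (by rw [this]; ring)

/-- By skewness g(X, JY) = -g(JX, Y), so the two conventions for the fundamental form differ by a
sign, which closedness ignores. -/
theorem isKahlerOn_iff {M : Set E} (hM : IsOpen M) {g : E → E →L[ℝ] E →L[ℝ] ℝ}
    {J : E → E →L[ℝ] E} : IsKahlerOn M g J ↔ IsHermitianKahlerOn (-1) M g J := by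
  have key : (∀ p ∈ M, ∀ v, J p (J p v) = (-1 : ℝ) • v) →
      (∀ p ∈ M, ∀ v w, g p (J p v) (J p w) = -(-1) * g p v w) →
      ∀ p ∈ M, ((g p).flip.comp (J p)).flip = -(g p).comp (J p) := fun h1 h2 p hp => by
    ext v w
    have := compatible_skew (by norm_num) (h1 p hp) (h2 p hp) v w
    simp [this]
  constructor
  · rintro ⟨h1, h2, h3, h4⟩
    have h2' := isComplexStructureOn_iff.1 h2
    have h3' : ∀ p ∈ M, ∀ v w, g p (J p v) (J p w) = -(-1) * g p v w := fun p hp v w => by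
      rw [h3 p hp]; ring
    exact ⟨h1, h2', h3', (IsClosedOn.neg_iff hM (key h2'.sq h3')).1 h4⟩
  · rintro ⟨h1, h2, h3, h4⟩
    exact ⟨h1, isComplexStructureOn_iff.2 h2, fun p hp v w => by rw [h3 p hp]; ring,
      (IsClosedOn.neg_iff hM (key h2.sq h3)).2 h4⟩

theorem isParaKahlerOn_iff {M : Set E} (hM : IsOpen M) {g : E → E →L[ℝ] E →L[ℝ] ℝ}
    {J : E → E →L[ℝ] E} : IsParaKahlerOn M g J ↔ IsHermitianKahlerOn 1 M g J := by
  constructor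
  · rintro ⟨h1, h2, h3, h4⟩
    exact ⟨h1, (isProductStructureOn_iff hM).1 h2, fun p hp v w => by rw [h3 p hp]; ring, h4⟩
  · rintro ⟨h1, h2, h3, h4⟩
    exact ⟨h1, (isProductStructureOn_iff hM).2 h2, fun p hp v w => by rw [h3 p hp]; ring, h4⟩

/-! ### Torsion and exterior derivative in a moving frame. -/

variable {ι : Type*} [Fintype ι]

/-- The fields `F i` form a smooth frame on `M`, with structure functions `c`. -/
structure IsFrameOn (M : Set E) (F : ι → E → E) (c : ι → ι → ι → E → ℝ) : Prop where
  smooth : ∀ i, ContDiffOn ℝ ∞ (F i) M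
  bracket : ∀ p ∈ M, ∀ i k, lieBracket ℝ (F i) (F k) p = ∑ l, c i k l p • F l p
  linearIndependent : ∀ p ∈ M, LinearIndependent ℝ fun i => F i p
  span : ∀ p ∈ M, ⊤ ≤ Submodule.span ℝ (Set.range fun i => F i p)

theorem lieBracket_sum_smul_left {f : ι → E → ℝ} {F : ι → E → E} {W : E → E} {p : E}
    (hf : ∀ i, DifferentiableAt ℝ (f i) p) (hF : ∀ i, DifferentiableAt ℝ (F i) p) :
    lieBracket ℝ (fun q => ∑ i, f i q • F i q) W p =
      ∑ i, (f i p • lieBracket ℝ (F i) W p - fderiv ℝ (f i) p (W p) • F i p) := by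
  simp only [lieBracket_eq]
  rw [fderiv_fun_sum fun i _ => (hf i).fun_smul (hF i), map_sum, sum_apply,
    ← Finset.sum_sub_distrib]
  refine Finset.sum_congr rfl fun i _ => ?_
  rw [fderiv_fun_smul (hf i) (hF i)]
  simp only [add_apply, smul_apply, ContinuousLinearMap.smulRight_apply,
    map_smul]
  module

theorem lieBracket_sum_smul_right {f : ι → E → ℝ} {F : ι → E → E} {W : E → E} {p : E}
    (hf : ∀ i, DifferentiableAt ℝ (f i) p) (hF : ∀ i, DifferentiableAt ℝ (F i) p) :
    lieBracket ℝ W (fun q => ∑ i, f i q • F i q) p =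
      ∑ i, (f i p • lieBracket ℝ W (F i) p + fderiv ℝ (f i) p (W p) • F i p) := by
  rw [lieBracket_swap, lieBracket_sum_smul_left hf hF, ← Finset.sum_neg_distrib]
  refine Finset.sum_congr rfl fun i _ => ?_
  rw [lieBracket_swap (V := W)]
  module

/-- The components in a frame of the torsion expression of `J`, where `J F_i = ∑ m_ik F_k`. -/
def nijenhuisCoeff (e : ℝ) (F : ι → E → E) (c : ι → ι → ι → E → ℝ) (m : ι → ι → E → ℝ)
    (i k r : ι) (p : E) : ℝ :=
  ∑ a, m i a p * fderiv ℝ (m k r) p (F a p) - ∑ b, m k b p * fderiv ℝ (m i r) p (F b p)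
    + ∑ a, ∑ b, m i a p * m k b p * c a b r p
    + ∑ l, fderiv ℝ (m i l) p (F k p) * m l r p - ∑ l, ∑ a, m i a p * c a k l p * m l r p
    - ∑ l, fderiv ℝ (m k l) p (F i p) * m l r p - ∑ l, ∑ b, m k b p * c i b l p * m l r p
    + e * c i k r p

theorem nijenhuis_frame {e : ℝ} {M : Set E} (hM : IsOpen M) {F : ι → E → E}
    {c : ι → ι → ι → E → ℝ} (hF : IsFrameOn M F c) {J : E → E →L[ℝ] E} {m : ι → ι → E → ℝ}
    (hm : ∀ i k, ContDiffOn ℝ ∞ (m i k) M)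
    (hJ : ∀ q ∈ M, ∀ i, J q (F i q) = ∑ k, m i k q • F k q) {p : E} (hp : p ∈ M) (i k : ι) :
    nijenhuis e J (F i) (F k) p = ∑ r, nijenhuisCoeff e F c m i k r p • F r p := by
  have dm : ∀ i k, DifferentiableAt ℝ (m i k) p := fun i k =>
    (hm i k).differentiableAt_of_isOpen hM hp
  have dF : ∀ i, DifferentiableAt ℝ (F i) p := fun i =>
    (hF.smooth i).differentiableAt_of_isOpen hM hp
  have ev : ∀ i, (fun q => J q (F i q)) =ᶠ[𝓝 p] fun q => ∑ k, m i k q • F k q := fun i =>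
    (hM.eventually_mem hp).mono fun q hq => hJ q hq i
  rw [nijenhuis, (ev i).lieBracket_vectorField_eq (ev k),
    (ev i).lieBracket_vectorField_eq EventuallyEq.rfl,
    EventuallyEq.rfl.lieBracket_vectorField_eq (ev k)]
  have r1 : lieBracket ℝ (fun q => ∑ k, m i k q • F k q) (fun q => ∑ l, m k l q • F l q) p =
      ∑ r, (∑ a, m i a p * fderiv ℝ (m k r) p (F a p) - ∑ b, m k b p * fderiv ℝ (m i r) p (F b p)
        + ∑ a, ∑ b, m i a p * m k b p * c a b r p) • F r p := by
    rw [lieBracket_sum_smul_left (dm i) dF]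
    simp only [lieBracket_sum_smul_right (dm k) dF, hF.bracket p hp, map_sum, map_smul,
      Finset.smul_sum, Finset.sum_smul, add_smul, sub_smul, smul_add, smul_smul,
      Finset.sum_add_distrib, Finset.sum_sub_distrib, smul_eq_mul]
    rw [Finset.sum_comm (f := fun x y => (m i x p * (fderiv ℝ (m k y) p) (F x p)) • F y p)]
    rw [Finset.sum_comm (f := fun x y => (m k y p * (fderiv ℝ (m i x) p) (F y p)) • F x p)]
    have : ∑ x, ∑ x_1, ∑ x_2, (m i x p * (m k x_1 p * c x x_1 x_2 p)) • F x_2 p =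
        ∑ x, ∑ x_1, ∑ x_2, (m i x_1 p * m k x_2 p * c x_1 x_2 x p) • F x p := by
      rw [Finset.sum_comm_cycle]
      refine Finset.sum_congr rfl fun x _ => Finset.sum_congr rfl fun y _ =>
        Finset.sum_congr rfl fun z _ => ?_
      rw [mul_assoc]
    rw [this]
    abel
  have hJsum : ∀ x : ι → ℝ, J p (∑ l, x l • F l p) = ∑ r, (∑ l, x l * m l r p) • F r p := by
    intro x
    simp only [map_sum, map_smul, hJ p hp, Finset.smul_sum, Finset.sum_smul, smul_smul]
    exact Finset.sum_comm
  have r2 : lieBracket ℝ (fun q => ∑ k, m i k q • F k q) (F k) p =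
      ∑ l, (∑ a, m i a p * c a k l p - fderiv ℝ (m i l) p (F k p)) • F l p := by
    rw [lieBracket_sum_smul_left (dm i) dF]
    simp only [hF.bracket p hp, Finset.smul_sum, Finset.sum_smul, sub_smul, smul_smul,
      Finset.sum_sub_distrib]
    rw [Finset.sum_comm]
  have r3 : lieBracket ℝ (F i) (fun q => ∑ l, m k l q • F l q) p =
      ∑ l, (∑ b, m k b p * c i b l p + fderiv ℝ (m k l) p (F i p)) • F l p := by
    rw [lieBracket_sum_smul_right (dm k) dF]
    simp only [hF.bracket p hp, Finset.smul_sum, Finset.sum_smul, add_smul, smul_smul,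
      Finset.sum_add_distrib]
    rw [Finset.sum_comm]
  rw [r1, r2, r3, hJsum, hJsum, hF.bracket p hp, Finset.smul_sum, ← Finset.sum_sub_distrib,
    ← Finset.sum_sub_distrib, ← Finset.sum_add_distrib]
  refine Finset.sum_congr rfl fun r _ => ?_
  rw [smul_smul, ← sub_smul, ← sub_smul, ← add_smul]
  congr 1
  simp only [nijenhuisCoeff, add_mul, sub_mul, Finset.sum_add_distrib, Finset.sum_sub_distrib,
    Finset.sum_mul]
  ring

/-- The components in a frame of the exterior derivative of a two-form with components `w`. -/
def closedCoeff (F : ι → E → E) (c : ι → ι → ι → E → ℝ) (w : ι → ι → E → ℝ)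
    (i j k : ι) (p : E) : ℝ :=
  fderiv ℝ (w j k) p (F i p) - fderiv ℝ (w i k) p (F j p) + fderiv ℝ (w i j) p (F k p)
    - ∑ l, c i j l p * w l k p + ∑ l, c i k l p * w l j p - ∑ l, c j k l p * w l i p

theorem cyclicDeriv_frame {M : Set E} (hM : IsOpen M) {F : ι → E → E}
    {c : ι → ι → ι → E → ℝ} (hF : IsFrameOn M F c) {S : E → E →L[ℝ] E →L[ℝ] ℝ}
    {w : ι → ι → E → ℝ} (hw : ∀ q ∈ M, ∀ i k, S q (F i q) (F k q) = w i k q) {p : E}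
    (hp : p ∈ M) (i j k : ι) :
    cyclicDeriv S (F i) (F j) (F k) p = closedCoeff F c w i j k p := by
  have ev : ∀ i k, (fun q => S q (F i q) (F k q)) =ᶠ[𝓝 p] w i k := fun i k =>
    (hM.eventually_mem hp).mono fun q hq => hw q hq i k
  simp only [cyclicDeriv, closedCoeff, (ev _ _).fderiv_eq, hF.bracket p hp, map_sum, map_smul,
    sum_apply, smul_apply, smul_eq_mul, hw p hp]

theorem isClosedOn_iff_frame {M : Set E} (hM : IsOpen M) {F : ι → E → E}
    {c : ι → ι → ι → E → ℝ} (hF : IsFrameOn M F c) {S : E → E →L[ℝ] E →L[ℝ] ℝ}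
    (hS : ContDiffOn ℝ ∞ S M) (hskew : ∀ q ∈ M, ∀ v w, S q v w = -S q w v)
    {w : ι → ι → E → ℝ} (hw : ∀ q ∈ M, ∀ i k, S q (F i q) (F k q) = w i k q) :
    IsClosedOn M S ↔ ∀ p ∈ M, ∀ i j k, closedCoeff F c w i j k p = 0 := by
  refine forall₂_congr fun p hp => ?_
  have dF : ∀ i, DifferentiableAt ℝ (F i) p := fun i =>
    (hF.smooth i).differentiableAt_of_isOpen hM hp
  have key : ∀ i j k, extDeriv (fun q => twoForm (S q)) p ![F i p, F j p, F k p] =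
      closedCoeff F c w i j k p := fun i j k => by
    rw [extDeriv_twoForm hM hS hskew hp (dF i) (dF j) (dF k), cyclicDeriv_frame hM hF hw hp]
  constructor
  · intro h i j k
    rw [← key, h]; rfl
  · intro h
    apply ContinuousAlternatingMap.toAlternatingMap_injective
    refine Module.Basis.ext_alternating
      (Module.Basis.mk (hF.linearIndependent p hp) (hF.span p hp)) fun v _ => ?_
    have : (fun i => (Module.Basis.mk (hF.linearIndependent p hp) (hF.span p hp)) (v i)) =
        ![F (v 0) p, F (v 1) p, F (v 2) p] := by
      ext i; fin_cases i <;> simp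
    rw [this]
    exact (key _ _ _).trans (h _ _ _)

/-- By `nijenhuis_eq` the torsion at p is bilinear in the values X p and Y p, so it vanishes as soon
as it does on the frame fields. -/
theorem isIntegrableOn_iff_frame {e : ℝ} {M : Set E} (hM : IsOpen M) {F : ι → E → E}
    {c : ι → ι → ι → E → ℝ} (hF : IsFrameOn M F c) {J : E → E →L[ℝ] E}
    (hJs : ContDiffOn ℝ ∞ J M) (hsq : ∀ p ∈ M, ∀ v, J p (J p v) = e • v) {m : ι → ι → E → ℝ}
    (hm : ∀ i k, ContDiffOn ℝ ∞ (m i k) M)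
    (hJ : ∀ q ∈ M, ∀ i, J q (F i q) = ∑ k, m i k q • F k q) :
    IsIntegrableOn e M J ↔ ∀ p ∈ M, ∀ i k r, nijenhuisCoeff e F c m i k r p = 0 := by
  constructor
  · intro h p hp i k r
    have := h.nijenhuis (F i) (F k) (hF.smooth i) (hF.smooth k) p hp
    rw [nijenhuis_frame hM hF hm hJ hp] at this
    exact Fintype.linearIndependent_iff.1 (hF.linearIndependent p hp) _ this r
  · intro h
    refine ⟨hJs, hsq, fun X Y hX hY p hp => ?_⟩
    have dJ := hJs.differentiableAt_of_isOpen hM hp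
    have dF : ∀ i, DifferentiableAt ℝ (F i) p := fun i =>
      (hF.smooth i).differentiableAt_of_isOpen hM hp
    rw [nijenhuis_eq dJ (hX.differentiableAt_of_isOpen hM hp)
      (hY.differentiableAt_of_isOpen hM hp) (hsq p hp)]
    have key : ∀ i k, nijenhuisForm J p (F i p) (F k p) = 0 := fun i k => by
      rw [← nijenhuis_eq dJ (dF i) (dF k) (hsq p hp), nijenhuis_frame hM hF hm hJ hp]
      simp [h p hp]
    have span : ∀ v, ∃ a : ι → ℝ, v = ∑ i, a i • F i p := fun v => by
      obtain ⟨a, ha⟩ := (Submodule.mem_span_range_iff_exists_fun ℝ).1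
        (hF.span p hp (Submodule.mem_top (x := v)))
      exact ⟨a, ha.symm⟩
    obtain ⟨a, ha⟩ := span (X p)
    obtain ⟨b, hb⟩ := span (Y p)
    have add_l : ∀ v v' w, nijenhuisForm J p (v + v') w =
        nijenhuisForm J p v w + nijenhuisForm J p v' w := fun v v' w => by
      simp only [nijenhuisForm, map_add, add_apply]; abel
    have add_r : ∀ v w w', nijenhuisForm J p v (w + w') =
        nijenhuisForm J p v w + nijenhuisForm J p v w' := fun v v' w => by
      simp only [nijenhuisForm, map_add, add_apply]; abel
    have smul_l : ∀ (s : ℝ) v w, nijenhuisForm J p (s • v) w = s • nijenhuisForm J p v w :=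
      fun s v w => by
        simp only [nijenhuisForm, map_smul, smul_apply]; module
    have smul_r : ∀ (s : ℝ) v w, nijenhuisForm J p v (s • w) = s • nijenhuisForm J p v w :=
      fun s v w => by
        simp only [nijenhuisForm, map_smul, smul_apply]; module
    let L : E →ₗ[ℝ] E →ₗ[ℝ] E := LinearMap.mk₂ ℝ (nijenhuisForm J p) add_l smul_l add_r smul_r
    change L (X p) (Y p) = 0
    rw [ha, hb]
    simp only [map_sum, LinearMap.sum_apply, map_smul, LinearMap.smul_apply]
    refine Finset.sum_eq_zero fun i _ => ?_
    rw [Finset.smul_sum]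
    refine Finset.sum_eq_zero fun k _ => ?_
    rw [show L (F k p) (F i p) = 0 from key k i]
    simp

end FrameCalculus

/-! ### The metric g, its null frame and the brackets of the frame. -/

section RiemannExtension

variable {U : Set Plane} (γ : TorsionFreeConnection U)

theorem thomas_symm (C A B : Fin 2) {x : Plane} (hx : x ∈ U) :
    thomas γ C A B x = thomas γ C B A x := by
  simp only [thomas, γ.symm C A B x hx]; ring

theorem thomas_trace (B : Fin 2) {x : Plane} (hx : x ∈ U) :
    thomas γ 0 0 B x + thomas γ 1 1 B x = 0 := by
  have h := fun C => γ.symm C 0 1 x hx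
  fin_cases B <;> simp [thomas, kron, Fin.sum_univ_two] <;> first | rw [h] | rw [← h]
  all_goals ring

theorem thomas_smooth (C A B : Fin 2) : ContDiffOn ℝ ∞ (thomas γ C A B) U := by
  have h := γ.smooth
  unfold thomas
  simp only [Fin.sum_univ_two]
  exact (((h _ _ _).sub ((contDiffOn_const.mul ((h _ _ _).add (h _ _ _))).mul
    contDiffOn_const))).sub ((contDiffOn_const.mul ((h _ _ _).add (h _ _ _))).mul contDiffOn_const)

/-- The change δ_A^C β_B + δ_B^C β_A has trace 3β, which is exactly what the two corrections by a
third of the trace remove. -/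
theorem thomas_congr {γ' : TorsionFreeConnection U} (h : ProjEquiv γ γ') (C A B : Fin 2)
    {x : Plane} (hx : x ∈ U) : thomas γ' C A B x = thomas γ C A B x := by
  obtain ⟨β, -, h⟩ := h
  simp only [thomas, h x hx, Fin.sum_univ_two]
  fin_cases C <;> fin_cases A <;> fin_cases B <;> simp [kron] <;> ring

/-- The coordinate vector field `∂/∂x^A` on `TU`. -/
def baseVec (A : Fin 2) : Plane × Plane := (Pi.single A 1, 0)

/-- The coordinate vector field `∂/∂z_A` on `TU`. -/
def vertVec (A : Fin 2) : Plane × Plane := (0, fun B => epsLow B A)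

/-- The function `Π^C_{AB} z_C` on `TU`. -/
def fibreSymbol (A B : Fin 2) (q : Plane × Plane) : ℝ :=
  ∑ C, thomas γ C A B q.1 * dzLow C q

/-- The horizontal lift `∂/∂x^A + Π^C_{AB} z_C ∂/∂z_B`. -/
def horizVec (A : Fin 2) (q : Plane × Plane) : Plane × Plane :=
  baseVec A + ∑ B, fibreSymbol γ A B q • vertVec B

/-- The one-form `dz_B - Π^C_{AB} z_C dx^A`. -/
def vertForm (B : Fin 2) (q : Plane × Plane) : Plane × Plane →L[ℝ] ℝ :=
  dzLow B - ∑ A, fibreSymbol γ A B q • dx A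

theorem dx_baseVec (A B : Fin 2) : dx A (baseVec B) = kron A B := by
  simp [dx, baseVec, kron, Pi.single_apply]

theorem dx_vertVec (A B : Fin 2) : dx A (vertVec B) = 0 := by simp [dx, vertVec]

theorem dzLow_baseVec (A B : Fin 2) : dzLow A (baseVec B) = 0 := by simp [dzLow, baseVec]

theorem dzLow_vertVec (A B : Fin 2) : dzLow A (vertVec B) = kron A B := by
  fin_cases A <;> fin_cases B <;> simp [dzLow, vertVec, kron, epsLow]

theorem dx_horizVec (A B : Fin 2) (q : Plane × Plane) : dx A (horizVec γ B q) = kron A B := by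
  simp [horizVec, dx_baseVec, dx_vertVec]

theorem vertForm_vertVec (A B : Fin 2) (q : Plane × Plane) :
    vertForm γ A q (vertVec B) = kron A B := by
  simp [vertForm, dzLow_vertVec, dx_vertVec]

theorem vertForm_horizVec (A B : Fin 2) (q : Plane × Plane) :
    vertForm γ A q (horizVec γ B q) = 0 := by
  simp only [vertForm, horizVec, sub_apply, add_apply, map_add, map_smul, smul_apply,
    dzLow_baseVec, dzLow_vertVec, dx_baseVec, dx_vertVec, Fin.sum_univ_two, smul_eq_mul]
  fin_cases A <;> fin_cases B <;> simp [kron]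

theorem eq_sum_frame (q v : Plane × Plane) :
    v = ∑ A, dx A v • horizVec γ A q + ∑ A, vertForm γ A q v • vertVec A := by
  ext i <;> fin_cases i <;>
    simp [horizVec, baseVec, vertVec, vertForm, dx, dzLow, epsLow, Fin.sum_univ_two] <;> ring

/-- Since Π is symmetric, the quadratic term can be absorbed into dz_A: g is the symmetric product
of dx^A with θ_A = dz_A - Π^C_{AB} z_C dx^B, summed over A. Hence both distributions are null and
g(h_A, v^B) = δ_A^B / 2. -/
theorem riemannianExtension_apply {q : Plane × Plane} (hq : q ∈ tangentTotal U)
    (v w : Plane × Plane) : riemannianExtension γ q v w =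
      (1 / 2) * ∑ A, (vertForm γ A q v * dx A w + dx A v * vertForm γ A q w) := by
  have h := fun C => thomas_symm γ C 0 1 (x := q.1) hq.1
  simp [riemannianExtension, symProd, vertForm, Fin.sum_univ_two, fibreSymbol, h]
  ring

theorem dzLow_smooth (C : Fin 2) : ContDiff ℝ ∞ (fun q => dzLow C q) := (dzLow C).contDiff

theorem isOpen_tangentTotal (hU : IsOpen U) : IsOpen (tangentTotal U) := hU.prod isOpen_univ

theorem ContDiffOn.comp_fst_tangentTotal {f : Plane → ℝ} (hf : ContDiffOn ℝ ∞ f U) :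
    ContDiffOn ℝ ∞ (fun q : Plane × Plane => f q.1) (tangentTotal U) :=
  hf.comp contDiff_fst.contDiffOn fun _ hq => hq.1

theorem fibreSymbol_smooth (A B : Fin 2) :
    ContDiffOn ℝ ∞ (fibreSymbol γ A B) (tangentTotal U) := by
  unfold fibreSymbol
  exact ContDiffOn.sum fun C _ => (thomas_smooth γ C A B).comp_fst_tangentTotal.mul
    (dzLow_smooth C).contDiffOn

theorem horizVec_smooth (A : Fin 2) : ContDiffOn ℝ ∞ (horizVec γ A) (tangentTotal U) := by
  unfold horizVec
  exact contDiffOn_const.add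
    (ContDiffOn.sum fun B _ => (fibreSymbol_smooth γ A B).smul contDiffOn_const)

theorem vertForm_smooth (A : Fin 2) : ContDiffOn ℝ ∞ (vertForm γ A) (tangentTotal U) := by
  unfold vertForm
  exact contDiffOn_const.sub
    (ContDiffOn.sum fun B _ => (fibreSymbol_smooth γ B A).smul contDiffOn_const)

theorem ContDiffOn.smul_fixed {E F : Type*} [NormedAddCommGroup E] [NormedSpace ℝ E]
    [NormedAddCommGroup F] [NormedSpace ℝ F] {M : Set E} {f : E → ℝ} (hf : ContDiffOn ℝ ∞ f M)
    (v : F) : ContDiffOn ℝ ∞ (fun q => f q • v) M :=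
  hf.smul contDiffOn_const

theorem riemannianExtension_smooth :
    ContDiffOn ℝ ∞ (riemannianExtension γ) (tangentTotal U) := by
  unfold riemannianExtension
  exact contDiffOn_const.sub (ContDiffOn.sum fun A _ => ContDiffOn.sum fun B _ =>
    ContDiffOn.sum fun C _ => ((thomas_smooth γ C A B).comp_fst_tangentTotal.mul
      (dzLow_smooth C).contDiffOn).smul_fixed _)

theorem riemannianExtension_congr {γ' : TorsionFreeConnection U} (h : ProjEquiv γ γ')
    {p : Plane × Plane} (hp : p ∈ tangentTotal U) :
    riemannianExtension γ' p = riemannianExtension γ p := by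
  simp only [riemannianExtension, thomas_congr γ h _ _ _ hp.1]

theorem eq_of_forms_eq (q : Plane × Plane) {v : Plane × Plane} (h1 : ∀ A, dx A v = 0)
    (h2 : ∀ A, vertForm γ A q v = 0) : v = 0 := by
  rw [eq_sum_frame γ q v]; simp [h1, h2]

theorem riemannianExtension_isMetricOn :
    IsMetricOn (tangentTotal U) (riemannianExtension γ) where
  smooth := riemannianExtension_smooth γ
  symm p hp v w := by
    rw [riemannianExtension_apply γ hp, riemannianExtension_apply γ hp]
    congr 1
    exact Finset.sum_congr rfl fun A _ => by ring
  nondeg p hp v h := by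
    refine eq_of_forms_eq γ p (fun A => ?_) fun A => ?_
    · have := h (vertVec A)
      rw [riemannianExtension_apply γ hp] at this
      fin_cases A <;> simpa [dx_vertVec, vertForm_vertVec, kron] using this
    · have := h (horizVec γ A p)
      rw [riemannianExtension_apply γ hp] at this
      fin_cases A <;> simpa [dx_horizVec, vertForm_horizVec, kron] using this

/-- The frame of horizontal lifts and vertical coordinate fields. -/
def tangentFrame : Fin 2 ⊕ Fin 2 → Plane × Plane → Plane × Plane :=
  Sum.elim (horizVec γ) fun A _ => vertVec A

theorem tangentFrame_linearIndependent (p : Plane × Plane) :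
    LinearIndependent ℝ fun i => tangentFrame γ i p := by
  refine Fintype.linearIndependent_iff.2 fun a ha => ?_
  simp only [Fintype.sum_sum_type, tangentFrame, Sum.elim_inl, Sum.elim_inr] at ha
  rintro (A | A)
  · have := congrArg (dx A) ha
    fin_cases A <;> simpa [dx_horizVec, dx_vertVec, kron] using this
  · have := congrArg (vertForm γ A p) ha
    fin_cases A <;> simpa [vertForm_horizVec, vertForm_vertVec, kron] using this

theorem tangentFrame_span (p : Plane × Plane) :
    ⊤ ≤ Submodule.span ℝ (Set.range fun i => tangentFrame γ i p) := fun v _ => by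
  rw [eq_sum_frame γ p v]
  refine Submodule.add_mem _ (Submodule.sum_mem _ fun A _ => ?_)
    (Submodule.sum_mem _ fun A _ => ?_)
  · exact Submodule.smul_mem _ _ (Submodule.subset_span ⟨Sum.inl A, rfl⟩)
  · exact Submodule.smul_mem _ _ (Submodule.subset_span ⟨Sum.inr A, rfl⟩)

theorem riemannianExtension_neutral {p : Plane × Plane} (hp : p ∈ tangentTotal U) :
    HasNeutralSignature (riemannianExtension γ p) := by
  -- As g(h_A, v^A) = 1/2, the vectors h_A ± v^A have square ±1.
  let e : Fin 4 → Plane × Plane := ![horizVec γ 0 p + vertVec 0, horizVec γ 1 p + vertVec 1,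
    horizVec γ 0 p - vertVec 0, horizVec γ 1 p - vertVec 1]
  have he : ∀ i j, riemannianExtension γ p (e i) (e j) =
      Matrix.diagonal (![1, 1, -1, -1] : Fin 4 → ℝ) i j := fun i j => by
    rw [riemannianExtension_apply γ hp]
    fin_cases i <;> fin_cases j <;>
      simp [e, dx_horizVec, dx_vertVec, vertForm_horizVec, vertForm_vertVec, kron] <;> norm_num
  have hli : LinearIndependent ℝ e := by
    refine Fintype.linearIndependent_iff.2 fun a ha j => ?_
    have := congrArg (riemannianExtension γ p (e j)) ha
    simp only [map_sum, map_smul, he, map_zero, smul_eq_mul] at this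
    fin_cases j <;> simpa [Fin.sum_univ_four, Matrix.diagonal] using this
  refine ⟨basisOfLinearIndependentOfCardEqFinrank hli (by simp), fun i j => ?_⟩
  simp [he]

/-- The curvature symbol `∂_0 Π^C_{1B} - ∂_1 Π^C_{0B} + Π^C_{0E} Π^E_{1B} - Π^C_{1E} Π^E_{0B}`. -/
def curvSymbol (C B : Fin 2) (x : Plane) : ℝ :=
  partialD 0 (thomas γ C 1 B) x - partialD 1 (thomas γ C 0 B) x
    + ∑ E, (thomas γ C 0 E x * thomas γ E 1 B x - thomas γ C 1 E x * thomas γ E 0 B x)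

/-- The function `R^C_B z_C` on `TU`. -/
def fibreCurv (B : Fin 2) (q : Plane × Plane) : ℝ := ∑ C, curvSymbol γ C B q.1 * dzLow C q

/-- The structure functions of `tangentFrame`. -/
def tangentStructure : Fin 2 ⊕ Fin 2 → Fin 2 ⊕ Fin 2 → Fin 2 ⊕ Fin 2 → Plane × Plane → ℝ
  | .inl A, .inl B, .inr C, q => epsLow A B * fibreCurv γ C q
  | .inl A, .inr B, .inr C, q => -thomas γ B A C q.1
  | .inr B, .inl A, .inr C, q => thomas γ B A C q.1
  | _, _, _, _ => 0

variable {γ}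

theorem fderiv_comp_fst {f : Plane → ℝ} {q : Plane × Plane} (hf : DifferentiableAt ℝ f q.1)
    (v : Plane × Plane) : fderiv ℝ (fun q : Plane × Plane => f q.1) q v = fderiv ℝ f q.1 v.1 := by
  have := (hf.hasFDerivAt.comp q hasFDerivAt_fst).fderiv
  rw [show (fun q : Plane × Plane => f q.1) = f ∘ Prod.fst from rfl, this]
  rfl

theorem horizVec_fst (A : Fin 2) (q : Plane × Plane) : (horizVec γ A q).1 = Pi.single A 1 := by
  simp [horizVec, baseVec, vertVec]

theorem fderiv_comp_fst_horizVec {f : Plane → ℝ} {q : Plane × Plane}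
    (hf : DifferentiableAt ℝ f q.1) (A : Fin 2) :
    fderiv ℝ (fun q : Plane × Plane => f q.1) q (horizVec γ A q) = partialD A f q.1 := by
  rw [fderiv_comp_fst hf, horizVec_fst]; rfl

theorem fderiv_comp_fst_vertVec {f : Plane → ℝ} {q : Plane × Plane}
    (hf : DifferentiableAt ℝ f q.1) (A : Fin 2) :
    fderiv ℝ (fun q : Plane × Plane => f q.1) q (vertVec A) = 0 := by
  rw [fderiv_comp_fst hf]; simp [vertVec]

theorem dzLow_horizVec (C A : Fin 2) (q : Plane × Plane) :
    dzLow C (horizVec γ A q) = fibreSymbol γ A C q := by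
  simp only [horizVec, map_add, map_smul, dzLow_baseVec, dzLow_vertVec, smul_eq_mul,
    Fin.sum_univ_two]
  fin_cases C <;> simp [kron]

/-- The derivative of a function that is linear along the fibres. -/
theorem fderiv_fibreLinear {f : Fin 2 → Plane → ℝ} {q : Plane × Plane}
    (hf : ∀ C, DifferentiableAt ℝ (f C) q.1) (v : Plane × Plane) :
    fderiv ℝ (fun q : Plane × Plane => ∑ C, f C q.1 * dzLow C q) q v =
      ∑ C, (fderiv ℝ (f C) q.1 v.1 * dzLow C q + f C q.1 * dzLow C v) := by
  have h1 : ∀ C, DifferentiableAt ℝ (fun q : Plane × Plane => f C q.1) q := fun C =>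
    (hf C).comp q differentiableAt_fst
  have h2 : ∀ C, DifferentiableAt ℝ (fun q : Plane × Plane => dzLow C q) q := fun C =>
    (dzLow C).differentiableAt
  rw [fderiv_fun_sum fun C _ => (h1 C).fun_mul (h2 C), sum_apply]
  refine Finset.sum_congr rfl fun C _ => ?_
  rw [fderiv_fun_mul (h1 C) (h2 C), add_apply, smul_apply, smul_apply, fderiv_comp_fst (hf C),
    ContinuousLinearMap.fderiv]
  simp only [smul_eq_mul]
  ring

theorem thomas_differentiableAt (hU : IsOpen U) {x : Plane} (hx : x ∈ U) (C A B : Fin 2) :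
    DifferentiableAt ℝ (thomas γ C A B) x :=
  (thomas_smooth γ C A B).differentiableAt_of_isOpen hU hx

theorem fderiv_fibreSymbol_horizVec (hU : IsOpen U) {q : Plane × Plane}
    (hq : q ∈ tangentTotal U) (A B D : Fin 2) :
    fderiv ℝ (fibreSymbol γ A B) q (horizVec γ D q) =
      ∑ C, (partialD D (thomas γ C A B) q.1 * dzLow C q +
        thomas γ C A B q.1 * fibreSymbol γ D C q) := by
  have := fderiv_fibreLinear (f := fun C => thomas γ C A B) (q := q)
    (fun C => thomas_differentiableAt hU hq.1 C A B) (horizVec γ D q)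
  simp only [dzLow_horizVec, horizVec_fst] at this
  exact this

theorem fderiv_fibreSymbol_vertVec (hU : IsOpen U) {q : Plane × Plane}
    (hq : q ∈ tangentTotal U) (A B D : Fin 2) :
    fderiv ℝ (fibreSymbol γ A B) q (vertVec D) = thomas γ D A B q.1 := by
  have := fderiv_fibreLinear (f := fun C => thomas γ C A B) (q := q)
    (fun C => thomas_differentiableAt hU hq.1 C A B) (vertVec D)
  rw [show (vertVec D).1 = 0 from rfl] at this
  refine this.trans ?_
  fin_cases D <;> simp [dzLow_vertVec, kron]

theorem fderiv_horizVec (hU : IsOpen U) {q : Plane × Plane} (hq : q ∈ tangentTotal U)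
    (A : Fin 2) (v : Plane × Plane) :
    fderiv ℝ (horizVec γ A) q v = ∑ B, fderiv ℝ (fibreSymbol γ A B) q v • vertVec B := by
  have h1 : ∀ B, DifferentiableAt ℝ (fibreSymbol γ A B) q := fun B =>
    (fibreSymbol_smooth γ A B).differentiableAt_of_isOpen (isOpen_tangentTotal hU) hq
  unfold horizVec
  rw [fderiv_const_add, fderiv_fun_sum fun B _ => (h1 B).fun_smul (differentiableAt_const _),
    sum_apply]
  refine Finset.sum_congr rfl fun B _ => ?_
  rw [fderiv_fun_smul (h1 B) (differentiableAt_const _)]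
  simp

/-- All brackets are vertical, because the base components of the fields are constant. The vertical
fields commute, a mixed bracket differentiates the fibre-linear functions Π^C_{AB} z_C, and [h_0,
h_1] is the curvature contracted with z. -/
theorem tangentFrame_isFrameOn (hU : IsOpen U) :
    IsFrameOn (tangentTotal U) (tangentFrame γ) (tangentStructure γ) where
  smooth := by
    rintro (A | A)
    · exact horizVec_smooth γ A
    · exact contDiffOn_const
  bracket p hp := by
    have hvv : ∀ A B, fderiv ℝ (fun _ : Plane × Plane => vertVec A) p B = 0 := by simp
    have hs := fun C => thomas_symm γ C 0 1 (x := p.1) hp.1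
    rintro (A | A) (B | B) <;>
      simp only [tangentFrame, Sum.elim_inl, Sum.elim_inr, lieBracket_eq, fderiv_horizVec hU hp,
        Fintype.sum_sum_type, tangentStructure, fderiv_fibreSymbol_vertVec hU hp,
        fderiv_fibreSymbol_horizVec hU hp, hvv, zero_smul, Finset.sum_const_zero, zero_add,
        zero_sub, sub_zero, ← Finset.sum_neg_distrib, neg_smul]
    -- The case of two horizontal fields is the only one left.
    rw [← Finset.sum_sub_distrib]
    refine Finset.sum_congr rfl fun C _ => ?_
    rw [← sub_smul]
    congr 1
    fin_cases A <;> fin_cases B <;>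
      simp [epsLow, fibreCurv, curvSymbol, fibreSymbol, Fin.sum_univ_two, hs] <;> ring
  linearIndependent p _ := tangentFrame_linearIndependent γ p
  span p _ := tangentFrame_span γ p

end RiemannExtension

/-! ### J preserving the horizontal and vertical distributions: the Weyl equation. -/

section DualStructure

/-- The pointwise relation `2 κ ∇_C j_{AB} = κ_A j_{CB} + κ_B j_{AC} - κ_C j_{AB}` for the trace-free
`j_A^B = [[a, b], [c, -a]]`, where `X`, `Y`, `Z` are the covariant derivatives of `a`, `b`, `c`
and `K` is the derivative of `κ`. -/
structure WeylParallel (κ a b c : ℝ) (K X Y Z : Fin 2 → ℝ) : Prop where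
  x0 : 2 * κ * X 0 = -b * K 1
  x1 : 2 * κ * X 1 = c * K 0
  y0 : 2 * κ * Y 0 = b * K 0
  y1 : 2 * κ * Y 1 = -2 * a * K 0 - b * K 1
  z0 : 2 * κ * Z 0 = 2 * a * K 1 - c * K 0
  z1 : 2 * κ * Z 1 = c * K 1

/-- All the equations are linear in the derivatives X, Y, Z: one is the derivative of a² + bc = e,
two come from closedness and five from the torsion. Elimination gives four of the relations
multiplied by e = a² + bc, which is then cancelled; closedness supplies the other two. -/
theorem weylParallel_of_equations {κ a b c e : ℝ} {K X Y Z : Fin 2 → ℝ} (he : e ≠ 0)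
    (hsq : a ^ 2 + b * c = e) (hsq0 : 2 * a * X 0 + b * Z 0 + c * Y 0 = 0)
    (hcl0 : K 0 * c + κ * Z 0 - K 1 * a - κ * X 1 = 0)
    (hcl1 : -(K 0 * a) - κ * X 0 - K 1 * b - κ * Y 1 = 0)
    (h000 : 2 * a * X 0 + b * (X 1 + Z 0) = 0) (h001 : 2 * a * Y 0 + b * (Y 1 - X 0) = 0)
    (h010 : b * Z 1 + c * X 0 = 0)
    (h110 : c * (Z 0 + X 1) = 2 * a * Z 1) (h111 : 2 * a * X 1 + c * (Y 1 - X 0) = 0) :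
    WeylParallel κ a b c K X Y Z := by
  have x0 : 2 * κ * X 0 = -b * K 1 := mul_left_cancel₀ he (by grind)
  have x1 : 2 * κ * X 1 = c * K 0 := mul_left_cancel₀ he (by grind)
  have y1 : 2 * κ * Y 1 = -2 * a * K 0 - b * K 1 := by linear_combination -2 * hcl1 - x0
  have z0 : 2 * κ * Z 0 = 2 * a * K 1 - c * K 0 := by linear_combination 2 * hcl0 + x1
  exact ⟨x0, x1, mul_left_cancel₀ he (by grind), y1, z0, mul_left_cancel₀ he (by grind)⟩

/-- The trace-free matrix `[[a, b], [c, -a]]` of functions. -/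
def traceFree {E : Type*} (a b c : E → ℝ) : Fin 2 → Fin 2 → E → ℝ := ![![a, b], ![c, -a]]

/-- The matrix in `tangentFrame` of the endomorphism `h_A ↦ j_A^B h_B`, `v^B ↦ -j_A^B v^A`. -/
def dualMatrix (a b c : Plane × Plane → ℝ) :
    Fin 2 ⊕ Fin 2 → Fin 2 ⊕ Fin 2 → Plane × Plane → ℝ
  | .inl A, .inl B => traceFree a b c A B
  | .inr B, .inr A => -traceFree a b c A B
  | _, _ => 0

/-- The components in `tangentFrame` of the two-form of `dualMatrix` for the metric `κ g`. -/
def dualForm (κ a b c : Plane × Plane → ℝ) :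
    Fin 2 ⊕ Fin 2 → Fin 2 ⊕ Fin 2 → Plane × Plane → ℝ
  | .inl A, .inr B => (1 / 2 : ℝ) • (κ * traceFree a b c A B)
  | .inr B, .inl A => (-(1 / 2) : ℝ) • (κ * traceFree a b c A B)
  | _, _ => 0

variable {U : Set Plane} {γ : TorsionFreeConnection U}

/-- `∇_C a` for the entry `a = j_0^0`. -/
def covA (γ : TorsionFreeConnection U) (a b c : Plane × Plane → ℝ) (q : Plane × Plane)
    (C : Fin 2) : ℝ :=
  fderiv ℝ a q (horizVec γ C q) + thomas γ 0 C 1 q.1 * b q - thomas γ 1 C 0 q.1 * c q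

/-- `∇_C b` for the entry `b = j_0^1`. -/
def covB (γ : TorsionFreeConnection U) (a b : Plane × Plane → ℝ) (q : Plane × Plane)
    (C : Fin 2) : ℝ :=
  fderiv ℝ b q (horizVec γ C q) + 2 * thomas γ 1 C 0 q.1 * a q
    + (thomas γ 1 C 1 q.1 - thomas γ 0 C 0 q.1) * b q

/-- `∇_C c` for the entry `c = j_1^0`. -/
def covC (γ : TorsionFreeConnection U) (a c : Plane × Plane → ℝ) (q : Plane × Plane)
    (C : Fin 2) : ℝ :=
  fderiv ℝ c q (horizVec γ C q) - 2 * thomas γ 0 C 1 q.1 * a q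
    + (thomas γ 0 C 0 q.1 - thomas γ 1 C 1 q.1) * c q

theorem thomas_one_zero_one {x : Plane} (hx : x ∈ U) : thomas γ 1 0 1 x = -thomas γ 0 0 0 x := by
  rw [thomas_symm γ 1 0 1 hx]; linear_combination thomas_trace γ 0 hx

theorem thomas_one_one_one {x : Plane} (hx : x ∈ U) : thomas γ 1 1 1 x = -thomas γ 0 0 1 x := by
  linear_combination thomas_trace γ 1 hx

/-- The components used are the vertical part of N(h_A, v^B) and dΩ(h_0, h_1, v^A), where Ω is the
fundamental form. They contain no vertical derivative of κ, a, b, c, so nothing has to be assumed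
about the dependence on the fibre coordinate. -/
theorem weylParallel_of_dual {e : ℝ} (he : e ≠ 0) {κ a b c : Plane × Plane → ℝ}
    {q : Plane × Plane} (hq : q ∈ tangentTotal U) (hκ : DifferentiableAt ℝ κ q)
    (ha : DifferentiableAt ℝ a q) (hb : DifferentiableAt ℝ b q) (hc : DifferentiableAt ℝ c q)
    (hsq : ∀ᶠ p in 𝓝 q, a p ^ 2 + b p * c p = e)
    (hN : ∀ i k r, nijenhuisCoeff e (tangentFrame γ) (tangentStructure γ) (dualMatrix a b c)
      i k r q = 0)
    (hcl : ∀ i j k, closedCoeff (tangentFrame γ) (tangentStructure γ) (dualForm κ a b c)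
      i j k q = 0) :
    WeylParallel (κ q) (a q) (b q) (c q) (fun C => fderiv ℝ κ q (horizVec γ C q))
      (covA γ a b c q) (covB γ a b q) (covC γ a c q) := by
  have hs := fun C => thomas_symm γ C 1 0 (x := q.1) hq.1
  have ht := thomas_one_zero_one (γ := γ) hq.1
  have ht' := thomas_one_one_one (γ := γ) hq.1
  have hd : ∀ v, 2 * a q * fderiv ℝ a q v + (b q * fderiv ℝ c q v + c q * fderiv ℝ b q v) = 0 := by
    intro v
    have h1 : (fun p => a p ^ 2 + b p * c p) =ᶠ[𝓝 q] fun _ => e := hsq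
    have h2 := congrArg (fun L : Plane × Plane →L[ℝ] ℝ => L v) h1.fderiv_eq
    rw [fderiv_fun_add (ha.fun_pow 2) (hb.fun_mul hc), fderiv_fun_pow 2 ha, fderiv_fun_mul hb hc] at h2
    simpa using h2
  have e0 := hsq.self_of_nhds
  have n : ∀ A H B, nijenhuisCoeff e (tangentFrame γ) (tangentStructure γ) (dualMatrix a b c)
      (.inl A) (.inr B) (.inr H) q = 0 := fun A H B => hN _ _ _
  have n000 := n 0 0 0
  have n001 := n 0 0 1
  have n010 := n 0 1 0
  have := n 0 1 1
  have n110 := n 1 1 0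
  have n111 := n 1 1 1
  have c0 := hcl (.inl 0) (.inl 1) (.inr 0)
  have c1 := hcl (.inl 0) (.inl 1) (.inr 1)
  simp [nijenhuisCoeff, Fintype.sum_sum_type, Fin.sum_univ_two, dualMatrix, tangentFrame,
    tangentStructure, traceFree, fderiv_neg, hs, ht, ht'] at n000 n001 n010 n110 n111
  subst e0
  simp [closedCoeff, Fintype.sum_sum_type, Fin.sum_univ_two, dualForm, tangentFrame,
    tangentStructure, traceFree, fderiv_neg, hs, ht, ht', fderiv_const_smul, fderiv_mul, ha, hb, hc,
    hκ, DifferentiableAt.mul] at c0 c1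
  refine weylParallel_of_equations he rfl ?_ ?_ ?_ ?_ ?_ ?_ ?_ ?_ <;>
    simp only [covA, covB, covC, hs, ht, ht']
  · linear_combination hd (horizVec γ 0 q)
  · linear_combination 2 * c0
  · linear_combination 2 * c1
  · linear_combination -n000
  · linear_combination -n001
  · linear_combination -n010
  · linear_combination -n110
  · linear_combination -n111

set_option maxHeartbeats 1000000 in
-- The converse needs all components, including those with vertical derivatives, and so requires
-- these to vanish. The curvature terms drop out by J² = e and the trace-freeness of j.
theorem dual_of_weylParallel {e : ℝ} {κ a b c : Plane × Plane → ℝ} {q : Plane × Plane}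
    (hq : q ∈ tangentTotal U) (hκ0 : κ q ≠ 0) (hκ : DifferentiableAt ℝ κ q)
    (ha : DifferentiableAt ℝ a q) (hb : DifferentiableAt ℝ b q) (hc : DifferentiableAt ℝ c q)
    (hsq : a q ^ 2 + b q * c q = e)
    (vκ : ∀ A, fderiv ℝ κ q (vertVec A) = 0) (va : ∀ A, fderiv ℝ a q (vertVec A) = 0)
    (vb : ∀ A, fderiv ℝ b q (vertVec A) = 0) (vc : ∀ A, fderiv ℝ c q (vertVec A) = 0)
    (h : WeylParallel (κ q) (a q) (b q) (c q) (fun C => fderiv ℝ κ q (horizVec γ C q))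
      (covA γ a b c q) (covB γ a b q) (covC γ a c q)) :
    (∀ i k r, nijenhuisCoeff e (tangentFrame γ) (tangentStructure γ) (dualMatrix a b c)
      i k r q = 0) ∧
    (∀ i j k, closedCoeff (tangentFrame γ) (tangentStructure γ) (dualForm κ a b c)
      i j k q = 0) := by
  have hs := fun C => thomas_symm γ C 1 0 (x := q.1) hq.1
  have ht := thomas_one_zero_one (γ := γ) hq.1
  have ht' := thomas_one_one_one (γ := γ) hq.1
  -- With k = (d log κ)/2 the relations can be solved for the derivatives of a, b, c without
  -- denominators.
  obtain ⟨k, hk⟩ : ∃ k : Fin 2 → ℝ, ∀ C, fderiv ℝ κ q (horizVec γ C q) = 2 * κ q * k C :=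
    ⟨fun C => fderiv ℝ κ q (horizVec γ C q) / (2 * κ q), fun C => by field_simp⟩
  obtain ⟨x0, x1, y0, y1, z0, z1⟩ := h
  have h2 : (2 * κ q) ≠ 0 := by positivity
  simp only [hk, covA, covB, covC, hs, ht, ht'] at x0 x1 y0 y1 z0 z1
  have a0 : fderiv ℝ a q (horizVec γ 0 q) =
      -b q * k 1 - thomas γ 0 0 1 q.1 * b q + thomas γ 1 0 0 q.1 * c q :=
    mul_left_cancel₀ h2 (by linear_combination x0)
  have a1 : fderiv ℝ a q (horizVec γ 1 q) =
      c q * k 0 - thomas γ 0 1 1 q.1 * b q - thomas γ 0 0 0 q.1 * c q :=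
    mul_left_cancel₀ h2 (by linear_combination x1)
  have b0 : fderiv ℝ b q (horizVec γ 0 q) =
      b q * k 0 - 2 * thomas γ 1 0 0 q.1 * a q + 2 * thomas γ 0 0 0 q.1 * b q :=
    mul_left_cancel₀ h2 (by linear_combination y0)
  have b1 : fderiv ℝ b q (horizVec γ 1 q) = -2 * a q * k 0 - b q * k 1
      + 2 * thomas γ 0 0 0 q.1 * a q + 2 * thomas γ 0 0 1 q.1 * b q :=
    mul_left_cancel₀ h2 (by linear_combination y1)
  have c0 : fderiv ℝ c q (horizVec γ 0 q) = 2 * a q * k 1 - c q * k 0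
      + 2 * thomas γ 0 0 1 q.1 * a q - 2 * thomas γ 0 0 0 q.1 * c q :=
    mul_left_cancel₀ h2 (by linear_combination z0)
  have c1 : fderiv ℝ c q (horizVec γ 1 q) =
      c q * k 1 + 2 * thomas γ 0 1 1 q.1 * a q - 2 * thomas γ 0 0 1 q.1 * c q :=
    mul_left_cancel₀ h2 (by linear_combination z1)
  subst hsq
  have hv : ∀ A B C, fderiv ℝ (traceFree a b c A B) q (vertVec C) = 0 := fun A B C => by
    fin_cases A <;> fin_cases B <;> simp [traceFree, fderiv_neg, va, vb, vc]
  have hj : ∀ A B, DifferentiableAt ℝ (traceFree a b c A B) q := fun A B => by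
    fin_cases A <;> fin_cases B <;> simp [traceFree, ha, hb, hc]
  have hm : ∀ (s : ℝ) A B v, fderiv ℝ (s • (κ * traceFree a b c A B)) q v =
      s * (κ q * fderiv ℝ (traceFree a b c A B) q v + traceFree a b c A B q * fderiv ℝ κ q v) := by
    intro s A B v
    rw [fderiv_const_smul (hκ.mul (hj A B)), fderiv_mul hκ (hj A B)]
    simp
    ring
  constructor
  · rintro (i | i) (k | k) (r | r) <;>
      simp only [nijenhuisCoeff, Fintype.sum_sum_type, Fin.sum_univ_two, dualMatrix, tangentFrame,
        tangentStructure, fderiv_neg, hv, Sum.elim_inl, Sum.elim_inr, Pi.zero_apply, mul_zero,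
        zero_mul, add_zero, zero_add, sub_zero, fderiv_zero, zero_apply, Pi.neg_apply, neg_apply,
        neg_zero, sub_self, mul_neg, neg_mul] <;>
      fin_cases i <;> fin_cases k <;> fin_cases r <;>
      simp [traceFree, epsLow, fderiv_neg, hs, ht, ht', a0, a1, b0, b1, c0, c1] <;> ring
  · rintro (i | i) (j | j) (k | k) <;>
      simp only [closedCoeff, Fintype.sum_sum_type, Fin.sum_univ_two, dualForm, tangentFrame,
        tangentStructure, hm, hv, vκ, Sum.elim_inl, Sum.elim_inr, Pi.zero_apply, mul_zero, zero_mul,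
        add_zero, zero_add, sub_zero, fderiv_zero, zero_apply, sub_self, smul_zero] <;>
      fin_cases i <;> fin_cases j <;> fin_cases k <;>
      simp [traceFree, epsLow, fderiv_neg, hs, ht, ht', a0, a1, b0, b1, c0, c1, hk] <;> ring

/-- The relation `WeylParallel` for functions on `U`. -/
def IsWeylParallelOn (γ : TorsionFreeConnection U) (κ a b c : Plane → ℝ) : Prop :=
  ∀ x ∈ U, WeylParallel (κ x) (a x) (b x) (c x) (fun C => partialD C κ x)
    (fun C => partialD C a x + thomas γ 0 C 1 x * b x - thomas γ 1 C 0 x * c x)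
    (fun C => partialD C b x + 2 * thomas γ 1 C 0 x * a x
      + (thomas γ 1 C 1 x - thomas γ 0 C 0 x) * b x)
    (fun C => partialD C c x - 2 * thomas γ 0 C 1 x * a x
      + (thomas γ 0 C 0 x - thomas γ 1 C 1 x) * c x)

end DualStructure

/-! ### From a Weyl-parallel pair on U to a metric on TU. -/

section DualConstruction

theorem ContDiffOn.smul_field {E F : Type*} [NormedAddCommGroup E] [NormedSpace ℝ E]
    [NormedAddCommGroup F] [NormedSpace ℝ F] {M : Set E} {f : E → ℝ} {X : E → F}
    (hf : ContDiffOn ℝ ∞ f M) (hX : ContDiffOn ℝ ∞ X M) :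
    ContDiffOn ℝ ∞ (fun q => f q • X q) M :=
  hf.smul hX

theorem IsMetricOn.smul {E : Type*} [NormedAddCommGroup E] [NormedSpace ℝ E] {M : Set E}
    {g : E → E →L[ℝ] E →L[ℝ] ℝ} (hg : IsMetricOn M g) {κ : E → ℝ} (hκ : ContDiffOn ℝ ∞ κ M)
    (h0 : ∀ p ∈ M, κ p ≠ 0) : IsMetricOn M (fun p => κ p • g p) where
  smooth := hκ.smul_field hg.smooth
  symm p hp v w := by simp [hg.symm p hp v w]
  nondeg p hp v h := hg.nondeg p hp v fun w => by simpa [h0 p hp] using h w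

variable {U : Set Plane} (γ : TorsionFreeConnection U)

/-- The endomorphism field with matrix `dualMatrix a b c` in `tangentFrame`. -/
def dualEndo (a b c : Plane × Plane → ℝ) (q : Plane × Plane) :
    Plane × Plane →L[ℝ] Plane × Plane :=
  ∑ A, ∑ B, traceFree a b c A B q •
    ((dx A).smulRight (horizVec γ B q) - (vertForm γ B q).smulRight (vertVec A))

theorem traceFree_smooth {E : Type*} [NormedAddCommGroup E] [NormedSpace ℝ E] {M : Set E}
    {a b c : E → ℝ} (ha : ContDiffOn ℝ ∞ a M) (hb : ContDiffOn ℝ ∞ b M) (hc : ContDiffOn ℝ ∞ c M)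
    (A B : Fin 2) : ContDiffOn ℝ ∞ (traceFree a b c A B) M := by
  fin_cases A <;> fin_cases B <;> simp only [traceFree]
  exacts [ha, hb, hc, ha.neg]

theorem dualMatrix_smooth {a b c : Plane × Plane → ℝ} {M : Set (Plane × Plane)}
    (ha : ContDiffOn ℝ ∞ a M) (hb : ContDiffOn ℝ ∞ b M) (hc : ContDiffOn ℝ ∞ c M)
    (i k : Fin 2 ⊕ Fin 2) : ContDiffOn ℝ ∞ (dualMatrix a b c i k) M := by
  rcases i with i | i <;> rcases k with k | k
  exacts [traceFree_smooth ha hb hc i k, contDiffOn_const, contDiffOn_const,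
    (traceFree_smooth ha hb hc k i).neg]

theorem dualEndo_smooth {a b c : Plane × Plane → ℝ} (ha : ContDiffOn ℝ ∞ a (tangentTotal U))
    (hb : ContDiffOn ℝ ∞ b (tangentTotal U)) (hc : ContDiffOn ℝ ∞ c (tangentTotal U)) :
    ContDiffOn ℝ ∞ (dualEndo γ a b c) (tangentTotal U) := by
  unfold dualEndo
  refine ContDiffOn.sum fun A _ => ContDiffOn.sum fun B _ =>
    (traceFree_smooth ha hb hc A B).smul (ContDiffOn.sub ?_ ?_)
  · exact contDiffOn_const.smulRight (horizVec_smooth γ B)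
  · exact (vertForm_smooth γ B).smulRight contDiffOn_const

theorem dualEndo_horizVec (a b c : Plane × Plane → ℝ) (q : Plane × Plane) (A : Fin 2) :
    dualEndo γ a b c q (horizVec γ A q) = ∑ B, traceFree a b c A B q • horizVec γ B q := by
  simp only [dualEndo, sum_apply, smul_apply, sub_apply, ContinuousLinearMap.smulRight_apply,
    dx_horizVec, vertForm_horizVec]
  fin_cases A <;> simp [kron]

theorem dualEndo_vertVec (a b c : Plane × Plane → ℝ) (q : Plane × Plane) (B : Fin 2) :
    dualEndo γ a b c q (vertVec B) = -∑ A, traceFree a b c A B q • vertVec A := by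
  simp only [dualEndo, sum_apply, smul_apply, sub_apply, ContinuousLinearMap.smulRight_apply,
    dx_vertVec, vertForm_vertVec]
  fin_cases B <;> simp [kron]

theorem dualEndo_tangentFrame (a b c : Plane × Plane → ℝ) (q : Plane × Plane)
    (i : Fin 2 ⊕ Fin 2) : dualEndo γ a b c q (tangentFrame γ i q) =
      ∑ k, dualMatrix a b c i k q • tangentFrame γ k q := by
  rcases i with i | i
  · simp [tangentFrame, dualMatrix, dualEndo_horizVec]
  · simp [tangentFrame, dualMatrix, dualEndo_vertVec]

theorem dx_dualEndo (a b c : Plane × Plane → ℝ) (q v : Plane × Plane) (B : Fin 2) :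
    dx B (dualEndo γ a b c q v) = ∑ A, traceFree a b c A B q * dx A v := by
  simp only [dualEndo, sum_apply, smul_apply, sub_apply, ContinuousLinearMap.smulRight_apply,
    map_sum, map_smul, map_sub, dx_horizVec, dx_vertVec, smul_eq_mul]
  fin_cases B <;> simp [kron]

theorem vertForm_dualEndo (a b c : Plane × Plane → ℝ) (q v : Plane × Plane) (A : Fin 2) :
    vertForm γ A q (dualEndo γ a b c q v) = -∑ B, traceFree a b c A B q * vertForm γ B q v := by
  simp only [dualEndo, sum_apply, smul_apply, sub_apply, ContinuousLinearMap.smulRight_apply,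
    map_sum, map_smul, map_sub, vertForm_horizVec, vertForm_vertVec, smul_eq_mul]
  fin_cases A <;> simp [kron]

theorem dualEndo_sq {e : ℝ} {a b c : Plane × Plane → ℝ} {q : Plane × Plane}
    (h : a q ^ 2 + b q * c q = e) (v : Plane × Plane) :
    dualEndo γ a b c q (dualEndo γ a b c q v) = e • v := by
  subst h
  rw [← sub_eq_zero]
  refine eq_of_forms_eq γ q (fun A => ?_) fun A => ?_
  · rw [map_sub, map_smul, dx_dualEndo]
    simp only [dx_dualEndo]
    fin_cases A <;> simp [traceFree] <;> ring
  · rw [map_sub, map_smul, vertForm_dualEndo]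
    simp only [vertForm_dualEndo]
    fin_cases A <;> simp [traceFree] <;> ring

theorem dualEndo_compatible {e : ℝ} {a b c : Plane × Plane → ℝ} {q : Plane × Plane}
    (hq : q ∈ tangentTotal U) (h : a q ^ 2 + b q * c q = e) (v w : Plane × Plane) :
    riemannianExtension γ q (dualEndo γ a b c q v) (dualEndo γ a b c q w) =
      -e * riemannianExtension γ q v w := by
  subst h
  simp only [riemannianExtension_apply γ hq, dx_dualEndo, vertForm_dualEndo]
  simp [traceFree]
  ring

theorem dualEndo_form {κ a b c : Plane × Plane → ℝ} {q : Plane × Plane}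
    (hq : q ∈ tangentTotal U) (i k : Fin 2 ⊕ Fin 2) :
    κ q * riemannianExtension γ q (dualEndo γ a b c q (tangentFrame γ i q)) (tangentFrame γ k q) =
      dualForm κ a b c i k q := by
  rw [riemannianExtension_apply γ hq]
  simp only [dx_dualEndo, vertForm_dualEndo]
  rcases i with i | i <;> rcases k with k | k <;>
    simp only [tangentFrame, Sum.elim_inl, Sum.elim_inr, dx_horizVec, dx_vertVec,
      vertForm_horizVec, vertForm_vertVec, dualForm] <;>
    fin_cases i <;> fin_cases k <;> simp [traceFree, kron] <;> ring

/-- A pair `(κ, j)` on `U` that is parallel for a Weyl connection gives a pseudo-Kähler or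
para-Kähler metric in the conformal class. -/
theorem exists_isHermitianKahlerOn {e : ℝ} (he : e ≠ 0) (hU : IsOpen U) {κ a b c : Plane → ℝ}
    (hκ : ContDiffOn ℝ ∞ κ U) (ha : ContDiffOn ℝ ∞ a U) (hb : ContDiffOn ℝ ∞ b U)
    (hc : ContDiffOn ℝ ∞ c U) (hpos : ∀ x ∈ U, 0 < κ x) (hsq : ∀ x ∈ U, a x ^ 2 + b x * c x = e)
    (h : IsWeylParallelOn γ κ a b c) :
    ∃ g' J, InConformalClass (tangentTotal U) (riemannianExtension γ) g' ∧
      IsHermitianKahlerOn e (tangentTotal U) g' J := by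
  set M := tangentTotal U
  have hM : IsOpen M := isOpen_tangentTotal hU
  have hF := tangentFrame_isFrameOn (γ := γ) hU
  set κ' : Plane × Plane → ℝ := fun q => κ q.1
  set a' : Plane × Plane → ℝ := fun q => a q.1
  set b' : Plane × Plane → ℝ := fun q => b q.1
  set c' : Plane × Plane → ℝ := fun q => c q.1
  have sκ : ContDiffOn ℝ ∞ κ' M := hκ.comp_fst_tangentTotal
  have sa : ContDiffOn ℝ ∞ a' M := ha.comp_fst_tangentTotal
  have sb : ContDiffOn ℝ ∞ b' M := hb.comp_fst_tangentTotal
  have sc : ContDiffOn ℝ ∞ c' M := hc.comp_fst_tangentTotal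
  have hmet : IsMetricOn M (fun p => κ' p • riemannianExtension γ p) :=
    (riemannianExtension_isMetricOn γ).smul sκ fun p hp => (hpos _ hp.1).ne'
  have hJsq : ∀ p ∈ M, ∀ v, dualEndo γ a' b' c' p (dualEndo γ a' b' c' p v) = e • v :=
    fun p hp v => dualEndo_sq γ (hsq _ hp.1) v
  have hcomp : ∀ p ∈ M, ∀ v w, (κ' p • riemannianExtension γ p) (dualEndo γ a' b' c' p v)
      (dualEndo γ a' b' c' p w) = -e * (κ' p • riemannianExtension γ p) v w := fun p hp v w => by
    have := dualEndo_compatible γ hp (a := a') (b := b') (c := c') (hsq _ hp.1) v w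
    simp only [smul_apply, this, smul_eq_mul]
    ring
  have hJs := dualEndo_smooth γ sa sb sc
  have hall : ∀ q ∈ M, (∀ i k r, nijenhuisCoeff e (tangentFrame γ) (tangentStructure γ)
      (dualMatrix a' b' c') i k r q = 0) ∧
      (∀ i j k, closedCoeff (tangentFrame γ) (tangentStructure γ) (dualForm κ' a' b' c')
        i j k q = 0) := fun q hq => by
    have dκ := hκ.differentiableAt_of_isOpen hU hq.1
    have da := ha.differentiableAt_of_isOpen hU hq.1
    have db := hb.differentiableAt_of_isOpen hU hq.1
    have dc := hc.differentiableAt_of_isOpen hU hq.1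
    refine dual_of_weylParallel hq (hpos _ hq.1).ne' (sκ.differentiableAt_of_isOpen hM hq)
      (sa.differentiableAt_of_isOpen hM hq) (sb.differentiableAt_of_isOpen hM hq)
      (sc.differentiableAt_of_isOpen hM hq) (hsq _ hq.1) (fun A => fderiv_comp_fst_vertVec dκ A)
      (fun A => fderiv_comp_fst_vertVec da A) (fun A => fderiv_comp_fst_vertVec db A)
      (fun A => fderiv_comp_fst_vertVec dc A) ?_
    -- On functions pulled back from U the horizontal lifts act as ∂_C, so the equation on TU is the
    -- one on U.
    convert h q.1 hq.1 using 1 <;> ext C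
    · exact fderiv_comp_fst_horizVec dκ C
    · rw [covA, fderiv_comp_fst_horizVec da C]
    · rw [covB, fderiv_comp_fst_horizVec db C]
    · rw [covC, fderiv_comp_fst_horizVec dc C]
  refine ⟨fun p => κ' p • riemannianExtension γ p, dualEndo γ a' b' c',
    ⟨κ', sκ, fun p hp => hpos _ hp.1, fun p _ => rfl⟩, hmet, ?_, hcomp, ?_⟩
  · exact (isIntegrableOn_iff_frame hM hF hJs hJsq (dualMatrix_smooth sa sb sc)
      fun q _ i => dualEndo_tangentFrame γ a' b' c' q i).2 fun p hp => (hall p hp).1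
  · refine (isClosedOn_iff_frame hM hF (hmet.smooth.clm_comp hJs) (fun p hp v w => ?_)
      (w := dualForm κ' a' b' c') (fun p hp i k => ?_)).2 fun p hp => (hall p hp).2
    · have := compatible_skew he (hJsq p hp) (hcomp p hp) v w
      exact this.trans (congrArg Neg.neg (hmet.symm p hp _ _))
    · exact dualEndo_form γ hp i k

end DualConstruction

/-! ### From a Weyl-parallel pair on U to a metric in the projective class. -/

section Metrisability

variable {U : Set Plane}

theorem partialD_mul {f g : Plane → ℝ} {x : Plane} (hf : DifferentiableAt ℝ f x)
    (hg : DifferentiableAt ℝ g x) (C : Fin 2) :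
    partialD C (fun y => f y * g y) x = f x * partialD C g x + g x * partialD C f x := by
  simp [partialD, fderiv_fun_mul hf hg]

theorem partialD_rpow {f : Plane → ℝ} {x : Plane} (hf : DifferentiableAt ℝ f x) (h0 : 0 < f x)
    (p : ℝ) (C : Fin 2) :
    partialD C (fun y => f y ^ p) x = p * (f x ^ p / f x) * partialD C f x := by
  rw [partialD, (hf.hasFDerivAt.rpow_const (p := p) (Or.inl h0.ne')).fderiv,
    Real.rpow_sub_one h0.ne']
  simp [partialD]

theorem partialD_congr {f g : Plane → ℝ} (hU : IsOpen U) {x : Plane} (hx : x ∈ U)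
    (h : ∀ y ∈ U, f y = g y) (C : Fin 2) : partialD C f x = partialD C g x := by
  have : f =ᶠ[𝓝 x] g := (hU.eventually_mem hx).mono fun y hy => h y hy
  rw [partialD, this.fderiv_eq, partialD]

theorem partialD_neg (f : Plane → ℝ) (x : Plane) (C : Fin 2) :
    partialD C (fun y => -f y) x = -partialD C f x := by
  simp [partialD, fderiv_fun_neg]

/-- The trace `γ^D_{DA}`. -/
def connectionTrace (γ : TorsionFreeConnection U) (A : Fin 2) (x : Plane) : ℝ := ∑ D, γ.Γ D D A x

theorem connectionTrace_smooth (γ : TorsionFreeConnection U) (A : Fin 2) :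
    ContDiffOn ℝ ∞ (connectionTrace γ A) U :=
  ContDiffOn.sum fun D _ => γ.smooth D D A

theorem gamma_eq_thomas (γ : TorsionFreeConnection U) (C A B : Fin 2) (x : Plane) :
    γ.Γ C A B x = thomas γ C A B x + kron A C * ((1 / 3) * connectionTrace γ B x)
      + kron B C * ((1 / 3) * connectionTrace γ A x) := by
  simp only [thomas, connectionTrace]; ring

/-- Metrisability is expressed through Π alone: the hypothesis says that h is parallel for the
connection Π^C_{AB} + δ_A^C β_B + δ_B^C β_A, which lies in the class since Π differs from γ by a
third of the trace. -/
theorem isMetrisedBy_of_projective_levi_civita (γ : TorsionFreeConnection U) {h : SurfaceMetric U}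
    {β : Fin 2 → Plane → ℝ} (hβ : ∀ A, ContDiffOn ℝ ∞ (β A) U)
    (hh : ∀ x ∈ U, ∀ C A B, partialD C (fun y => h.h y A B) x =
      ∑ D, (thomas γ D C A x * h.h x D B + thomas γ D C B x * h.h x A D)
        + β A x * h.h x C B + 2 * β C x * h.h x A B + β B x * h.h x A C) :
    IsMetrisedBy γ h := by
  refine ⟨⟨fun C A B x => thomas γ C A B x + kron A C * β B x + kron B C * β A x,
    fun C A B => ((thomas_smooth γ C A B).add (contDiffOn_const.mul (hβ B))).add
      (contDiffOn_const.mul (hβ A)), fun C A B x hx => ?_⟩,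
    ⟨fun A x => β A x - (1 / 3) * connectionTrace γ A x,
      fun A => (hβ A).sub (contDiffOn_const.mul (connectionTrace_smooth γ A)),
      fun x _ C A B => ?_⟩, fun x hx C A B => ?_⟩
  · simp only [thomas_symm γ C A B hx]; ring
  · simp only [gamma_eq_thomas γ C A B x]; ring
  · rw [hh x hx]
    simp only [Fin.sum_univ_two]
    fin_cases A <;> fin_cases B <;> fin_cases C <;> simp [kron] <;> ring

theorem levi_civita_thomas {γ γ' : TorsionFreeConnection U} (hp : ProjEquiv γ γ')
    {h : SurfaceMetric U} (hLC : IsLeviCivita γ' h) {x : Plane} (hx : x ∈ U) (C A B : Fin 2) :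
    partialD C (fun y => h.h y A B) x =
      ∑ D, (thomas γ D C A x * h.h x D B + thomas γ D C B x * h.h x A D)
        + (1 / 3) * connectionTrace γ' A x * h.h x C B
        + 2 * ((1 / 3) * connectionTrace γ' C x) * h.h x A B
        + (1 / 3) * connectionTrace γ' B x * h.h x A C := by
  rw [hLC x hx]
  simp only [gamma_eq_thomas γ', thomas_congr γ hp _ _ _ hx, Fin.sum_univ_two]
  fin_cases A <;> fin_cases B <;> fin_cases C <;> simp [kron] <;> ring

/-- A parallel pair `(κ, j)` gives the metric `κ^{3/2} j_{AB}`. -/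
theorem isMetrisable_of_weylParallel (γ : TorsionFreeConnection U) {e : ℝ} (he : e ≠ 0)
    (hU : IsOpen U) {κ a b c : Plane → ℝ}
    (hκ : ContDiffOn ℝ ∞ κ U) (ha : ContDiffOn ℝ ∞ a U) (hb : ContDiffOn ℝ ∞ b U)
    (hc : ContDiffOn ℝ ∞ c U) (hpos : ∀ x ∈ U, 0 < κ x) (hsq : ∀ x ∈ U, a x ^ 2 + b x * c x = e)
    (h : IsWeylParallelOn γ κ a b c) : IsMetrisable γ := by
  have hr : ContDiffOn ℝ ∞ (fun x => κ x ^ (3 / 2 : ℝ)) U :=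
    hκ.rpow_const_of_ne fun x hx => (hpos x hx).ne'
  let H : SurfaceMetric U :=
    -- This is j with its upper index lowered by ε, which is symmetric because j is trace-free. Its
    -- determinant is -κ³e.
    { h := fun x => !![κ x ^ (3 / 2 : ℝ) * -b x, κ x ^ (3 / 2 : ℝ) * a x;
        κ x ^ (3 / 2 : ℝ) * a x, κ x ^ (3 / 2 : ℝ) * c x]
      smooth := fun A B => by
        fin_cases A <;> fin_cases B
        exacts [hr.mul hb.neg, hr.mul ha, hr.mul ha, hr.mul hc]
      symm := fun x _ => by
        ext A B; fin_cases A <;> fin_cases B <;> rfl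
      nondeg := fun x hx => by
        have : κ x ^ (3 / 2 : ℝ) ≠ 0 := (Real.rpow_pos_of_pos (hpos x hx) _).ne'
        rw [Matrix.det_fin_two_of]
        have h2 : κ x ^ (3 / 2 : ℝ) * -b x * (κ x ^ (3 / 2 : ℝ) * c x) -
            κ x ^ (3 / 2 : ℝ) * a x * (κ x ^ (3 / 2 : ℝ) * a x) =
            -((κ x ^ (3 / 2 : ℝ)) ^ 2 * e) := by rw [← hsq x hx]; ring
        rw [h2]
        exact neg_ne_zero.2 (mul_ne_zero (pow_ne_zero 2 this) he) }
  refine ⟨H, isMetrisedBy_of_projective_levi_civita γ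
    -- With k = dκ/(2κ) the Weyl equation is ∇_C j_{AB} = k_A j_{CB} + k_B j_{AC} - k_C j_{AB},
    -- while the target has +2k_C in the last term. The factor κ^{3/2} contributes the missing 3k_C.
    (β := fun A x => (1 / 2) * (partialD A κ x / κ x)) (fun A => ?_) ?_⟩
  · refine contDiffOn_const.mul (ContDiffOn.div ?_ hκ fun x hx => (hpos x hx).ne')
    exact (hκ.fderiv_of_isOpen hU (by simp)).clm_apply contDiffOn_const
  · intro x hx
    have dκ := hκ.differentiableAt_of_isOpen hU hx
    have da := ha.differentiableAt_of_isOpen hU hx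
    have db := hb.differentiableAt_of_isOpen hU hx
    have dc := hc.differentiableAt_of_isOpen hU hx
    have dr := hr.differentiableAt_of_isOpen hU hx
    have hs := fun C => thomas_symm γ C 1 0 (x := x) hx
    have ht := thomas_one_zero_one (γ := γ) hx
    have ht' := thomas_one_one_one (γ := γ) hx
    have hκ0 := (hpos x hx).ne'
    have hdr := fun C => partialD_rpow dκ (hpos x hx) (3 / 2) C
    set r := κ x ^ (3 / 2 : ℝ) with hrdef
    obtain ⟨k, hk⟩ : ∃ k : Fin 2 → ℝ, ∀ C, partialD C κ x = 2 * κ x * k C :=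
      ⟨fun C => partialD C κ x / (2 * κ x), fun C => by field_simp⟩
    have hdr' : ∀ C, partialD C (fun y => κ y ^ (3 / 2 : ℝ)) x = 3 * r * k C := fun C => by
      rw [hdr, hk]; field_simp
    have hβ : ∀ C, (1 / 2) * (partialD C κ x / κ x) = k C := fun C => by
      rw [hk]; field_simp
    obtain ⟨x0, x1, y0, y1, z0, z1⟩ := h x hx
    have h2 : 2 * κ x ≠ 0 := mul_ne_zero two_ne_zero hκ0
    simp only [hk, hs, ht, ht'] at x0 x1 y0 y1 z0 z1
    have a0 : partialD 0 a x = -b x * k 1 - thomas γ 0 0 1 x * b x + thomas γ 1 0 0 x * c x :=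
      mul_left_cancel₀ h2 (by linear_combination x0)
    have a1 : partialD 1 a x = c x * k 0 - thomas γ 0 1 1 x * b x - thomas γ 0 0 0 x * c x :=
      mul_left_cancel₀ h2 (by linear_combination x1)
    have b0 : partialD 0 b x = b x * k 0 - 2 * thomas γ 1 0 0 x * a x
        + 2 * thomas γ 0 0 0 x * b x := mul_left_cancel₀ h2 (by linear_combination y0)
    have b1 : partialD 1 b x = -2 * a x * k 0 - b x * k 1 + 2 * thomas γ 0 0 0 x * a x
        + 2 * thomas γ 0 0 1 x * b x := mul_left_cancel₀ h2 (by linear_combination y1)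
    have c0 : partialD 0 c x = 2 * a x * k 1 - c x * k 0 + 2 * thomas γ 0 0 1 x * a x
        - 2 * thomas γ 0 0 0 x * c x := mul_left_cancel₀ h2 (by linear_combination z0)
    have c1 : partialD 1 c x = c x * k 1 + 2 * thomas γ 0 1 1 x * a x
        - 2 * thomas γ 0 0 1 x * c x := mul_left_cancel₀ h2 (by linear_combination z1)
    intro C A B
    simp only [hβ, Fin.sum_univ_two]
    have H00 : ∀ y, H.h y 0 0 = κ y ^ (3 / 2 : ℝ) * -b y := fun y => rfl
    have H01 : ∀ y, H.h y 0 1 = κ y ^ (3 / 2 : ℝ) * a y := fun y => rfl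
    have H10 : ∀ y, H.h y 1 0 = κ y ^ (3 / 2 : ℝ) * a y := fun y => rfl
    have H11 : ∀ y, H.h y 1 1 = κ y ^ (3 / 2 : ℝ) * c y := fun y => rfl
    fin_cases A <;> fin_cases B <;> fin_cases C <;>
      simp only [Fin.zero_eta, Fin.mk_one, H00, H01, H10, H11, partialD_mul dr da,
        partialD_mul dr db.fun_neg, partialD_mul dr dc, partialD_neg, hdr', a0, a1, b0, b1, c0, c1,
        ← hrdef, hs, ht, ht'] <;> ring

end Metrisability

/-! ### From a metric in the projective class to a Kähler or para-Kähler metric. -/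

section MetricToHermitian

variable {U : Set Plane}

/-- A metric whose Levi-Civita connection lies in `[γ]` and whose determinant has the sign of `-e`
gives a pseudo-Kähler (`e = -1`) or para-Kähler (`e = 1`) metric. -/
theorem exists_isHermitianKahlerOn_of_isMetrisedBy {γ : TorsionFreeConnection U} {e : ℝ}
    (he : e ^ 2 = 1) (hU : IsOpen U) {h : SurfaceMetric U} (hm : IsMetrisedBy γ h)
    (hdet : ∀ x ∈ U, 0 < -e * (h.h x).det) :
    ∃ g' J, InConformalClass (tangentTotal U) (riemannianExtension γ) g' ∧
      IsHermitianKahlerOn e (tangentTotal U) g' J := by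
  obtain ⟨γ', hp, hLC⟩ := hm
  have he0 : e ≠ 0 := fun h0 => by norm_num [h0] at he
  have hlc := fun x hx => levi_civita_thomas hp hLC (x := x) hx
  -- For e = ±1 this is |det h|; the power functions below need it positive.
  set s : Plane → ℝ := fun x => -e * (h.h x 0 0 * h.h x 1 1 - h.h x 0 1 * h.h x 0 1) with hs
  have hsym : ∀ x ∈ U, h.h x 1 0 = h.h x 0 1 := fun x hx => (h.symm x hx).apply 0 1
  have hspos : ∀ x ∈ U, 0 < s x := fun x hx => by
    have := hdet x hx
    rwa [Matrix.det_fin_two, hsym x hx] at this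
  have ss : ContDiffOn ℝ ∞ s U := contDiffOn_const.mul
    (((h.smooth 0 0).mul (h.smooth 1 1)).sub ((h.smooth 0 1).mul (h.smooth 0 1)))
  have sr : ∀ p : ℝ, ContDiffOn ℝ ∞ (fun x => s x ^ p) U := fun p =>
    ss.rpow_const_of_ne fun x hx => (hspos x hx).ne'
  -- The trace of the Levi-Civita equation, in which Π does not contribute because it is trace-free.
  have hds : ∀ x ∈ U, ∀ C, partialD C s x = 6 * ((1 / 3) * connectionTrace γ' C x) * s x := by
    intro x hx C
    have d := fun A B => (h.smooth A B).differentiableAt_of_isOpen hU hx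
    have hl := hlc x hx C
    have h1 : partialD C s x = -e * ((h.h x 0 0 * partialD C (fun y => h.h y 1 1) x +
        h.h x 1 1 * partialD C (fun y => h.h y 0 0) x) -
        2 * (h.h x 0 1 * partialD C (fun y => h.h y 0 1) x)) := by
      have d2 := ((d 0 0).fun_mul (d 1 1)).fun_sub ((d 0 1).fun_mul (d 0 1))
      simp only [hs, partialD]
      rw [fderiv_const_mul d2, fderiv_fun_sub ((d 0 0).fun_mul (d 1 1)) ((d 0 1).fun_mul (d 0 1)),
        fderiv_fun_mul (d 0 0) (d 1 1), fderiv_fun_mul (d 0 1) (d 0 1)]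
      simp only [sub_apply, add_apply, smul_apply, smul_eq_mul]
      ring
    rw [h1, hl, hl, hl]
    have ht0 := thomas_one_zero_one (γ := γ) hx
    have ht1 := thomas_one_one_one (γ := γ) hx
    have hts := fun C => thomas_symm γ C 1 0 hx
    simp only [Fin.sum_univ_two, hsym x hx, hs]
    fin_cases C <;> simp only [Fin.zero_eta, Fin.mk_one, hsym x hx, hts, ht0, ht1] <;> ring
  -- The inverse of h = κ^{3/2} j: the exponent -1/2 normalises a² + bc to e, and then κ^{3/2} =
  -- s^{1/2} gives κ = s^{1/3}.
  refine exists_isHermitianKahlerOn γ he0 hU (κ := fun x => s x ^ (1 / 3 : ℝ))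
    (a := fun x => s x ^ (-1 / 2 : ℝ) * h.h x 0 1) (b := fun x => s x ^ (-1 / 2 : ℝ) * -h.h x 0 0)
    (c := fun x => s x ^ (-1 / 2 : ℝ) * h.h x 1 1) (sr _) ((sr _).mul (h.smooth 0 1))
    ((sr _).mul (h.smooth 0 0).neg) ((sr _).mul (h.smooth 1 1))
    (fun x hx => Real.rpow_pos_of_pos (hspos x hx) _) (fun x hx => ?_) fun x hx => ?_
  · have h1 : (s x ^ (-1 / 2 : ℝ)) ^ 2 * s x = 1 := by
      rw [← Real.rpow_natCast, ← Real.rpow_mul (hspos x hx).le, ← Real.rpow_add_one (hspos x hx).ne']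
      norm_num
    have h2 : e * s x = -(h.h x 0 0 * h.h x 1 1 - h.h x 0 1 * h.h x 0 1) := by
      simp only [hs]; linear_combination -(h.h x 0 0 * h.h x 1 1 - h.h x 0 1 * h.h x 0 1) * he
    linear_combination e * h1 - (s x ^ (-1 / 2 : ℝ)) ^ 2 * h2
  · have d := fun A B => (h.smooth A B).differentiableAt_of_isOpen hU hx
    have dr := (sr (-1 / 2)).differentiableAt_of_isOpen hU hx
    have ds := ss.differentiableAt_of_isOpen hU hx
    have hs0 := (hspos x hx).ne'
    have hdκ : ∀ C, partialD C (fun y => s y ^ (1 / 3 : ℝ)) x =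
        2 * ((1 / 3) * connectionTrace γ' C x) * s x ^ (1 / 3 : ℝ) := fun C => by
      rw [partialD_rpow ds (hspos x hx), hds x hx]; field_simp; ring
    have hdr : ∀ C, partialD C (fun y => s y ^ (-1 / 2 : ℝ)) x =
        -3 * ((1 / 3) * connectionTrace γ' C x) * s x ^ (-1 / 2 : ℝ) := fun C => by
      rw [partialD_rpow ds (hspos x hx), hds x hx]; field_simp; ring
    have hl := hlc x hx
    have ht0 := thomas_one_zero_one (γ := γ) hx
    have ht1 := thomas_one_one_one (γ := γ) hx
    have hts := fun C => thomas_symm γ C 1 0 hx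
    constructor <;>
      simp only [hdκ, partialD_mul dr (d _ _), partialD_mul dr (d _ _).fun_neg, partialD_neg, hdr,
        hl, Fin.sum_univ_two, hsym x hx, hts, ht0, ht1] <;> ring

theorem ContainsKahler.of_exists {γ : TorsionFreeConnection U} (hU : IsOpen U)
    (h : ∃ g' J, InConformalClass (tangentTotal U) (riemannianExtension γ) g' ∧
      IsHermitianKahlerOn (-1) (tangentTotal U) g' J) :
    ContainsKahler (tangentTotal U) (riemannianExtension γ) := by
  obtain ⟨g', J, h1, h2⟩ := h
  exact ⟨g', J, h1, (isKahlerOn_iff (isOpen_tangentTotal hU)).2 h2⟩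

theorem ContainsParaKahler.of_exists {γ : TorsionFreeConnection U} (hU : IsOpen U)
    (h : ∃ g' J, InConformalClass (tangentTotal U) (riemannianExtension γ) g' ∧
      IsHermitianKahlerOn 1 (tangentTotal U) g' J) :
    ContainsParaKahler (tangentTotal U) (riemannianExtension γ) := by
  obtain ⟨g', J, h1, h2⟩ := h
  exact ⟨g', J, h1, (isParaKahlerOn_iff (isOpen_tangentTotal hU)).2 h2⟩

theorem containsKahler_of_det_pos {γ : TorsionFreeConnection U} (hU : IsOpen U)
    {h : SurfaceMetric U} (hm : IsMetrisedBy γ h) (hdet : ∀ x ∈ U, 0 < (h.h x).det) :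
    ContainsKahler (tangentTotal U) (riemannianExtension γ) :=
  .of_exists hU <| exists_isHermitianKahlerOn_of_isMetrisedBy (by norm_num) hU hm fun x hx => by
    simpa using hdet x hx

theorem containsParaKahler_of_det_neg {γ : TorsionFreeConnection U} (hU : IsOpen U)
    {h : SurfaceMetric U} (hm : IsMetrisedBy γ h) (hdet : ∀ x ∈ U, (h.h x).det < 0) :
    ContainsParaKahler (tangentTotal U) (riemannianExtension γ) :=
  .of_exists hU <| exists_isHermitianKahlerOn_of_isMetrisedBy (by norm_num) hU hm fun x hx => by
    simpa using hdet x hx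

theorem SurfaceMetric.det_pos_or_det_neg (h : SurfaceMetric U) (hU : IsPreconnected U) :
    (∀ x ∈ U, 0 < (h.h x).det) ∨ ∀ x ∈ U, (h.h x).det < 0 := by
  have hc : ContinuousOn (fun x => (h.h x).det) U := by
    simp only [Matrix.det_fin_two]
    exact ((h.smooth 0 0).continuousOn.mul (h.smooth 1 1).continuousOn).sub
      ((h.smooth 0 1).continuousOn.mul (h.smooth 1 0).continuousOn)
  by_contra! hcon
  obtain ⟨⟨x, hx, hx'⟩, y, hy, hy'⟩ := hcon
  obtain ⟨z, hz, hz'⟩ := hU.intermediate_value hx hy hc ⟨hx', hy'⟩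
  exact h.nondeg z hz hz'

end MetricToHermitian

/-! ### J mixing horizontal and vertical fields: the first-order equations. -/

section AntiSelfDual

/-- Here D and Q stand for the derivatives along h_A and along ε_{AB} v^B, the letters d and q for
those of κ, and r for the fibre curvature. The hypotheses are the derivatives of t² - bc = e, two
closedness and three torsion components. Four derivatives are found up to the factor e, the other
two from closedness. -/
theorem twistor_algebra {κ t b c e r d q Qt Qb Qc Dt Db Dc : ℝ} (he : e ≠ 0)
    (hsq : t ^ 2 - b * c = e) (hKQ : 2 * t * Qt = b * Qc + c * Qb)
    (hKD : 2 * t * Dt = b * Dc + c * Db)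
    (hC1 : κ * Dc + c * d + κ * Qt + t * q = 0)
    (hC2 : κ * Dt + t * d + κ * Qb + b * q - κ * r * c = 0)
    (h1 : c * Qt - c * Dc - 2 * t * Qc = 0) (h2 : c * Dt - c ^ 2 * r + b * Qc = 0)
    (h3 : -c * b * r - 2 * t * Db + 4 * t ^ 2 * r - b * Qb + b * Dt = 0) :
    2 * κ * Qc = c * q ∧ 2 * κ * Dc = -c * d - 2 * t * q ∧ 2 * κ * Qt = -c * d ∧
      2 * κ * Dt = -b * q + 2 * κ * r * c ∧ 2 * κ * Qb = -b * q - 2 * t * d ∧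
      2 * κ * Db = b * d + 4 * κ * r * t := by
  have a1 : 2 * κ * Qc = c * q := mul_left_cancel₀ he (by grind)
  have a3 : 2 * κ * Qt = -c * d := mul_left_cancel₀ he (by grind)
  have a4 : 2 * κ * Dt = -b * q + 2 * κ * r * c := mul_left_cancel₀ he (by grind)
  have a6 : 2 * κ * Db = b * d + 4 * κ * r * t := mul_left_cancel₀ he (by grind)
  exact ⟨a1, by linear_combination 2 * hC1 - a3, a3, a4, by linear_combination 2 * hC2 - a4, a6⟩

/-- The matrix in `tangentFrame` of `h_A ↦ t h_A + b ε_{AB} v^B`, `v^A ↦ c ε_{AB} h_B - t v^A`. -/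
def asdMatrix (t b c : Plane × Plane → ℝ) :
    Fin 2 ⊕ Fin 2 → Fin 2 ⊕ Fin 2 → Plane × Plane → ℝ
  | .inl A, .inl B => kron A B • t
  | .inl A, .inr B => epsLow A B • b
  | .inr A, .inl B => epsLow A B • c
  | .inr A, .inr B => -kron A B • t

/-- The components in `tangentFrame` of the two-form of `asdMatrix` for the metric `κ g`. -/
def asdForm (κ t b c : Plane × Plane → ℝ) :
    Fin 2 ⊕ Fin 2 → Fin 2 ⊕ Fin 2 → Plane × Plane → ℝ
  | .inl A, .inl B => (1 / 2 * epsLow A B) • (κ * b)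
  | .inl A, .inr B => (1 / 2 * kron A B) • (κ * t)
  | .inr A, .inl B => (-1 / 2 * kron A B) • (κ * t)
  | .inr A, .inr B => (1 / 2 * epsLow A B) • (κ * c)

theorem kron_zero_zero : kron 0 0 = 1 := by simp [kron]
theorem kron_zero_one : kron 0 1 = 0 := by simp [kron]
theorem kron_one_zero : kron 1 0 = 0 := by simp [kron]
theorem kron_one_one : kron 1 1 = 1 := by simp [kron]
theorem epsLow_zero_zero : epsLow 0 0 = 0 := by simp [epsLow]
theorem epsLow_zero_one : epsLow 0 1 = 1 := by simp [epsLow]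
theorem epsLow_one_zero : epsLow 1 0 = -1 := by simp [epsLow]
theorem epsLow_one_one : epsLow 1 1 = 0 := by simp [epsLow]

/-- The vertical fields `ε_{AB} v^B`. -/
def crossVec : Fin 2 → Plane × Plane := ![vertVec 1, -vertVec 0]

variable {U : Set Plane} {γ : TorsionFreeConnection U}

set_option maxHeartbeats 1000000 in
-- J maps each plane spanned by h_A and ε_{AB} v^B to itself, by a matrix independent of A. Both
-- values of A therefore lead to the same algebraic system, up to the sign in `crossVec 1`.
theorem asd_equations {e : ℝ} (he : e ≠ 0) {κ t b c : Plane × Plane → ℝ}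
    {q : Plane × Plane} (hq : q ∈ tangentTotal U) (hκ : DifferentiableAt ℝ κ q)
    (ht : DifferentiableAt ℝ t q) (hb : DifferentiableAt ℝ b q) (hc : DifferentiableAt ℝ c q)
    (hsq : ∀ᶠ p in 𝓝 q, t p ^ 2 - b p * c p = e)
    (hN : ∀ i k r, nijenhuisCoeff e (tangentFrame γ) (tangentStructure γ) (asdMatrix t b c)
      i k r q = 0)
    (hcl : ∀ i j k, closedCoeff (tangentFrame γ) (tangentStructure γ) (asdForm κ t b c)
      i j k q = 0) (A : Fin 2) :
    2 * κ q * fderiv ℝ c q (crossVec A) = c q * fderiv ℝ κ q (crossVec A) ∧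
    2 * κ q * fderiv ℝ c q (horizVec γ A q) =
      -c q * fderiv ℝ κ q (horizVec γ A q) - 2 * t q * fderiv ℝ κ q (crossVec A) ∧
    2 * κ q * fderiv ℝ t q (crossVec A) = -c q * fderiv ℝ κ q (horizVec γ A q) ∧
    2 * κ q * fderiv ℝ t q (horizVec γ A q) =
      -b q * fderiv ℝ κ q (crossVec A) + 2 * κ q * fibreCurv γ A q * c q ∧
    2 * κ q * fderiv ℝ b q (crossVec A) =
      -b q * fderiv ℝ κ q (crossVec A) - 2 * t q * fderiv ℝ κ q (horizVec γ A q) ∧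
    2 * κ q * fderiv ℝ b q (horizVec γ A q) =
      b q * fderiv ℝ κ q (horizVec γ A q) + 4 * κ q * fibreCurv γ A q * t q := by
  have hs := fun C => thomas_symm γ C 1 0 (x := q.1) hq.1
  have ht0 := thomas_one_zero_one (γ := γ) hq.1
  have ht1 := thomas_one_one_one (γ := γ) hq.1
  have e0 := hsq.self_of_nhds
  have hd : ∀ v, 2 * t q * fderiv ℝ t q v = b q * fderiv ℝ c q v + c q * fderiv ℝ b q v := by
    intro v
    have h1 : (fun p => t p ^ 2 - b p * c p) =ᶠ[𝓝 q] fun _ => e := hsq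
    have h2 := congrArg (fun L : Plane × Plane →L[ℝ] ℝ => L v) h1.fderiv_eq
    rw [fderiv_fun_sub (ht.fun_pow 2) (hb.fun_mul hc), fderiv_fun_pow 2 ht,
      fderiv_fun_mul hb hc] at h2
    simp at h2
    linear_combination h2
  have hm : ∀ (s : ℝ) (f : Plane × Plane → ℝ) v, DifferentiableAt ℝ f q →
      fderiv ℝ (s • (κ * f)) q v = s * (κ q * fderiv ℝ f q v + f q * fderiv ℝ κ q v) := by
    intro s f v hf
    rw [fderiv_const_smul (hκ.mul hf), fderiv_mul hκ hf]
    simp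
    ring
  have n01 := hN (.inr 0) (.inr 1) (.inl 1)
  have n11 := hN (.inr 0) (.inr 1) (.inl 0)
  have n02 := hN (.inr 0) (.inr 1) (.inr 0)
  have n12 := hN (.inr 0) (.inr 1) (.inr 1)
  have n03 := hN (.inl 0) (.inl 1) (.inr 0)
  have n13 := hN (.inl 0) (.inl 1) (.inr 1)
  have c01 := hcl (.inr 0) (.inr 1) (.inl 0)
  have c11 := hcl (.inr 0) (.inr 1) (.inl 1)
  have c02 := hcl (.inl 0) (.inl 1) (.inr 1)
  have c12 := hcl (.inl 0) (.inl 1) (.inr 0)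
  simp only [nijenhuisCoeff, Fintype.sum_sum_type, Fin.sum_univ_two, asdMatrix, tangentFrame,
    tangentStructure, kron_zero_zero, kron_zero_one, kron_one_zero, kron_one_one, epsLow_zero_zero,
    epsLow_zero_one, epsLow_one_zero, epsLow_one_one, fderiv_neg, hs, ht0, ht1, one_smul,
    zero_smul, neg_smul, Sum.elim_inl, Sum.elim_inr, Pi.zero_apply, mul_zero, zero_mul, add_zero,
    zero_add, sub_zero, fderiv_zero, zero_apply, Pi.neg_apply, neg_apply, neg_zero, sub_self,
    mul_neg, neg_mul, one_mul, neg_neg] at n01 n11 n02 n12 n03 n13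
  simp only [closedCoeff, Fintype.sum_sum_type, Fin.sum_univ_two, asdForm, tangentFrame,
    tangentStructure, hm _ _ _ ht, hm _ _ _ hb, hm _ _ _ hc, kron_zero_zero, kron_zero_one,
    kron_one_zero, kron_one_one, epsLow_zero_zero, epsLow_zero_one, epsLow_one_zero,
    epsLow_one_one, hs, ht0, ht1, Sum.elim_inl, Sum.elim_inr, Pi.smul_apply, Pi.mul_apply,
    smul_eq_mul] at c01 c11 c02 c12
  subst e0
  fin_cases A
  · refine twistor_algebra he rfl (hd _) (hd _) ?_ ?_ ?_ ?_ ?_ <;>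
      simp only [crossVec, Fin.zero_eta, Matrix.cons_val_zero]
    · linear_combination 2 * c01
    · linear_combination 2 * c02
    · linear_combination -n01
    · linear_combination -n02
    · linear_combination n03
  · refine twistor_algebra he rfl (hd _) (hd _) ?_ ?_ ?_ ?_ ?_ <;>
      simp only [crossVec, Fin.zero_eta, Fin.mk_one, Matrix.cons_val_zero, Matrix.cons_val_one,
        map_neg]
    · linear_combination 2 * c11
    · linear_combination -2 * c12
    · linear_combination n11
    · linear_combination -n12
    · linear_combination n13

end AntiSelfDual

/-! ### The prolonged twistor equation and the vanishing of the Cotton tensor. -/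

section Integrability

variable {U : Set Plane} {γ : TorsionFreeConnection U}

theorem fderiv_scale {κ ψ f : Plane × Plane → ℝ} {q : Plane × Plane} (hκ0 : κ q ≠ 0)
    (hψ : DifferentiableAt ℝ ψ q) (hf : DifferentiableAt ℝ f q) (v : Plane × Plane)
    (hψκ : 2 * κ q * fderiv ℝ ψ q v = -ψ q * fderiv ℝ κ q v) :
    fderiv ℝ (fun p => ψ p * f p) q v =
      ψ q / (2 * κ q) * (2 * κ q * fderiv ℝ f q v - f q * fderiv ℝ κ q v) := by
  rw [fderiv_fun_mul hψ hf]
  simp only [add_apply, smul_apply, smul_eq_mul]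
  field_simp
  linear_combination f q * hψκ

theorem fderiv_rpow_neg_half {κ : Plane × Plane → ℝ} {q : Plane × Plane}
    (hκ : DifferentiableAt ℝ κ q) (hpos : 0 < κ q) (v : Plane × Plane) :
    2 * κ q * fderiv ℝ (fun p => κ p ^ (-1 / 2 : ℝ)) q v =
      -κ q ^ (-1 / 2 : ℝ) * fderiv ℝ κ q v := by
  rw [(hκ.hasFDerivAt.rpow_const (p := (-1 / 2 : ℝ)) (Or.inl hpos.ne')).fderiv,
    Real.rpow_sub_one hpos.ne']
  simp only [smul_apply, smul_eq_mul]
  field_simp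

/-- The prolonged twistor equation, satisfied by a rescaled anti-self-dual structure. -/
structure IsTwistorSolution (γ : TorsionFreeConnection U) (G T B : Plane × Plane → ℝ) : Prop where
  smoothG : ContDiffOn ℝ ∞ G (tangentTotal U)
  smoothT : ContDiffOn ℝ ∞ T (tangentTotal U)
  smoothB : ContDiffOn ℝ ∞ B (tangentTotal U)
  cross_G : ∀ q ∈ tangentTotal U, ∀ A, fderiv ℝ G q (crossVec A) = 0
  horiz_G : ∀ q ∈ tangentTotal U, ∀ A,
    fderiv ℝ G q (horizVec γ A q) = 2 * fderiv ℝ T q (crossVec A)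
  horiz_T : ∀ q ∈ tangentTotal U, ∀ A,
    2 * fderiv ℝ T q (horizVec γ A q) = fderiv ℝ B q (crossVec A) + 2 * fibreCurv γ A q * G q
  horiz_B : ∀ q ∈ tangentTotal U, ∀ A,
    fderiv ℝ B q (horizVec γ A q) = 2 * fibreCurv γ A q * T q
  nondeg : ∀ q ∈ tangentTotal U, T q = 0 → G q = 0 → False

/-- The derivative of κ^{-1/2} f is proportional to 2κ df - f dκ. For f = c, t, b this is the
combination in which the system of `asd_equations` becomes linear and free of κ. A common zero of T
and G would give t = c = 0, hence e = 0. -/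
theorem isTwistorSolution_of_asd {e : ℝ} (he : e ≠ 0) (hU : IsOpen U)
    {κ t b c : Plane × Plane → ℝ} (hκ : ContDiffOn ℝ ∞ κ (tangentTotal U))
    (ht : ContDiffOn ℝ ∞ t (tangentTotal U)) (hb : ContDiffOn ℝ ∞ b (tangentTotal U))
    (hc : ContDiffOn ℝ ∞ c (tangentTotal U)) (hpos : ∀ q ∈ tangentTotal U, 0 < κ q)
    (hsq : ∀ p ∈ tangentTotal U, t p ^ 2 - b p * c p = e)
    (hN : ∀ q ∈ tangentTotal U, ∀ i k r,
      nijenhuisCoeff e (tangentFrame γ) (tangentStructure γ) (asdMatrix t b c) i k r q = 0)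
    (hcl : ∀ q ∈ tangentTotal U, ∀ i j k,
      closedCoeff (tangentFrame γ) (tangentStructure γ) (asdForm κ t b c) i j k q = 0) :
    IsTwistorSolution γ (fun q => κ q ^ (-1 / 2 : ℝ) * c q) (fun q => κ q ^ (-1 / 2 : ℝ) * t q)
      (fun q => κ q ^ (-1 / 2 : ℝ) * b q) := by
  have hM := isOpen_tangentTotal hU
  have hψ : ContDiffOn ℝ ∞ (fun q => κ q ^ (-1 / 2 : ℝ)) (tangentTotal U) :=
    hκ.rpow_const_of_ne fun q hq => (hpos q hq).ne'
  have dψ : ∀ q ∈ tangentTotal U, ∀ f, ContDiffOn ℝ ∞ f (tangentTotal U) → ∀ v,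
      fderiv ℝ (fun p => κ p ^ (-1 / 2 : ℝ) * f p) q v =
      κ q ^ (-1 / 2 : ℝ) / (2 * κ q) * (2 * κ q * fderiv ℝ f q v - f q * fderiv ℝ κ q v) :=
    fun q hq f hf v => fderiv_scale (hpos q hq).ne' (hψ.differentiableAt_of_isOpen hM hq)
      (hf.differentiableAt_of_isOpen hM hq) v
      (fderiv_rpow_neg_half (hκ.differentiableAt_of_isOpen hM hq) (hpos q hq) v)
  have key := fun q hq => asd_equations (γ := γ) he (q := q) hq
    (hκ.differentiableAt_of_isOpen hM hq) (ht.differentiableAt_of_isOpen hM hq)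
    (hb.differentiableAt_of_isOpen hM hq) (hc.differentiableAt_of_isOpen hM hq)
    ((hM.eventually_mem hq).mono hsq) (hN q hq) (hcl q hq)
  refine ⟨hψ.mul hc, hψ.mul ht, hψ.mul hb, fun q hq A => ?_, fun q hq A => ?_, fun q hq A => ?_,
    fun q hq A => ?_, fun q hq h1 h2 => ?_⟩
  · rw [dψ q hq c hc, (key q hq A).1, sub_self, mul_zero]
  · rw [dψ q hq c hc, dψ q hq t ht, (key q hq A).2.1, (key q hq A).2.2.1]; ring
  · have := (hpos q hq).ne'
    rw [dψ q hq t ht, dψ q hq b hb, (key q hq A).2.2.2.1, (key q hq A).2.2.2.2.1]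
    field_simp
    ring
  · have := (hpos q hq).ne'
    rw [dψ q hq b hb, (key q hq A).2.2.2.2.2]
    field_simp
    ring
  · have h0 : κ q ^ (-1 / 2 : ℝ) ≠ 0 := (Real.rpow_pos_of_pos (hpos q hq) _).ne'
    have h1' : t q = 0 := by simpa [h0] using h1
    have h2' : c q = 0 := by simpa [h0] using h2
    exact he (by rw [← hsq q hq, h1', h2']; ring)

theorem curvSymbol_smooth (hU : IsOpen U) (C B : Fin 2) :
    ContDiffOn ℝ ∞ (curvSymbol γ C B) U := by
  have hd : ∀ A {f : Plane → ℝ}, ContDiffOn ℝ ∞ f U → ContDiffOn ℝ ∞ (partialD A f) U :=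
    fun A f hf => (hf.fderiv_of_isOpen hU (by simp)).clm_apply contDiffOn_const
  have h := thomas_smooth γ
  unfold curvSymbol
  exact ((hd 0 (h _ _ _)).sub (hd 1 (h _ _ _))).add
    (ContDiffOn.sum fun E _ => ((h _ _ _).mul (h _ _ _)).sub ((h _ _ _).mul (h _ _ _)))

theorem fibreCurv_smooth (hU : IsOpen U) (B : Fin 2) :
    ContDiffOn ℝ ∞ (fibreCurv γ B) (tangentTotal U) := by
  unfold fibreCurv
  exact ContDiffOn.sum fun C _ => (curvSymbol_smooth hU C B).comp_fst_tangentTotal.mul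
    (dzLow_smooth C).contDiffOn

/-- The trace of the curvature is the curl of the trace of Π plus the trace of a commutator, and
both vanish. -/
theorem curvSymbol_trace (hU : IsOpen U) {x : Plane} (hx : x ∈ U) :
    curvSymbol γ 0 0 x + curvSymbol γ 1 1 x = 0 := by
  have ht := fun y (hy : y ∈ U) => thomas_one_zero_one (γ := γ) hy
  have ht' := fun y (hy : y ∈ U) => thomas_one_one_one (γ := γ) hy
  have hs := fun C y (hy : y ∈ U) => thomas_symm γ C 1 0 (x := y) hy
  have p1 := partialD_congr hU hx (hs 0) 0
  have p2 := partialD_congr hU hx ht' 0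
  have p3 := partialD_congr hU hx ht 1
  rw [partialD_neg] at p2 p3
  simp only [curvSymbol, Fin.sum_univ_two, p1, p2, p3, hs _ x hx, ht x hx, ht' x hx]
  ring

/-- The projective Cotton tensor; it vanishes iff the projective structure is flat. -/
def cottonSymbol (γ : TorsionFreeConnection U) (C : Fin 2) (x : Plane) : ℝ :=
  partialD 0 (curvSymbol γ C 1) x - partialD 1 (curvSymbol γ C 0) x
    + ∑ E, (thomas γ C 0 E x * curvSymbol γ E 1 x - thomas γ C 1 E x * curvSymbol γ E 0 x)

theorem fderiv_fibreCurv_horizVec (hU : IsOpen U) {q : Plane × Plane} (hq : q ∈ tangentTotal U)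
    (B D : Fin 2) : fderiv ℝ (fibreCurv γ B) q (horizVec γ D q) =
      ∑ C, (partialD D (curvSymbol γ C B) q.1 * dzLow C q +
        curvSymbol γ C B q.1 * fibreSymbol γ D C q) := by
  have := fderiv_fibreLinear (f := fun C => curvSymbol γ C B) (q := q)
    (fun C => (curvSymbol_smooth hU C B).differentiableAt_of_isOpen hU hq.1) (horizVec γ D q)
  simp only [dzLow_horizVec, horizVec_fst] at this
  exact this

theorem fderiv_fibreCurv_vertVec (hU : IsOpen U) {q : Plane × Plane} (hq : q ∈ tangentTotal U)
    (B D : Fin 2) : fderiv ℝ (fibreCurv γ B) q (vertVec D) = curvSymbol γ D B q.1 := by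
  have := fderiv_fibreLinear (f := fun C => curvSymbol γ C B) (q := q)
    (fun C => (curvSymbol_smooth hU C B).differentiableAt_of_isOpen hU hq.1) (vertVec D)
  rw [show (vertVec D).1 = 0 from rfl] at this
  refine this.trans ?_
  fin_cases D <;> simp [dzLow_vertVec, kron]

/-- The horizontal lifts contain Π, so they differentiate fibre-linear functions covariantly. This
turns the Cotton tensor into a condition on TU. -/
theorem cotton_fibre (hU : IsOpen U) {q : Plane × Plane} (hq : q ∈ tangentTotal U) :
    fderiv ℝ (fibreCurv γ 1) q (horizVec γ 0 q) - fderiv ℝ (fibreCurv γ 0) q (horizVec γ 1 q) =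
      ∑ C, cottonSymbol γ C q.1 * dzLow C q := by
  have hs := fun C => thomas_symm γ C 1 0 (x := q.1) hq.1
  simp only [fderiv_fibreCurv_horizVec hU hq, Fin.sum_univ_two, cottonSymbol, fibreSymbol, hs]
  ring

theorem fderiv_bracket {E : Type*} [NormedAddCommGroup E] [NormedSpace ℝ E] {M : Set E}
    (hM : IsOpen M) {f : E → ℝ} (hf : ContDiffOn ℝ ∞ f M) {X Y : E → E}
    (hX : ContDiffOn ℝ ∞ X M) (hY : ContDiffOn ℝ ∞ Y M) {q : E} (hq : q ∈ M) :
    fderiv ℝ (fun p => fderiv ℝ f p (Y p)) q (X q) - fderiv ℝ (fun p => fderiv ℝ f p (X p)) q (Y q)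
      = fderiv ℝ f q (lieBracket ℝ X Y q) :=
  (fderiv_apply_lieBracket ((hf.contDiffAt (hM.mem_nhds hq)).of_le (m := 2) (mod_cast le_top : ((2 : ℕ∞) : WithTop ℕ∞) ≤ ((⊤ : ℕ∞) : WithTop ℕ∞))) (by simp)
    (hY.differentiableAt_of_isOpen hM hq) (hX.differentiableAt_of_isOpen hM hq)).symm

theorem fderiv_congr_of_isOpen {E : Type*} [NormedAddCommGroup E] [NormedSpace ℝ E] {M : Set E}
    (hM : IsOpen M) {f g : E → ℝ} {q : E} (hq : q ∈ M) (h : ∀ p ∈ M, f p = g p) (v : E) :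
    fderiv ℝ f q v = fderiv ℝ g q v := by
  have : f =ᶠ[𝓝 q] g := (hM.eventually_mem hq).mono h
  rw [this.fderiv_eq]

/-- The difference of the brackets is the trace of Π contracted with the vertical fields. In the
integrability condition for T this removes the brackets of h_A with ε_{BC} v^C. -/
theorem lieBracket_horizVec_crossVec (hU : IsOpen U) {q : Plane × Plane}
    (hq : q ∈ tangentTotal U) :
    lieBracket ℝ (horizVec γ 0) (fun _ => crossVec 1) q =
      lieBracket ℝ (horizVec γ 1) (fun _ => crossVec 0) q := by
  have t := fun B => thomas_trace γ B hq.1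
  have s := fun C => thomas_symm γ C 1 0 hq.1
  have e0 : crossVec 0 = vertVec 1 := rfl
  have e1 : crossVec 1 = -vertVec 0 := rfl
  simp only [lieBracket_eq, fderiv_fun_const, Pi.zero_apply, zero_apply, zero_sub, e0, e1, map_neg,
    fderiv_horizVec hU hq, fderiv_fibreSymbol_vertVec hU hq, Fin.sum_univ_two]
  have h0 : thomas γ 0 0 0 q.1 = -thomas γ 1 1 0 q.1 := by linear_combination t 0
  have h1 : thomas γ 0 0 1 q.1 = -thomas γ 1 1 1 q.1 := by linear_combination t 1
  rw [h0, h1]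
  module

theorem lieBracket_horizVec (hU : IsOpen U) {q : Plane × Plane} (hq : q ∈ tangentTotal U) :
    lieBracket ℝ (horizVec γ 0) (horizVec γ 1) q =
      fibreCurv γ 1 q • crossVec 0 - fibreCurv γ 0 q • crossVec 1 := by
  have e := (tangentFrame_isFrameOn (γ := γ) hU).bracket q hq (.inl 0) (.inl 1)
  have e0 : crossVec 0 = vertVec 1 := rfl
  have e1 : crossVec 1 = -vertVec 0 := rfl
  simp only [Fintype.sum_sum_type, tangentFrame, tangentStructure, Sum.elim_inl, Sum.elim_inr,
    zero_smul, Finset.sum_const_zero, zero_add, epsLow_zero_one, one_mul, Fin.sum_univ_two] at e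
  rw [e, e0, e1, smul_neg, sub_neg_eq_add, add_comm]

theorem fderiv_two_mul_mul {f g : Plane × Plane → ℝ} {q : Plane × Plane}
    (hf : DifferentiableAt ℝ f q) (hg : DifferentiableAt ℝ g q) (v : Plane × Plane) :
    fderiv ℝ (fun p => 2 * f p * g p) q v =
      2 * (fderiv ℝ f q v * g q + f q * fderiv ℝ g q v) := by
  rw [fderiv_fun_mul (hf.const_mul 2) hg, fderiv_const_mul hf]
  simp only [add_apply, smul_apply, smul_eq_mul]
  ring

/-- The commutator of h_0 and h_1 is applied to B and to T. After substitution of the system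
everything cancels except T times, respectively G times, the Cotton function; since T and G have no
common zero, that function vanishes. -/
theorem IsTwistorSolution.cotton_fibre_eq_zero (hU : IsOpen U) {G T B : Plane × Plane → ℝ}
    (h : IsTwistorSolution γ G T B) {q : Plane × Plane} (hq : q ∈ tangentTotal U) :
    ∑ C, cottonSymbol γ C q.1 * dzLow C q = 0 := by
  have hM := isOpen_tangentTotal hU
  have dG := h.smoothG.differentiableAt_of_isOpen hM hq
  have dT := h.smoothT.differentiableAt_of_isOpen hM hq
  have dρ := fun A => (fibreCurv_smooth (γ := γ) hU A).differentiableAt_of_isOpen hM hq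
  have hcs : ∀ A, ContDiffOn ℝ ∞ (fun _ : Plane × Plane => crossVec A) (tangentTotal U) :=
    fun A => contDiffOn_const
  have hcur := fun (f : Plane × Plane → ℝ) (hf : ContDiffOn ℝ ∞ f (tangentTotal U)) =>
    fderiv_bracket hM hf (horizVec_smooth γ 0) (horizVec_smooth γ 1) hq
  have hcross := fun A B => fderiv_bracket hM h.smoothB (horizVec_smooth γ A) (hcs B) hq
  simp only [lieBracket_horizVec hU hq, map_sub, map_smul, smul_eq_mul] at hcur
  have hB : ∀ A v, fderiv ℝ (fun p => fderiv ℝ B p (horizVec γ A p)) q v =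
      2 * (fderiv ℝ (fibreCurv γ A) q v * T q + fibreCurv γ A q * fderiv ℝ T q v) :=
    fun A v => (fderiv_congr_of_isOpen hM hq (fun p hp => h.horiz_B p hp A) v).trans
      (fderiv_two_mul_mul (dρ A) dT v)
  have dQ : ∀ A, DifferentiableAt ℝ (fun p => fderiv ℝ B p (crossVec A)) q := fun A =>
    (((h.smoothB.fderiv_of_isOpen hM (by simp : (∞ : WithTop ℕ∞) + 1 ≤ ∞)).clm_apply
      contDiffOn_const)).differentiableAt_of_isOpen hM hq
  have dDT : ∀ A, DifferentiableAt ℝ (fun p => fderiv ℝ T p (horizVec γ A p)) q := fun A =>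
    (((h.smoothT.fderiv_of_isOpen hM (by simp : (∞ : WithTop ℕ∞) + 1 ≤ ∞)).clm_apply
      (horizVec_smooth γ A))).differentiableAt_of_isOpen hM hq
  have hT : ∀ A v, 2 * fderiv ℝ (fun p => fderiv ℝ T p (horizVec γ A p)) q v =
      fderiv ℝ (fun p => fderiv ℝ B p (crossVec A)) q v +
        2 * (fderiv ℝ (fibreCurv γ A) q v * G q + fibreCurv γ A q * fderiv ℝ G q v) := by
    intro A v
    have e := fderiv_congr_of_isOpen hM hq (fun p hp => h.horiz_T p hp A) v
    rw [fderiv_fun_add (dQ A) (((dρ A).const_mul 2).fun_mul dG), fderiv_const_mul (dDT A)] at e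
    rw [← fderiv_two_mul_mul (dρ A) dG]
    simpa using e
  have hc := cotton_fibre (γ := γ) hU hq
  have h01 := hcross 0 1
  have h10 := hcross 1 0
  rw [lieBracket_horizVec_crossVec hU hq] at h01
  rw [hB] at h01 h10
  have q01 : fderiv ℝ (fibreCurv γ 0) q (crossVec 1) = -curvSymbol γ 0 0 q.1 := by
    rw [show crossVec 1 = -vertVec 0 from rfl, map_neg, fderiv_fibreCurv_vertVec hU hq]
  have q10 : fderiv ℝ (fibreCurv γ 1) q (crossVec 0) = curvSymbol γ 1 1 q.1 := by
    rw [show crossVec 0 = vertVec 1 from rfl, fderiv_fibreCurv_vertVec hU hq]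
  have tr := curvSymbol_trace (γ := γ) hU hq.1
  have cB := hcur B h.smoothB
  have cT := hcur T h.smoothT
  have t00 := hT 0 (horizVec γ 1 q)
  have t11 := hT 1 (horizVec γ 0 q)
  rw [hB, hB] at cB
  have gG := h.horiz_G q hq
  have gT := h.horiz_T q hq
  by_contra hne
  refine h.nondeg q hq ?_ ?_ <;> refine (mul_eq_zero.1 ?_).resolve_left hne
  -- Commutator on B: the terms with the curvature times G are symmetric in the two indices and
  -- cancel.
  · rw [← hc]
    linear_combination (1 / 2) * cB - (1 / 2) * fibreCurv γ 1 q * gT 0 +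
      (1 / 2) * fibreCurv γ 0 q * gT 1
  -- Commutator on T: the mixed second derivatives of B are exchanged by means of `h01` and `h10`,
  -- which leaves T times the trace of the curvature.
  · rw [← hc]
    rw [q01] at h01
    rw [q10] at h10
    linear_combination cT - (1 / 2) * t11 + (1 / 2) * t00 - (1 / 2) * h01 + (1 / 2) * h10
      - fibreCurv γ 1 q * gG 0 + fibreCurv γ 0 q * gG 1 + T q * tr

theorem IsTwistorSolution.cotton_eq_zero (hU : IsOpen U) {G T B : Plane × Plane → ℝ}
    (h : IsTwistorSolution γ G T B) {x : Plane} (hx : x ∈ U) (C : Fin 2) :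
    cottonSymbol γ C x = 0 := by
  -- At the point of the fibre with z_D = δ_D^C the fibre-linear function is its C-th coefficient.
  have := h.cotton_fibre_eq_zero hU (q := (x, (vertVec C).2)) ⟨hx, trivial⟩
  have e : ∀ D, dzLow D ((x, (vertVec C).2) : Plane × Plane) = dzLow D (vertVec C) := by
    intro D
    simp [dzLow]
  simpa [e, dzLow_vertVec, kron] using this

end Integrability

/-! ### Every compatible J is of one of the two types. -/

section Dichotomy

variable {U : Set Plane} {γ : TorsionFreeConnection U}

variable (γ) in
/-- The coframe dual to `tangentFrame`. -/
def tangentCoframe (k : Fin 2 ⊕ Fin 2) (q : Plane × Plane) : Plane × Plane →L[ℝ] ℝ :=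
  Sum.elim dx (fun A => vertForm γ A q) k

theorem tangentCoframe_smooth (k : Fin 2 ⊕ Fin 2) :
    ContDiffOn ℝ ∞ (tangentCoframe γ k) (tangentTotal U) := by
  rcases k with A | A
  · exact contDiffOn_const
  · exact vertForm_smooth γ A

theorem tangentCoframe_tangentFrame (i k : Fin 2 ⊕ Fin 2) (q : Plane × Plane) :
    tangentCoframe γ k q (tangentFrame γ i q) = if i = k then 1 else 0 := by
  rcases i with A | A <;> rcases k with B | B <;>
    simp [tangentCoframe, tangentFrame, dx_horizVec, vertForm_vertVec, dx_vertVec,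
      vertForm_horizVec, kron, eq_comm]

theorem eq_sum_tangentCoframe (q v : Plane × Plane) :
    v = ∑ k, tangentCoframe γ k q v • tangentFrame γ k q := by
  rw [Fintype.sum_sum_type]
  exact eq_sum_frame γ q v

theorem riemannianExtension_tangentFrame {q : Plane × Plane} (hq : q ∈ tangentTotal U)
    (v : Plane × Plane) (k : Fin 2 ⊕ Fin 2) :
    riemannianExtension γ q v (tangentFrame γ k q) = 1 / 2 * tangentCoframe γ k.swap q v := by
  rw [riemannianExtension_apply γ hq]
  rcases k with A | A <;> fin_cases A <;>
    simp [tangentCoframe, tangentFrame, dx_horizVec, vertForm_vertVec, dx_vertVec,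
      vertForm_horizVec, kron]

/-- Two continuous functions on a connected open set that have zero product and no common zero:
one of them vanishes identically. -/
theorem eqOn_zero_or_eqOn_zero {X : Type*} [TopologicalSpace X] {M : Set X} (hM : IsOpen M)
    (hc : IsPreconnected M) {f g : X → ℝ} (hf : ContinuousOn f M) (hg : ContinuousOn g M)
    (hfg : ∀ q ∈ M, f q * g q = 0) (h0 : ∀ q ∈ M, f q = 0 → g q = 0 → False) :
    (∀ q ∈ M, f q = 0) ∨ ∀ q ∈ M, g q = 0 := by
  have hu := hf.isOpen_inter_preimage hM (isOpen_compl_singleton (x := (0 : ℝ)))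
  have hv := hg.isOpen_inter_preimage hM (isOpen_compl_singleton (x := (0 : ℝ)))
  have hd : Disjoint (M ∩ f ⁻¹' {0}ᶜ) (M ∩ g ⁻¹' {0}ᶜ) := by
    refine Set.disjoint_left.2 fun q h1 h2 => ?_
    rcases mul_eq_zero.1 (hfg q h1.1) with h | h
    exacts [h1.2 h, h2.2 h]
  have hs : M ⊆ M ∩ f ⁻¹' {0}ᶜ ∪ M ∩ g ⁻¹' {0}ᶜ := by
    intro q hq
    by_cases h : f q = 0
    · exact Or.inr ⟨hq, fun h' => h0 q hq h h'⟩
    · exact Or.inl ⟨hq, h⟩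
  rcases hc.subset_or_subset hu hv hd hs with h | h
  · exact Or.inr fun q hq => (mul_eq_zero.1 (hfg q hq)).resolve_left (h hq).2
  · exact Or.inl fun q hq => (mul_eq_zero.1 (hfg q hq)).resolve_right (h hq).2

theorem IsHermitianKahlerOn.frame_equations {e : ℝ} (he : e ≠ 0) (hU : IsOpen U)
    {κ : Plane × Plane → ℝ} {g' : Plane × Plane → Plane × Plane →L[ℝ] Plane × Plane →L[ℝ] ℝ}
    {J : Plane × Plane → Plane × Plane →L[ℝ] Plane × Plane}
    (hg' : ∀ p ∈ tangentTotal U, g' p = κ p • riemannianExtension γ p)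
    (h : IsHermitianKahlerOn e (tangentTotal U) g' J)
    {m w : Fin 2 ⊕ Fin 2 → Fin 2 ⊕ Fin 2 → Plane × Plane → ℝ}
    (hms : ∀ i k, ContDiffOn ℝ ∞ (m i k) (tangentTotal U))
    (hm : ∀ q ∈ tangentTotal U, ∀ i k,
      tangentCoframe γ k q (J q (tangentFrame γ i q)) = m i k q)
    (hw : ∀ q ∈ tangentTotal U, ∀ i k, w i k q = κ q * (1 / 2 * m i k.swap q)) :
    (∀ q ∈ tangentTotal U, ∀ i k r,
      nijenhuisCoeff e (tangentFrame γ) (tangentStructure γ) m i k r q = 0) ∧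
    ∀ q ∈ tangentTotal U, ∀ i j k,
      closedCoeff (tangentFrame γ) (tangentStructure γ) w i j k q = 0 := by
  have hM := isOpen_tangentTotal hU
  have hF := tangentFrame_isFrameOn (γ := γ) hU
  refine ⟨(isIntegrableOn_iff_frame hM hF h.integrable.smooth h.integrable.sq hms
    fun q hq i => ?_).1 h.integrable,
    (isClosedOn_iff_frame hM hF (h.metric.smooth.clm_comp h.integrable.smooth)
      (fun q hq v w => ?_) fun q hq i k => ?_).1 h.closed⟩
  · exact (eq_sum_tangentCoframe q _).trans (Finset.sum_congr rfl fun k _ => by rw [hm q hq])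
  · rw [ContinuousLinearMap.comp_apply, ContinuousLinearMap.comp_apply,
      compatible_skew he (h.integrable.sq q hq) (h.compatible q hq), h.metric.symm q hq]
  · rw [ContinuousLinearMap.comp_apply, hg' q hq, smul_apply, smul_apply,
      riemannianExtension_tangentFrame hq, hm q hq, hw q hq, smul_eq_mul]

theorem asdMatrix_smooth {t b c : Plane × Plane → ℝ} {M : Set (Plane × Plane)}
    (ht : ContDiffOn ℝ ∞ t M) (hb : ContDiffOn ℝ ∞ b M) (hc : ContDiffOn ℝ ∞ c M)
    (i k : Fin 2 ⊕ Fin 2) : ContDiffOn ℝ ∞ (asdMatrix t b c i k) M := by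
  rcases i with i | i <;> rcases k with k | k
  exacts [contDiffOn_const.smul ht, contDiffOn_const.smul hb, contDiffOn_const.smul hc,
    contDiffOn_const.smul ht]

/-- A Hermitian Kähler or para-Kähler structure in the conformal class is self-dual or
anti-self-dual. -/
theorem IsHermitianKahlerOn.dual_or_antidual {e : ℝ} (he : e ≠ 0) (hU : IsOpen U)
    (hconn : IsPreconnected U)
    {κ : Plane × Plane → ℝ} {g' : Plane × Plane → Plane × Plane →L[ℝ] Plane × Plane →L[ℝ] ℝ}
    {J : Plane × Plane → Plane × Plane →L[ℝ] Plane × Plane}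
    (hpos : ∀ p ∈ tangentTotal U, 0 < κ p)
    (hg' : ∀ p ∈ tangentTotal U, g' p = κ p • riemannianExtension γ p)
    (h : IsHermitianKahlerOn e (tangentTotal U) g' J) :
    (∃ a b c : Plane × Plane → ℝ, ContDiffOn ℝ ∞ a (tangentTotal U) ∧
      ContDiffOn ℝ ∞ b (tangentTotal U) ∧ ContDiffOn ℝ ∞ c (tangentTotal U) ∧
      (∀ q ∈ tangentTotal U, a q ^ 2 + b q * c q = e) ∧
      ∀ q ∈ tangentTotal U, ∀ i k,
        tangentCoframe γ k q (J q (tangentFrame γ i q)) = dualMatrix a b c i k q) ∨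
    ∃ t b c : Plane × Plane → ℝ, ContDiffOn ℝ ∞ t (tangentTotal U) ∧
      ContDiffOn ℝ ∞ b (tangentTotal U) ∧ ContDiffOn ℝ ∞ c (tangentTotal U) ∧
      (∀ q ∈ tangentTotal U, t q ^ 2 - b q * c q = e) ∧
      ∀ q ∈ tangentTotal U, ∀ i k,
        tangentCoframe γ k q (J q (tangentFrame γ i q)) = asdMatrix t b c i k q := by
  have hM := isOpen_tangentTotal hU
  have hF := tangentFrame_isFrameOn (γ := γ) hU
  set m : Fin 2 ⊕ Fin 2 → Fin 2 ⊕ Fin 2 → Plane × Plane → ℝ := fun i k q =>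
    tangentCoframe γ k q (J q (tangentFrame γ i q)) with hm
  have hms : ∀ i k, ContDiffOn ℝ ∞ (m i k) (tangentTotal U) := fun i k =>
    (tangentCoframe_smooth k).clm_apply (h.integrable.smooth.clm_apply (hF.smooth i))
  have hskew : ∀ q ∈ tangentTotal U, ∀ i k, m i k.swap q = -m k i.swap q := by
    intro q hq i k
    have := compatible_skew he (h.integrable.sq q hq) (h.compatible q hq)
      (tangentFrame γ i q) (tangentFrame γ k q)
    rw [h.metric.symm q hq (tangentFrame γ i q)] at this
    simp only [hg' q hq, smul_apply, riemannianExtension_tangentFrame hq, smul_eq_mul] at this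
    have h0 := (hpos q hq).ne'
    refine mul_left_cancel₀ h0 ?_
    simp only [hm]
    linear_combination 2 * this
  have hmul : ∀ q ∈ tangentTotal U, ∀ i l, ∑ k, m i k q * m k l q = e * if i = l then 1 else 0 := by
    intro q hq i l
    have := congrArg (tangentCoframe γ l q) (h.integrable.sq q hq (tangentFrame γ i q))
    rw [eq_sum_tangentCoframe (γ := γ) q (J q (tangentFrame γ i q))] at this
    simpa only [map_sum, map_smul, smul_eq_mul, tangentCoframe_tangentFrame] using this
  have s1 : ∀ q ∈ tangentTotal U, ∀ A B, m (.inr B) (.inr A) q = -m (.inl A) (.inl B) q :=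
    fun q hq A B => hskew q hq (.inr B) (.inl A)
  have s2 : ∀ q ∈ tangentTotal U, ∀ A B, m (.inl B) (.inr A) q = -m (.inl A) (.inr B) q :=
    fun q hq A B => hskew q hq (.inl B) (.inl A)
  have s3 : ∀ q ∈ tangentTotal U, ∀ A B, m (.inr B) (.inl A) q = -m (.inr A) (.inl B) q :=
    fun q hq A B => hskew q hq (.inr B) (.inr A)
  have s2d : ∀ q ∈ tangentTotal U, ∀ A, m (.inl A) (.inr A) q = 0 := fun q hq A => by
    linarith [s2 q hq A A]
  have s3d : ∀ q ∈ tangentTotal U, ∀ A, m (.inr A) (.inl A) q = 0 := fun q hq A => by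
    linarith [s3 q hq A A]
  have r : ∀ q ∈ tangentTotal U, ∀ i l,
      m i (.inl 0) q * m (.inl 0) l q + m i (.inl 1) q * m (.inl 1) l q +
      (m i (.inr 0) q * m (.inr 0) l q + m i (.inr 1) q * m (.inr 1) l q) =
        e * if i = l then 1 else 0 := by
    intro q hq i l
    simpa [Fintype.sum_sum_type, Fin.sum_univ_two] using hmul q hq i l
  -- Entries of J² = e after skewness is inserted. The off-diagonal ones say that every product of a
  -- component in one sl(2) summand with a component in the other is zero.
  have eqs : ∀ q ∈ tangentTotal U,
      m (.inl 0) (.inl 0) q ^ 2 + m (.inl 0) (.inl 1) q * m (.inl 1) (.inl 0) q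
        - m (.inl 0) (.inr 1) q * m (.inr 0) (.inl 1) q = e ∧
      m (.inl 1) (.inl 1) q ^ 2 + m (.inl 0) (.inl 1) q * m (.inl 1) (.inl 0) q
        - m (.inl 0) (.inr 1) q * m (.inr 0) (.inl 1) q = e ∧
      (m (.inl 0) (.inl 0) q + m (.inl 1) (.inl 1) q) * m (.inl 0) (.inl 1) q = 0 ∧
      (m (.inl 0) (.inl 0) q + m (.inl 1) (.inl 1) q) * m (.inl 1) (.inl 0) q = 0 ∧
      m (.inl 0) (.inr 1) q * m (.inl 0) (.inl 1) q = 0 ∧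
      m (.inl 0) (.inr 1) q * m (.inl 1) (.inl 0) q = 0 ∧
      m (.inr 0) (.inl 1) q * m (.inl 0) (.inl 1) q = 0 ∧
      m (.inr 0) (.inl 1) q * m (.inl 1) (.inl 0) q = 0 ∧
      m (.inl 0) (.inr 1) q * (m (.inl 0) (.inl 0) q - m (.inl 1) (.inl 1) q) = 0 ∧
      m (.inr 0) (.inl 1) q * (m (.inl 0) (.inl 0) q - m (.inl 1) (.inl 1) q) = 0 := by
    intro q hq
    have r := r q hq
    have k1 := r (.inl 0) (.inl 0)
    have k2 := r (.inl 1) (.inl 1)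
    have k3 := r (.inl 0) (.inl 1)
    have k4 := r (.inl 1) (.inl 0)
    have k5 := r (.inl 0) (.inr 0)
    have k6 := r (.inl 1) (.inr 1)
    have k7 := r (.inr 0) (.inl 0)
    have k8 := r (.inr 1) (.inl 1)
    have k9 := r (.inl 0) (.inr 1)
    have k10 := r (.inr 0) (.inl 1)
    simp only [s1 q hq, s2d q hq, s3d q hq, s2 q hq 0 1, s3 q hq 0 1, if_true, reduceCtorEq,
      if_false, Sum.inl.injEq, zero_ne_one, one_ne_zero, mul_one, mul_zero] at k1 k2 k3 k4 k5 k6 k7 k8 k9 k10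
    refine ⟨?_, ?_, ?_, ?_, ?_, ?_, ?_, ?_, ?_, ?_⟩
    · linear_combination k1
    · linear_combination k2
    · linear_combination k3
    · linear_combination k4
    · linear_combination (-1 / 2 : ℝ) * k5
    · linear_combination (1 / 2 : ℝ) * k6
    · linear_combination (-1 / 2 : ℝ) * k8
    · linear_combination (1 / 2 : ℝ) * k7
    · linear_combination k9
    · linear_combination -k10
  have hcM : IsPreconnected (tangentTotal U) := hconn.prod isPreconnected_univ
  have hc := fun i k => (hms i k).continuousOn
  -- The first factor is a sum of squares that vanishes where J is of the dual type, the second one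
  -- where J is of the antidual type.
  have hprod : ∀ q ∈ tangentTotal U, (m (.inl 0) (.inr 1) q ^ 2 + m (.inr 0) (.inl 1) q ^ 2
      + (m (.inl 0) (.inl 0) q + m (.inl 1) (.inl 1) q) ^ 2) *
    ((m (.inl 0) (.inl 0) q - m (.inl 1) (.inl 1) q) ^ 2
      + m (.inl 0) (.inl 1) q ^ 2 + m (.inl 1) (.inl 0) q ^ 2) = 0 := by
    intro q hq
    obtain ⟨e1, e2, e3, e4, e5, e6, e7, e8, e9, e10⟩ := eqs q hq
    generalize m (.inl 0) (.inr 1) q = b at *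
    generalize m (.inr 0) (.inl 1) q = c at *
    generalize m (.inl 0) (.inl 0) q = x at *
    generalize m (.inl 0) (.inl 1) q = y at *
    generalize m (.inl 1) (.inl 0) q = z at *
    generalize m (.inl 1) (.inl 1) q = w at *
    have e11 : (x + w) * (x - w) = 0 := by linear_combination e1 - e2
    linear_combination b * (x - w) * e9 + b * y * e5 + b * z * e6 + c * (x - w) * e10 +
      c * y * e7 + c * z * e8 + (x + w) * (x - w) * e11 + (x + w) * y * e3 + (x + w) * z * e4
  have hcommon : ∀ q ∈ tangentTotal U, (m (.inl 0) (.inr 1) q ^ 2 + m (.inr 0) (.inl 1) q ^ 2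
      + (m (.inl 0) (.inl 0) q + m (.inl 1) (.inl 1) q) ^ 2) = 0 →
    ((m (.inl 0) (.inl 0) q - m (.inl 1) (.inl 1) q) ^ 2
      + m (.inl 0) (.inl 1) q ^ 2 + m (.inl 1) (.inl 0) q ^ 2) = 0 → False := by
    intro q hq h1 h2
    have e1 := (eqs q hq).1
    generalize m (.inl 0) (.inr 1) q = b at *
    generalize m (.inr 0) (.inl 1) q = c at *
    generalize m (.inl 0) (.inl 0) q = x at *
    generalize m (.inl 0) (.inl 1) q = y at *
    generalize m (.inl 1) (.inl 0) q = z at *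
    generalize m (.inl 1) (.inl 1) q = w at *
    have hb : b = 0 := by nlinarith [sq_nonneg b, sq_nonneg c, sq_nonneg (x + w)]
    have hy : y = 0 := by nlinarith [sq_nonneg y, sq_nonneg z, sq_nonneg (x - w)]
    have hx : x + w = 0 := by nlinarith [sq_nonneg b, sq_nonneg c, sq_nonneg (x + w)]
    have hx' : x - w = 0 := by nlinarith [sq_nonneg y, sq_nonneg z, sq_nonneg (x - w)]
    have : x = 0 := by linarith
    exact he (by rw [← e1, hb, hy, this]; ring)
  have hdich := eqOn_zero_or_eqOn_zero hM hcM
    (f := fun q => m (.inl 0) (.inr 1) q ^ 2 + m (.inr 0) (.inl 1) q ^ 2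
      + (m (.inl 0) (.inl 0) q + m (.inl 1) (.inl 1) q) ^ 2)
    (g := fun q => (m (.inl 0) (.inl 0) q - m (.inl 1) (.inl 1) q) ^ 2
      + m (.inl 0) (.inl 1) q ^ 2 + m (.inl 1) (.inl 0) q ^ 2)
    ((((hc _ _).pow 2).add ((hc _ _).pow 2)).add (((hc _ _).add (hc _ _)).pow 2))
    (((((hc _ _).sub (hc _ _)).pow 2).add ((hc _ _).pow 2)).add ((hc _ _).pow 2))
    hprod hcommon
  rcases hdich with h0 | h0
  · left
    have hz : ∀ q ∈ tangentTotal U, m (.inl 0) (.inr 1) q = 0 ∧ m (.inr 0) (.inl 1) q = 0 ∧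
        m (.inl 1) (.inl 1) q = -m (.inl 0) (.inl 0) q := fun q hq => by
      have := h0 q hq
      refine ⟨?_, ?_, ?_⟩ <;> nlinarith [sq_nonneg (m (.inl 0) (.inr 1) q),
        sq_nonneg (m (.inr 0) (.inl 1) q),
        sq_nonneg (m (.inl 0) (.inl 0) q + m (.inl 1) (.inl 1) q)]
    refine ⟨_, _, _, hms (.inl 0) (.inl 0), hms (.inl 0) (.inl 1), hms (.inl 1) (.inl 0),
      fun q hq => ?_, fun q hq i k => ?_⟩
    · linear_combination (eqs q hq).1 + m (.inr 0) (.inl 1) q * (hz q hq).1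
    · change m i k q = _
      obtain ⟨z1, z2, z3⟩ := hz q hq
      rcases i with i | i <;> rcases k with k | k <;> fin_cases i <;> fin_cases k <;>
        simp [dualMatrix, traceFree, s1 q hq, s2d q hq, s3d q hq, s2 q hq 0 1, s3 q hq 0 1,
          z1, z2, z3]
  · right
    have hz : ∀ q ∈ tangentTotal U, m (.inl 0) (.inl 1) q = 0 ∧ m (.inl 1) (.inl 0) q = 0 ∧
        m (.inl 1) (.inl 1) q = m (.inl 0) (.inl 0) q := fun q hq => by
      have := h0 q hq
      refine ⟨?_, ?_, ?_⟩ <;> nlinarith [sq_nonneg (m (.inl 0) (.inl 1) q),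
        sq_nonneg (m (.inl 1) (.inl 0) q),
        sq_nonneg (m (.inl 0) (.inl 0) q - m (.inl 1) (.inl 1) q)]
    refine ⟨_, _, _, hms (.inl 0) (.inl 0), hms (.inl 0) (.inr 1), hms (.inr 0) (.inl 1),
      fun q hq => ?_, fun q hq i k => ?_⟩
    · linear_combination (eqs q hq).1 - m (.inl 1) (.inl 0) q * (hz q hq).1
    · change m i k q = _
      obtain ⟨z1, z2, z3⟩ := hz q hq
      rcases i with i | i <;> rcases k with k | k <;> fin_cases i <;> fin_cases k <;>
        simp [asdMatrix, kron, epsLow, s1 q hq, s2d q hq, s3d q hq, s2 q hq 0 1, s3 q hq 0 1,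
          z1, z2, z3]

/-- In the dual case the Weyl equation is restricted to the zero section; in the antidual case the
twistor equation gives flatness. -/
theorem IsHermitianKahlerOn.isMetrisable_or_cotton_eq_zero {e : ℝ} (he : e ≠ 0) (hU : IsOpen U)
    (hconn : IsPreconnected U)
    {g' : Plane × Plane → Plane × Plane →L[ℝ] Plane × Plane →L[ℝ] ℝ}
    {J : Plane × Plane → Plane × Plane →L[ℝ] Plane × Plane}
    (hg' : InConformalClass (tangentTotal U) (riemannianExtension γ) g')
    (h : IsHermitianKahlerOn e (tangentTotal U) g' J) :
    IsMetrisable γ ∨ ∀ x ∈ U, ∀ C, cottonSymbol γ C x = 0 := by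
  have hM := isOpen_tangentTotal hU
  obtain ⟨κ, hκ, hpos, hg'⟩ := hg'
  rcases h.dual_or_antidual he hU hconn hpos hg' with
    ⟨a, b, c, ha, hb, hc, hsq, hm⟩ | ⟨t, b, c, ht, hb, hc, hsq, hm⟩
  · left
    obtain ⟨hN, hcl⟩ := h.frame_equations he hU hg' (w := dualForm κ a b c)
      (dualMatrix_smooth ha hb hc) hm fun q _ i k => by
        rcases i with i | i <;> rcases k with k | k <;>
          simp [dualForm, dualMatrix, Sum.swap] <;> ring
    have hz : ∀ {f : Plane × Plane → ℝ}, ContDiffOn ℝ ∞ f (tangentTotal U) →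
        ContDiffOn ℝ ∞ (fun x => f (x, 0)) U := fun hf =>
      hf.comp (contDiff_id.prodMk contDiff_const).contDiffOn fun x hx => ⟨hx, trivial⟩
    have hd : ∀ {f : Plane × Plane → ℝ}, ContDiffOn ℝ ∞ f (tangentTotal U) → ∀ x ∈ U, ∀ C,
        fderiv ℝ f (x, 0) (horizVec γ C (x, 0)) = partialD C (fun x => f (x, 0)) x := by
      intro f hf x hx C
      have hf' := hf.differentiableAt_of_isOpen hM (p := (x, 0)) ⟨hx, trivial⟩
      have := (HasFDerivAt.comp (f := fun x : Plane => (id x, (0 : Plane))) x hf'.hasFDerivAt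
        ((hasFDerivAt_id x).prodMk (hasFDerivAt_const (0 : Plane) x))).fderiv
      -- At z = 0 the vertical part of the lift vanishes, so horizontal derivatives are derivatives
      -- along the section.
      have e1 : horizVec γ C (x, 0) = (Pi.single C 1, 0) := by
        simp [horizVec, baseVec, fibreSymbol, dzLow]
      rw [partialD, show (fun x => f (x, 0)) = f ∘ fun x => (id x, (0 : Plane)) from rfl, this, e1]
      rfl
    refine isMetrisable_of_weylParallel γ he hU (hz hκ) (hz ha) (hz hb) (hz hc)
      (fun x hx => hpos _ ⟨hx, trivial⟩) (fun x hx => hsq _ ⟨hx, trivial⟩) fun x hx => ?_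
    have hq : ((x, 0) : Plane × Plane) ∈ tangentTotal U := ⟨hx, trivial⟩
    have := weylParallel_of_dual he hq (hκ.differentiableAt_of_isOpen hM hq)
      (ha.differentiableAt_of_isOpen hM hq) (hb.differentiableAt_of_isOpen hM hq)
      (hc.differentiableAt_of_isOpen hM hq) ((hM.eventually_mem hq).mono hsq) (hN _ hq) (hcl _ hq)
    unfold covA covB covC at this
    simpa only [hd hκ x hx, hd ha x hx, hd hb x hx, hd hc x hx] using this
  · right
    obtain ⟨hN, hcl⟩ := h.frame_equations he hU hg' (w := asdForm κ t b c)
      (asdMatrix_smooth ht hb hc) hm fun q _ i k => by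
        rcases i with i | i <;> rcases k with k | k <;>
          simp [asdForm, asdMatrix, Sum.swap] <;> ring
    exact fun x hx C => (isTwistorSolution_of_asd he hU hκ ht hb hc hpos hsq hN hcl).cotton_eq_zero
      hU hx C

end Dichotomy

/-! ### Horizontal sections over a simply connected space. -/

section Monodromy

/-- On a simply connected space, local trivialisations `ψ i y : F ≃ F'` on `V i` with locally
constant transition functions have global horizontal sections with any initial value. -/
theorem exists_horizontal_section {X F F' : Type*} [TopologicalSpace X] [SimplyConnectedSpace X]
    [LocallyPathConnectedSpace X] (V : X → Set X) (hV : ∀ i, IsOpen (V i)) (hmem : ∀ i, i ∈ V i)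
    (ψ : X → X → F ≃ F')
    (htrans : ∀ i j, ∀ x ∈ V i ∩ V j, ∀ᶠ y in 𝓝 x, ∀ v,
      (ψ j y).symm (ψ i y v) = (ψ j x).symm (ψ i x v)) (x₀ : X) (w₀ : F') :
    ∃ s : X → F', s x₀ = w₀ ∧
      ∀ i, ∀ x ∈ V i, ∀ᶠ y in 𝓝 x, (ψ i y).symm (s y) = (ψ i x).symm (s x) := by
  -- With discrete fibre, locally constant transition functions are continuous, and the bundle they
  -- define is a covering space.
  let _ : TopologicalSpace F := ⊥
  have _ : DiscreteTopology F := ⟨rfl⟩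
  let Z : FiberBundleCore X X F :=
    { baseSet := V
      isOpen_baseSet := hV
      indexAt := id
      mem_baseSet_at := hmem
      coordChange := fun i j x v => (ψ j x).symm (ψ i x v)
      coordChange_self := by simp
      coordChange_comp := by simp
      continuousOn_coordChange := by
        intro i j p hp
        refine ContinuousAt.continuousWithinAt ?_
        have h1 : ∀ᶠ q : X × F in 𝓝 p, q.2 = p.2 :=
          continuousAt_snd.preimage_mem_nhds ((isOpen_discrete {p.2}).mem_nhds rfl)
        have h2 : ∀ᶠ q : X × F in 𝓝 p, ∀ v,
            (ψ j q.1).symm (ψ i q.1 v) = (ψ j p.1).symm (ψ i p.1 v) :=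
          continuousAt_fst.eventually (htrans i j p.1 hp.1)
        refine (continuousAt_const (y := (ψ j p.1).symm (ψ i p.1 p.2))).congr ?_
        filter_upwards [h1, h2] with q h1 h2
        rw [h1, h2] }
  have hcov : IsCoveringMap Z.proj :=
    IsCoveringMap.mk Z.proj (fun _ => F) (fun x => Z.localTriv x) fun x => hmem x
  let e₀ : Z.TotalSpace := ⟨x₀, (ψ x₀ x₀).symm w₀⟩
  -- Simple connectivity lifts the identity of X to the covering, which is a global section.
  obtain ⟨σ, ⟨hσ0, hσ⟩, -⟩ := hcov.existsUnique_continuousMap_lifts (ContinuousMap.id X) x₀ e₀ rfl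
  have hσ1 : ∀ x, (σ x).1 = x := fun x => congrFun hσ x
  let s : X → F' := fun x => ψ (σ x).1 (σ x).1 (σ x).2
  refine ⟨s, ?_, fun i x hx => ?_⟩
  · change ψ (σ x₀).1 (σ x₀).1 (σ x₀).2 = w₀
    rw [hσ0]
    exact (ψ x₀ x₀).apply_symm_apply w₀
  · have hs : ∀ y, (Z.localTriv i (σ y)).2 = (ψ i y).symm (s y) := by
      intro y
      rw [Z.localTriv_apply]
      change (ψ i (σ y).1).symm (s y) = _
      rw [hσ1]
    have hc : ContinuousAt (fun y => (Z.localTriv i (σ y)).2) x := by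
      have hx' : σ x ∈ (Z.localTriv i).source := by
        rw [(Z.localTriv i).mem_source]
        change (σ x).1 ∈ V i
        rwa [hσ1]
      exact continuousAt_snd.comp
        (((Z.localTriv i).continuousAt hx').comp (map_continuous σ).continuousAt)
    simp only [hs] at hc
    exact hc.preimage_mem_nhds ((isOpen_discrete {(ψ i x).symm (s x)}).mem_nhds rfl)

end Monodromy

/-! ### Estimates for parallel transport along rays. -/

section FlatConnection

open Metric Set

variable {E 𝔸 : Type*} [NormedAddCommGroup E] [NormedSpace ℝ E] [NormedRing 𝔸] [NormedAlgebra ℝ 𝔸]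

theorem exists_radial_solution [CompleteSpace 𝔸] {A : E → E →L[ℝ] 𝔸} {x₀ u : E} {r M : ℝ}
    (hA : ContinuousOn A (ball x₀ r)) (hM : ∀ x ∈ ball x₀ r, ‖A x‖ ≤ M)
    (hr : M * r * (‖(1 : 𝔸)‖ + 1) ≤ 1) (hu : ‖u‖ < r) :
    ∃ φ : ℝ → 𝔸, φ 0 = 1 ∧ ∀ t ∈ Icc (0 : ℝ) 1,
      HasDerivWithinAt φ (A (x₀ + t • u) u * φ t) (Icc 0 1) t := by
  have hr0 : 0 < r := (norm_nonneg u).trans_lt hu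
  have hM0 : 0 ≤ M := (norm_nonneg _).trans (hM x₀ (mem_ball_self hr0))
  have hmem : ∀ t ∈ Icc (0 : ℝ) 1, x₀ + t • u ∈ ball x₀ r := by
    intro t ht
    rw [mem_ball, dist_eq_norm, add_sub_cancel_left, norm_smul, Real.norm_of_nonneg ht.1]
    nlinarith [ht.2, norm_nonneg u]
  have hn : ∀ t ∈ Icc (0 : ℝ) 1, ‖A (x₀ + t • u) u‖ ≤ M * r := fun t ht =>
    ((A _).le_opNorm u).trans (mul_le_mul (hM _ (hmem t ht)) hu.le (norm_nonneg _) hM0)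
  have hMr : 0 ≤ M * r := mul_nonneg hM0 hr0.le
  -- On the ball of radius 1 about the initial value 1 one has ‖y‖ ≤ ‖1‖ + 1, so by `hr` the field
  -- is bounded by 1 and the solution stays in the ball for the whole unit time.
  have hPL : IsPicardLindelof (fun t y => A (x₀ + t • u) u * y) (tmin := 0) (tmax := 1)
      ⟨0, by simp⟩ (1 : 𝔸) 1 0 1 ⟨M * r, hMr⟩ := by
    refine ⟨fun t ht => ?_, fun y _ => ?_, fun t ht y hy => ?_, by simp⟩
    · refine LipschitzWith.lipschitzOnWith (LipschitzWith.of_dist_le_mul fun y z => ?_)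
      rw [dist_eq_norm, dist_eq_norm, ← mul_sub]
      exact (norm_mul_le _ _).trans (mul_le_mul_of_nonneg_right (hn t ht) (norm_nonneg _))
    · refine ContinuousOn.mul (ContinuousOn.clm_apply (hA.comp ?_ hmem) continuousOn_const)
        continuousOn_const
      fun_prop
    · have hy' : ‖y‖ ≤ ‖(1 : 𝔸)‖ + 1 := by
        have : ‖y - 1‖ ≤ 1 := by simpa [dist_eq_norm] using hy
        have h2 := norm_add_le (y - 1) 1
        rw [sub_add_cancel] at h2
        linarith
      refine (norm_mul_le _ _).trans ((mul_le_mul (hn t ht) hy' (norm_nonneg _) hMr).trans ?_)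
      simpa using hr
  exact hPL.exists_eq_forall_mem_Icc_hasDerivWithinAt₀

/-- In use a and ay are the values of the connection form at nearby points of two rays, at
displacement th, and D is its derivative at the first. The term t D h u is of first order in h;
flatness replaces it by t D u h and a commutator, and all that remains is of second order. -/
theorem norm_flat_remainder_le {a ay : E →L[ℝ] 𝔸} {D : E →L[ℝ] E →L[ℝ] 𝔸} {u h : E}
    {t M N K : ℝ} (ht : t ∈ Icc (0 : ℝ) 1) (hu : ‖u‖ ≤ 1) (hh : ‖h‖ ≤ 1) (ha : ‖a‖ ≤ M)
    (hD : ‖D‖ ≤ N) (hay : ‖ay - a - t • D h‖ ≤ K * ‖h‖ ^ 2)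
    (hflat : D h u + a u * a h = D u h + a h * a u) :
    ‖ay (u + h) * (1 + t • a h) - a u - (a h + t • D u h) - t • (a h * a u)‖ ≤
      (2 * K + N + M ^ 2 + 2 * (K + N) * M) * ‖h‖ ^ 2 := by
  set ρ : E →L[ℝ] 𝔸 := ay - a - t • D h with hρ
  have e : ay (u + h) * (1 + t • a h) - a u - (a h + t • D u h) - t • (a h * a u) =
      ρ (u + h) + t • D h h + t • (a h * a h) + (ay - a) (u + h) * (t • a h) := by
    have hf : t • D h u + t • (a u * a h) = t • D u h + t • (a h * a u) := by
      rw [← smul_add, hflat, smul_add]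
    have hf' : t • D h u = t • D u h + t • (a h * a u) - t • (a u * a h) := by
      rw [← hf]; abel
    simp only [hρ, sub_apply, smul_apply, map_add, mul_add, mul_one, mul_smul_comm, add_mul,
      smul_add, sub_mul, hf']
    module
  have hM : 0 ≤ M := (norm_nonneg _).trans ha
  have hN : 0 ≤ N := le_trans (norm_nonneg D) hD
  have hh0 := norm_nonneg h
  have hhh : ‖h‖ ^ 2 ≤ ‖h‖ := by nlinarith
  have hKh : 0 ≤ K * ‖h‖ ^ 2 := (norm_nonneg _).trans hay
  have huh : ‖u + h‖ ≤ 2 := (norm_add_le _ _).trans (by linarith)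
  have ht' : ∀ z : 𝔸, ‖t • z‖ ≤ ‖z‖ := fun z => by
    rw [norm_smul, Real.norm_of_nonneg ht.1]
    exact mul_le_of_le_one_left (norm_nonneg _) ht.2
  have hah : ‖a h‖ ≤ M * ‖h‖ := (a.le_opNorm h).trans (by gcongr)
  have hDh : ‖D h‖ ≤ N * ‖h‖ := (D.le_opNorm h).trans (by gcongr)
  have b1 : ‖ρ (u + h)‖ ≤ K * ‖h‖ ^ 2 * 2 := (ρ.le_opNorm _).trans (by gcongr)
  have b2 : ‖t • D h h‖ ≤ N * ‖h‖ * ‖h‖ := (ht' _).trans (((D h).le_opNorm h).trans (by gcongr))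
  have b3 : ‖t • (a h * a h)‖ ≤ (M * ‖h‖) * (M * ‖h‖) :=
    (ht' _).trans ((norm_mul_le _ _).trans (by gcongr))
  have b4 : ‖ay - a‖ ≤ K * ‖h‖ ^ 2 + N * ‖h‖ := by
    have : ay - a = ρ + t • D h := by rw [hρ]; abel
    rw [this]
    refine (norm_add_le _ _).trans (add_le_add hay ?_)
    rw [norm_smul, Real.norm_of_nonneg ht.1]
    exact (mul_le_of_le_one_left (norm_nonneg _) ht.2).trans hDh
  have b5 : ‖(ay - a) (u + h) * (t • a h)‖ ≤ (K * ‖h‖ ^ 2 + N * ‖h‖) * 2 * (M * ‖h‖) := by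
    refine (norm_mul_le _ _).trans (mul_le_mul ?_ ((ht' _).trans hah) (norm_nonneg _) (by positivity))
    exact ((ay - a).le_opNorm _).trans (by gcongr)
  rw [e]
  have key : K * ‖h‖ ^ 2 * ‖h‖ ≤ K * ‖h‖ ^ 2 := mul_le_of_le_one_right hKh hh
  calc _ ≤ K * ‖h‖ ^ 2 * 2 + N * ‖h‖ * ‖h‖ + (M * ‖h‖) * (M * ‖h‖) +
        (K * ‖h‖ ^ 2 + N * ‖h‖) * 2 * (M * ‖h‖) :=
      (norm_add₃_le.trans (add_le_add (add_le_add b1 b2) b3) |> fun H =>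
        (norm_add_le _ _).trans (add_le_add H b5))
    _ ≤ _ := by nlinarith [mul_le_mul_of_nonneg_right key hM]

theorem norm_sub_sub_fderiv_le {F : Type*} [NormedAddCommGroup F] [NormedSpace ℝ F] {f : E → F}
    {s : Set E} (hs : Convex ℝ s) {K : NNReal} (hf : ∀ x ∈ s, DifferentiableAt ℝ f x)
    (hK : LipschitzOnWith K (fderiv ℝ f) s) {x y : E} (hx : x ∈ s) (hy : y ∈ s) :
    ‖f y - f x - fderiv ℝ f x (y - x)‖ ≤ K * ‖y - x‖ * ‖y - x‖ := by
  have hsub : segment ℝ x y ⊆ s := hs.segment_subset hx hy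
  refine (convex_segment x y).norm_image_sub_le_of_norm_hasFDerivWithin_le' (f' := fderiv ℝ f)
    (fun z hz => (hf z (hsub hz)).hasFDerivAt.hasFDerivWithinAt) (fun z hz => ?_)
    (left_mem_segment ℝ x y) (right_mem_segment ℝ x y)
  rw [← dist_eq_norm]
  refine (hK.dist_le_mul z (hsub hz) x hx).trans (mul_le_mul_of_nonneg_left ?_ K.2)
  obtain ⟨t, ht, rfl⟩ := (segment_eq_image' ℝ x y ▸ hz)
  rw [dist_eq_norm, add_sub_cancel_left, norm_smul, Real.norm_of_nonneg ht.1]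
  exact mul_le_of_le_one_left (norm_nonneg _) ht.2

end FlatConnection

/-! ### Local parallel frames of a flat connection. -/

section FlatConnection

open Metric Set

variable {E 𝔸 : Type*} [NormedAddCommGroup E] [NormedSpace ℝ E] [NormedRing 𝔸] [NormedAlgebra ℝ 𝔸]

theorem eventually_norm_lt_add_one {X F : Type*} [TopologicalSpace X] [NormedAddCommGroup F]
    {f : X → F} {x : X}
    (hf : ContinuousAt f x) : ∀ᶠ y in 𝓝 x, ‖f y‖ < ‖f x‖ + 1 :=
  hf.norm.eventually_lt_const (lt_add_one _)

/-- Flatness predicts that moving the end of the ray by h changes the transport at time t by t A(h)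
φ to first order. The error starts at zero and satisfies a linear inequality with source of order
‖h‖², so Grönwall's lemma bounds it by a multiple of ‖h‖². -/
theorem norm_radial_sub_le {A : E → E →L[ℝ] 𝔸} {x₀ u h : E} {r M N : ℝ} {K : NNReal}
    (hA : ∀ x ∈ ball x₀ r, DifferentiableAt ℝ A x) (hM : ∀ x ∈ ball x₀ r, ‖A x‖ ≤ M)
    (hN : ∀ x ∈ ball x₀ r, ‖fderiv ℝ A x‖ ≤ N) (hK : LipschitzOnWith K (fderiv ℝ A) (ball x₀ r))
    (hflat : ∀ x ∈ ball x₀ r, ∀ v w,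
      fderiv ℝ A x v w + A x w * A x v = fderiv ℝ A x w v + A x v * A x w)
    (hr1 : r ≤ 1) (hu : ‖u‖ < r) (huh : ‖u + h‖ < r) (hh : ‖h‖ ≤ 1) {φ χ : ℝ → 𝔸} {L : ℝ}
    (hφ0 : φ 0 = 1) (hχ0 : χ 0 = 1) (hL : ∀ t ∈ Icc (0 : ℝ) 1, ‖φ t‖ ≤ L)
    (hφ : ∀ t ∈ Icc (0 : ℝ) 1, HasDerivWithinAt φ (A (x₀ + t • u) u * φ t) (Icc 0 1) t)
    (hχ : ∀ t ∈ Icc (0 : ℝ) 1,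
      HasDerivWithinAt χ (A (x₀ + t • (u + h)) (u + h) * χ t) (Icc 0 1) t) :
    ‖χ 1 - φ 1 - A (x₀ + u) h * φ 1‖ ≤
      gronwallBound 0 (2 * M + 1) ((2 * K + N + M ^ 2 + 2 * (K + N) * M) * ‖h‖ ^ 2 * L) 1 := by
  have hr0 : 0 < r := (norm_nonneg u).trans_lt hu
  have hM0 : 0 ≤ M := (norm_nonneg _).trans (hM x₀ (mem_ball_self hr0))
  have hmem : ∀ v : E, ‖v‖ < r → ∀ t ∈ Icc (0 : ℝ) 1, x₀ + t • v ∈ ball x₀ r := by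
    intro v hv t ht
    rw [mem_ball, dist_eq_norm, add_sub_cancel_left, norm_smul, Real.norm_of_nonneg ht.1]
    nlinarith [ht.2, norm_nonneg v]
  set a : ℝ → 𝔸 := fun t => A (x₀ + t • u) h with ha
  have da : ∀ t ∈ Icc (0 : ℝ) 1, HasDerivAt a (fderiv ℝ A (x₀ + t • u) u h) t := by
    intro t ht
    have h1 : HasDerivAt (fun t : ℝ => x₀ + t • u) u t := by
      simpa using ((hasDerivAt_id t).smul_const u).const_add x₀
    have h2 := (hA _ (hmem u hu t ht)).hasFDerivAt.comp_hasDerivAt t h1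
    exact ((ContinuousLinearMap.apply ℝ 𝔸 h).hasFDerivAt.comp_hasDerivAt t h2)
  set e : ℝ → 𝔸 := fun t => χ t - φ t - (t • a t) * φ t with he
  set e' : ℝ → 𝔸 := fun t => A (x₀ + t • (u + h)) (u + h) * χ t - A (x₀ + t • u) u * φ t -
    ((a t + t • fderiv ℝ A (x₀ + t • u) u h) * φ t + (t • a t) * (A (x₀ + t • u) u * φ t)) with he'
  have de : ∀ t ∈ Icc (0 : ℝ) 1, HasDerivWithinAt e (e' t) (Icc 0 1) t := by
    intro t ht
    have h1 : HasDerivWithinAt (fun t : ℝ => t • a t) (a t + t • fderiv ℝ A (x₀ + t • u) u h)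
        (Icc 0 1) t := by
      have := ((hasDerivAt_id' t).fun_smul (da t ht)).hasDerivWithinAt (s := Icc 0 1)
      rwa [one_smul, add_comm] at this
    exact ((hχ t ht).sub (hφ t ht)).sub (h1.mul (hφ t ht))
  have hbound : ∀ t ∈ Ico (0 : ℝ) 1, ‖e' t‖ ≤
      (2 * M + 1) * ‖e t‖ + (2 * K + N + M ^ 2 + 2 * (K + N) * M) * ‖h‖ ^ 2 * L := by
    intro t ht'
    have ht : t ∈ Icc (0 : ℝ) 1 := ⟨ht'.1, ht'.2.le⟩
    have hx := hmem u hu t ht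
    have hy := hmem _ huh t ht
    have hyx : x₀ + t • (u + h) - (x₀ + t • u) = t • h := by module
    have hay := norm_sub_sub_fderiv_le (convex_ball x₀ r) hA hK hx hy
    rw [hyx, map_smul] at hay
    have hth : ‖t • h‖ ≤ ‖h‖ := by
      rw [norm_smul, Real.norm_of_nonneg ht.1]
      exact mul_le_of_le_one_left (norm_nonneg _) ht.2
    have hay' : ‖A (x₀ + t • (u + h)) - A (x₀ + t • u) - t • fderiv ℝ A (x₀ + t • u) h‖ ≤
        K * ‖h‖ ^ 2 := hay.trans (by rw [sq, ← mul_assoc]; gcongr)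
    have hrem := norm_flat_remainder_le ht (hu.le.trans hr1) hh (hM _ hx) (hN _ hx) hay'
      (hflat _ hx h u)
    have hsplit : e' t = A (x₀ + t • (u + h)) (u + h) * e t +
        (A (x₀ + t • (u + h)) (u + h) * (1 + t • a t) - A (x₀ + t • u) u -
          (a t + t • fderiv ℝ A (x₀ + t • u) u h) - t • (a t * A (x₀ + t • u) u)) * φ t := by
      simp only [he, he', mul_sub, sub_mul, add_mul, mul_add, mul_one, smul_mul_assoc,
        mul_smul_comm, mul_assoc]
      abel
    rw [hsplit]
    refine (norm_add_le _ _).trans (add_le_add ?_ ?_)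
    · refine (norm_mul_le _ _).trans (mul_le_mul_of_nonneg_right ?_ (norm_nonneg _))
      refine ((A _).le_opNorm _).trans ?_
      have := mul_le_mul (hM _ hy) huh.le (norm_nonneg _) hM0
      nlinarith
    · refine (norm_mul_le _ _).trans (mul_le_mul hrem (hL t ht) (norm_nonneg _) ?_)
      exact (norm_nonneg _).trans hrem
  have := norm_le_gronwallBound_of_norm_deriv_right_le (f := e) (f' := e') (δ := 0)
    (fun t ht => (de t ht).continuousWithinAt)
    (fun t ht => (de t ⟨ht.1, ht.2.le⟩).mono_of_mem_nhdsWithin (Icc_mem_nhdsGE_of_mem ht))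
    (by simp [he, hφ0, hχ0]) hbound 1 (by simp)
  simpa [he, ha] using this

/-- A flat connection has local parallel frames. -/
theorem exists_local_parallel_frame [CompleteSpace 𝔸] {U : Set E} (hU : IsOpen U)
    {A : E → E →L[ℝ] 𝔸} (hA : ContDiffOn ℝ ∞ A U)
    (hflat : ∀ x ∈ U, ∀ v w,
      fderiv ℝ A x v w + A x w * A x v = fderiv ℝ A x w v + A x v * A x w)
    {x₀ : E} (hx₀ : x₀ ∈ U) :
    ∃ r > 0, ball x₀ r ⊆ U ∧ ∃ Φ : E → 𝔸ˣ, ∀ x ∈ ball x₀ r,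
      HasFDerivAt (fun y => (Φ y : 𝔸)) (((ContinuousLinearMap.mul ℝ 𝔸).flip (Φ x)).comp (A x)) x := by
  have hD : ContDiffOn ℝ ∞ (fderiv ℝ A) U := hA.fderiv_of_isOpen hU (by simp)
  have hUn := hU.mem_nhds hx₀
  obtain ⟨K, s, hs, hK⟩ := ((hD.contDiffAt hUn).of_le
    (mod_cast le_top : ((1 : ℕ∞) : WithTop ℕ∞) ≤ ((⊤ : ℕ∞) : WithTop ℕ∞))).exists_lipschitzOnWith
  have hMn : ∀ᶠ x in 𝓝 x₀, ‖A x‖ < ‖A x₀‖ + 1 :=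
    eventually_norm_lt_add_one (hA.continuousOn.continuousAt hUn)
  have hNn : ∀ᶠ x in 𝓝 x₀, ‖fderiv ℝ A x‖ < ‖fderiv ℝ A x₀‖ + 1 :=
    eventually_norm_lt_add_one (hD.continuousOn.continuousAt hUn)
  set M := ‖A x₀‖ + 1 with hMdef
  set N := ‖fderiv ℝ A x₀‖ + 1 with hNdef
  have hMpos : 0 < M := by positivity
  obtain ⟨r₁, hr₁, hb⟩ := Metric.eventually_nhds_iff_ball.1
    (((hU.eventually_mem hx₀).and (mem_of_superset hs fun _ h => h : ∀ᶠ x in 𝓝 x₀, x ∈ s)).and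
      (hMn.and hNn))
  set B := M * (‖(1 : 𝔸)‖ + 1) with hB
  have hBpos : 0 < B := by positivity
  set r := min r₁ (min 1 (1 / B)) with hrdef
  have hr : 0 < r := lt_min hr₁ (lt_min one_pos (by positivity))
  have hrr₁ : ball x₀ r ⊆ ball x₀ r₁ := ball_subset_ball (min_le_left _ _)
  have hr1 : r ≤ 1 := (min_le_right _ _).trans (min_le_left _ _)
  have hrB : M * r * (‖(1 : 𝔸)‖ + 1) ≤ 1 := by
    have : r ≤ 1 / B := (min_le_right _ _).trans (min_le_right _ _)
    rw [le_div_iff₀ hBpos] at this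
    linarith [show M * r * (‖(1 : 𝔸)‖ + 1) = r * B by rw [hB]; ring]
  have hbU : ball x₀ r ⊆ U := fun x hx => (hb x (hrr₁ hx)).1.1
  have hbM : ∀ x ∈ ball x₀ r, ‖A x‖ ≤ M := fun x hx => (hb x (hrr₁ hx)).2.1.le
  have hbN : ∀ x ∈ ball x₀ r, ‖fderiv ℝ A x‖ ≤ N := fun x hx => (hb x (hrr₁ hx)).2.2.le
  have hbK : LipschitzOnWith K (fderiv ℝ A) (ball x₀ r) :=
    hK.mono fun x hx => (hb x (hrr₁ hx)).1.2
  have hbA : ∀ x ∈ ball x₀ r, DifferentiableAt ℝ A x := fun x hx =>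
    hA.differentiableAt_of_isOpen hU (hbU hx)
  -- For u = 0 the constant solution is chosen, so that the frame equals 1 at the centre; outside
  -- the ball the value is irrelevant.
  have hray : ∀ u : E, ∃ φ : ℝ → 𝔸, (u = 0 → φ 1 = 1) ∧ (‖u‖ < r → φ 0 = 1 ∧
      ∀ t ∈ Icc (0 : ℝ) 1, HasDerivWithinAt φ (A (x₀ + t • u) u * φ t) (Icc 0 1) t) := fun u => by
    by_cases h0 : u = 0
    · exact ⟨fun _ => 1, by simp, by simpa [h0] using fun _ _ _ _ => hasDerivWithinAt_const _ _ _⟩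
    by_cases hu : ‖u‖ < r
    · obtain ⟨φ, h⟩ := exists_radial_solution (hA.continuousOn.mono hbU) hbM hrB hu
      exact ⟨φ, fun h => absurd h h0, fun _ => h⟩
    · exact ⟨0, fun h => absurd h h0, fun h => absurd h hu⟩
  choose φ hφ0 hφ using hray
  have hder : ∀ x ∈ ball x₀ r, HasFDerivAt (fun y => φ (y - x₀) 1)
      (((ContinuousLinearMap.mul ℝ 𝔸).flip (φ (x - x₀) 1)).comp (A x)) x := by
    intro x hx
    have hu : ‖x - x₀‖ < r := by simpa [dist_eq_norm] using hx
    obtain ⟨L, hL⟩ := isCompact_Icc.exists_bound_of_continuousOn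
      (fun t ht => ((hφ _ hu).2 t ht).continuousWithinAt :
        ContinuousOn (φ (x - x₀)) (Icc (0 : ℝ) 1))
    rw [hasFDerivAt_iff_isLittleO_nhds_zero]
    refine Asymptotics.IsBigO.trans_isLittleO (g := fun h : E => ‖h‖ ^ 2) ?_
      (Asymptotics.isLittleO_norm_pow_id one_lt_two)
    have hev : ∀ᶠ h : E in 𝓝 0, ‖x - x₀ + h‖ < r ∧ ‖h‖ ≤ 1 := by
      refine Filter.Eventually.and ?_ ?_
      · have : ContinuousAt (fun h : E => ‖x - x₀ + h‖) 0 := by fun_prop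
        exact this.eventually_lt_const (by simpa using hu)
      · have : ContinuousAt (fun h : E => ‖h‖) 0 := by fun_prop
        exact (this.eventually_lt_const (by simp)).mono fun _ => le_of_lt
    -- The constant is the value of `gronwallBound` at time one, with zero initial value and rate 2M
    -- + 1, divided by ‖h‖².
    refine Asymptotics.IsBigO.of_bound ((2 * K + N + M ^ 2 + 2 * (K + N) * M) * L / (2 * M + 1) *
      (Real.exp (2 * M + 1) - 1)) ?_
    filter_upwards [hev] with h ⟨huh, hh⟩
    have := norm_radial_sub_le hbA hbM hbN hbK (fun y hy => hflat y (hbU hy)) hr1 hu huh hh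
      (hφ _ hu).1 (hφ _ huh).1 hL (hφ _ hu).2 (hφ _ huh).2
    rw [gronwallBound_of_K_ne_0 (by positivity), add_sub_cancel] at this
    rw [show x + h - x₀ = x - x₀ + h by abel]
    refine this.trans (le_of_eq ?_)
    rw [Real.norm_of_nonneg (by positivity)]
    simp only [zero_mul, zero_add, mul_one]
    ring
  have h1 : φ (x₀ - x₀) 1 = 1 := hφ0 _ (sub_self _)
  -- The transport is 1 at the centre and units are open, so it is invertible on a smaller ball.
  have hunit : ∀ᶠ x in 𝓝 x₀, x ∈ ball x₀ r ∧ IsUnit (φ (x - x₀) 1) := by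
    refine (isOpen_ball.eventually_mem (mem_ball_self hr)).and ?_
    refine (hder x₀ (mem_ball_self hr)).continuousAt.preimage_mem_nhds (Units.isOpen.mem_nhds ?_)
    change IsUnit (φ (x₀ - x₀) 1)
    exact h1 ▸ isUnit_one
  obtain ⟨r', hr', hb'⟩ := Metric.eventually_nhds_iff_ball.1 hunit
  classical
  refine ⟨r', hr', fun x hx => hbU (hb' x hx).1,
    fun x => if h : IsUnit (φ (x - x₀) 1) then h.unit else 1, fun x hx => ?_⟩
  have heq : ∀ y ∈ ball x₀ r',
      ((if h : IsUnit (φ (y - x₀) 1) then h.unit else 1 : 𝔸ˣ) : 𝔸) = φ (y - x₀) 1 := by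
    intro y hy
    rw [dif_pos (hb' y hy).2, IsUnit.unit_spec]
  rw [heq x hx]
  exact (hder x (hb' x hx).1).congr_of_eventuallyEq ((isOpen_ball.eventually_mem hx).mono heq)

end FlatConnection

/-! ### Global parallel frames. -/

section ParallelFrame

open Metric Set

variable {E 𝔸 : Type*} [NormedAddCommGroup E] [NormedSpace ℝ E] [NormedRing 𝔸] [NormedAlgebra ℝ 𝔸]

/-- `S` is a parallel frame on `W` for the connection `d - A`. -/
def IsParallelFrameOn (A : E → E →L[ℝ] 𝔸) (S : E → 𝔸ˣ) (W : Set E) : Prop :=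
  ∀ x ∈ W, HasFDerivAt (fun y => (S y : 𝔸))
    (((ContinuousLinearMap.mul ℝ 𝔸).flip (S x)).comp (A x)) x

/-- Bootstrapping: the derivative is an expression in A and S, so C^n regularity of S improves to
C^{n+1}. -/
theorem IsParallelFrameOn.smooth {U : Set E} (hU : IsOpen U) {A : E → E →L[ℝ] 𝔸} {S : E → 𝔸ˣ}
    (hA : ContDiffOn ℝ ∞ A U) (hS : IsParallelFrameOn A S U) :
    ContDiffOn ℝ ∞ (fun x => (S x : 𝔸)) U := by
  refine contDiffOn_infty.2 fun n => ?_
  induction n with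
  | zero =>
    exact contDiffOn_zero.2 fun x hx => (hS x hx).continuousAt.continuousWithinAt
  | succ n ih =>
    refine (contDiffOn_succ_iff_fderiv_of_isOpen hU).2
      ⟨fun x hx => (hS x hx).differentiableAt.differentiableWithinAt, fun h => absurd h (WithTop.natCast_ne_top n), ?_⟩
    refine ContDiffOn.congr (f := fun x => ((ContinuousLinearMap.mul ℝ 𝔸).flip (S x)).comp (A x)) ?_
      fun x hx => (hS x hx).fderiv
    exact ((ContinuousLinearMap.mul ℝ 𝔸).flip.contDiff.comp_contDiffOn ih).clm_comp
      (hA.of_le (mod_cast le_top))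

variable [CompleteSpace 𝔸]

/-- The derivatives of Ψ⁻¹ and Φ contribute -Ψ⁻¹AΦ and Ψ⁻¹AΦ, so Ψ⁻¹Φ is locally constant. These are
the transition functions for `exists_horizontal_section`. -/
theorem IsParallelFrameOn.eventually_inv_mul_eq {A : E → E →L[ℝ] 𝔸} {Φ Ψ : E → 𝔸ˣ} {W : Set E}
    (hW : IsOpen W) (hΦ : IsParallelFrameOn A Φ W) (hΨ : IsParallelFrameOn A Ψ W) {x : E}
    (hx : x ∈ W) : ∀ᶠ y in 𝓝 x, (Ψ y)⁻¹ * Φ y = (Ψ x)⁻¹ * Φ x := by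
  obtain ⟨r, hr, hb⟩ := Metric.isOpen_iff.1 hW x hx
  have hd : ∀ y ∈ ball x r, HasFDerivAt (fun y => (((Ψ y)⁻¹ * Φ y : 𝔸ˣ) : 𝔸)) (0 : E →L[ℝ] 𝔸) y := by
    intro y hy
    have h1 := (hasFDerivAt_ringInverse (𝕜 := ℝ) (Ψ y)).comp y (hΨ y (hb hy))
    have h2 := h1.mul' (hΦ y (hb hy))
    have e : (fun y => (((Ψ y)⁻¹ * Φ y : 𝔸ˣ) : 𝔸)) =
        (Ring.inverse ∘ fun y => (Ψ y : 𝔸)) * fun y => (Φ y : 𝔸) := by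
      funext z
      simp
    rw [e]
    refine h2.congr_fderiv ?_
    ext v
    simp [mul_assoc]
  have hc : ∀ y ∈ ball x r, (((Ψ y)⁻¹ * Φ y : 𝔸ˣ) : 𝔸) = (((Ψ x)⁻¹ * Φ x : 𝔸ˣ) : 𝔸) := fun y hy =>
    (convex_ball x r).is_const_of_fderivWithin_eq_zero (𝕜 := ℝ)
      (fun z hz => (hd z hz).differentiableAt.differentiableWithinAt)
      (fun z hz => (hd z hz).hasFDerivWithinAt.fderivWithin (isOpen_ball.uniqueDiffWithinAt hz))
      hy (mem_ball_self hr)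
  exact (isOpen_ball.eventually_mem (mem_ball_self hr)).mono fun y hy => Units.ext (hc y hy)

/-- A flat connection on a simply connected open set has a global parallel frame. -/
theorem exists_parallel_frame {U : Set E} (hU : IsOpen U) (hsc : IsSimplyConnected U)
    {A : E → E →L[ℝ] 𝔸} (hA : ContDiffOn ℝ ∞ A U)
    (hflat : ∀ x ∈ U, ∀ v w,
      fderiv ℝ A x v w + A x w * A x v = fderiv ℝ A x w v + A x v * A x w) :
    ∃ S : E → 𝔸ˣ, IsParallelFrameOn A S U := by
  classical
  have := hsc.simplyConnectedSpace
  have : LocallyPathConnectedSpace U := hU.locallyPathConnectedSpace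
  obtain ⟨x₀, hx₀⟩ := hsc.nonempty
  have hloc := fun x : U => exists_local_parallel_frame hU hA hflat x.2
  choose r hr hrU Φ hΦ using hloc
  obtain ⟨s, -, hs⟩ := exists_horizontal_section (F := 𝔸ˣ) (F' := 𝔸ˣ)
    (fun i : U => ((↑) : U → E) ⁻¹' ball (i : E) (r i))
    (fun i => isOpen_ball.preimage continuous_subtype_val) (fun i => mem_ball_self (hr i))
    (fun i y => Equiv.mulLeft (Φ i y)) (fun i j x hx => by
      have h := IsParallelFrameOn.eventually_inv_mul_eq (isOpen_ball.inter isOpen_ball)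
        (fun y hy => hΦ i y hy.1) (fun y hy => hΦ j y hy.2) (x := (x : E)) hx
      filter_upwards [continuousAt_subtype_val.eventually h] with y hy v
      simp only [Equiv.mulLeft_symm, Equiv.coe_mulLeft, ← mul_assoc]
      rw [hy]) ⟨x₀, hx₀⟩ 1
  refine ⟨fun x => if h : x ∈ U then s ⟨x, h⟩ else 1, fun x hx => ?_⟩
  -- Near x the global frame is the local one times this constant on the right, which preserves the
  -- parallel equation.
  set C : 𝔸ˣ := (Φ ⟨x, hx⟩ x)⁻¹ * s ⟨x, hx⟩ with hC
  have h1 := hs ⟨x, hx⟩ ⟨x, hx⟩ (mem_ball_self (hr _))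
  have h2 : ∀ᶠ y in 𝓝 x, (if h : y ∈ U then s ⟨y, h⟩ else 1 : 𝔸ˣ) = Φ ⟨x, hx⟩ y * C := by
    rw [nhds_subtype_eq_comap, eventually_comap] at h1
    filter_upwards [h1, hU.eventually_mem hx] with y hy hyU
    have := hy ⟨y, hyU⟩ rfl
    simp only [Equiv.mulLeft_symm, Equiv.coe_mulLeft] at this
    rw [dif_pos hyU, hC, ← this, mul_inv_cancel_left]
  have h3 := (hΦ ⟨x, hx⟩ x (mem_ball_self (hr _))).mul_const' (C : 𝔸)
  refine (h3.congr_of_eventuallyEq (h2.mono fun y hy => ?_)).congr_fderiv ?_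
  · beta_reduce
    rw [hy]; rfl
  · ext v
    beta_reduce
    rw [h2.self_of_nhds]
    simp [mul_assoc]

end ParallelFrame

/-! ### Linear systems with vanishing curvature in matrix form. -/

section LinearSystem

variable {ι : Type*} [Fintype ι] [DecidableEq ι]

/-- The algebra map from matrices to continuous endomorphisms. -/
def matrixToCLM : Matrix ι ι ℝ →ₐ[ℝ] ((ι → ℝ) →L[ℝ] (ι → ℝ)) :=
  (Module.End.toContinuousLinearMap (𝕜 := ℝ) (ι → ℝ)).toAlgHom.comp
    (Matrix.toLinAlgEquiv' (R := ℝ) (n := ι)).toAlgHom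

theorem sum_smul_matrixToCLM_single (m : ι → ι → ℝ) :
    ∑ i, ∑ j, m i j • matrixToCLM (Matrix.single i j (1 : ℝ)) = matrixToCLM (Matrix.of m) := by
  conv_rhs => rw [Matrix.matrix_eq_sum_single (Matrix.of m)]
  simp only [map_sum, ← map_smul, Matrix.smul_single, Matrix.of_apply, smul_eq_mul, mul_one]

theorem fderiv_sum_smul_const {κ E F : Type*} [Fintype κ] [NormedAddCommGroup E] [NormedSpace ℝ E]
    [NormedAddCommGroup F] [NormedSpace ℝ F] {f : κ → E → ℝ} {L : κ → F} {x : E}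
    (hf : ∀ k, DifferentiableAt ℝ (f k) x) (v : E) :
    fderiv ℝ (fun y => ∑ k, f k y • L k) x v = ∑ k, fderiv ℝ (f k) x v • L k := by
  have h : HasFDerivAt (fun y => ∑ k, f k y • L k) (∑ k, (fderiv ℝ (f k) x).smulRight (L k)) x :=
    HasFDerivAt.fun_sum fun k _ => (hf k).hasFDerivAt.smul_const (L k)
  rw [h.fderiv]
  simp

/-- The connection form `dx^0 a_0 + dx^1 a_1`. -/
def connectionForm (a : Fin 2 → Plane → Matrix ι ι ℝ) (x : Plane) :
    Plane →L[ℝ] ((ι → ℝ) →L[ℝ] (ι → ℝ)) :=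
  ∑ p : Fin 2 × ι × ι, a p.1 x p.2.1 p.2.2 •
    (ContinuousLinearMap.proj (R := ℝ) (φ := fun _ : Fin 2 => ℝ) p.1).smulRight
      (matrixToCLM (Matrix.single p.2.1 p.2.2 (1 : ℝ)))

theorem sum_connectionForm (m : Fin 2 → Matrix ι ι ℝ) (v : Plane) :
    (∑ p : Fin 2 × ι × ι, m p.1 p.2.1 p.2.2 •
      (ContinuousLinearMap.proj (R := ℝ) (φ := fun _ : Fin 2 => ℝ) p.1).smulRight
        (matrixToCLM (Matrix.single p.2.1 p.2.2 (1 : ℝ)))) v = ∑ C, v C • matrixToCLM (m C) := by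
  simp only [Fintype.sum_prod_type, sum_apply, smul_apply, ContinuousLinearMap.smulRight_apply,
    ContinuousLinearMap.proj_apply]
  refine Finset.sum_congr rfl fun C _ => ?_
  rw [show m C = Matrix.of (fun i j => m C i j) from rfl, ← sum_smul_matrixToCLM_single]
  simp only [Finset.smul_sum, Matrix.of_apply, smul_comm (v C)]

theorem connectionForm_apply (a : Fin 2 → Plane → Matrix ι ι ℝ) (x v : Plane) :
    connectionForm a x v = ∑ C, v C • matrixToCLM (a C x) :=
  sum_connectionForm (fun C => a C x) v

theorem connectionForm_smooth {U : Set Plane} {a : Fin 2 → Plane → Matrix ι ι ℝ}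
    (ha : ∀ C i j, ContDiffOn ℝ ∞ (fun x => a C x i j) U) :
    ContDiffOn ℝ ∞ (connectionForm a) U := by
  unfold connectionForm
  exact ContDiffOn.sum fun p _ => (ha p.1 p.2.1 p.2.2).smul_fixed _

theorem fderiv_connectionForm {a : Fin 2 → Plane → Matrix ι ι ℝ} {x : Plane}
    (ha : ∀ C i j, DifferentiableAt ℝ (fun x => a C x i j) x) (v w : Plane) :
    fderiv ℝ (connectionForm a) x v w =
      ∑ C, w C • matrixToCLM (Matrix.of fun i j => fderiv ℝ (fun x => a C x i j) x v) := by
  rw [← sum_connectionForm]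
  have h := fderiv_sum_smul_const (f := fun (p : Fin 2 × ι × ι) x => a p.1 x p.2.1 p.2.2)
    (L := fun p => (ContinuousLinearMap.proj (R := ℝ) (φ := fun _ : Fin 2 => ℝ) p.1).smulRight
      (matrixToCLM (Matrix.single p.2.1 p.2.2 (1 : ℝ)))) (fun p => ha p.1 p.2.1 p.2.2) v
  change fderiv ℝ (connectionForm a) x v = _ at h
  rw [h]
  rfl

theorem fderiv_eq_partialD (f : Plane → ℝ) (x v : Plane) :
    fderiv ℝ f x v = v 0 * partialD 0 f x + v 1 * partialD 1 f x := by
  have : v = v 0 • Pi.single 0 1 + v 1 • Pi.single 1 1 := by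
    ext i; fin_cases i <;> simp
  conv_lhs => rw [this, map_add, map_smul, map_smul]
  rfl

theorem connectionForm_flat {a : Fin 2 → Plane → Matrix ι ι ℝ} {x : Plane}
    (ha : ∀ C i j, DifferentiableAt ℝ (fun x => a C x i j) x)
    (hflat : ∀ i j, partialD 0 (fun x => a 1 x i j) x + (a 1 x * a 0 x) i j =
      partialD 1 (fun x => a 0 x i j) x + (a 0 x * a 1 x) i j) (v w : Plane) :
    fderiv ℝ (connectionForm a) x v w + connectionForm a x w * connectionForm a x v =
      fderiv ℝ (connectionForm a) x w v + connectionForm a x v * connectionForm a x w := by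
  set P : Fin 2 → Fin 2 → Matrix ι ι ℝ := fun D C =>
    Matrix.of fun i j => partialD D (fun x => a C x i j) x with hP
  have e : ∀ C (u : Plane), (Matrix.of fun i j => fderiv ℝ (fun x => a C x i j) x u) =
      u 0 • P 0 C + u 1 • P 1 C := by
    intro C u
    ext i j
    simp [hP, fderiv_eq_partialD]
  have hF : P 0 1 + a 1 x * a 0 x = P 1 0 + a 0 x * a 1 x := by
    ext i j
    simpa [hP] using hflat i j
  have hF' : P 0 1 = P 1 0 + a 0 x * a 1 x - a 1 x * a 0 x := by rw [← hF]; abel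
  simp only [fderiv_connectionForm ha, connectionForm_apply, e, hF', Fin.sum_univ_two, map_add,
    map_sub, map_smul, map_mul, add_mul, mul_add, smul_mul_assoc, mul_smul_comm]
  module

/-- A system `∂_C w = a_C w` with vanishing curvature on a simply connected plane domain has a
fundamental system of solutions. -/
theorem exists_fundamental_system {U : Set Plane} (hU : IsOpen U) (hsc : IsSimplyConnected U)
    {a : Fin 2 → Plane → Matrix ι ι ℝ} (ha : ∀ C i j, ContDiffOn ℝ ∞ (fun x => a C x i j) U)
    (hflat : ∀ x ∈ U, ∀ i j, partialD 0 (fun x => a 1 x i j) x + (a 1 x * a 0 x) i j =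
      partialD 1 (fun x => a 0 x i j) x + (a 0 x * a 1 x) i j) :
    ∃ w : Plane → Matrix ι ι ℝ, (∀ i k, ContDiffOn ℝ ∞ (fun x => w x i k) U) ∧
      (∀ x ∈ U, (w x).det ≠ 0) ∧
      ∀ x ∈ U, ∀ C i k, partialD C (fun x => w x i k) x = (a C x * w x) i k := by
  have hA := connectionForm_smooth ha
  obtain ⟨S, hS⟩ := exists_parallel_frame hU hsc hA fun x hx => connectionForm_flat
    (fun C i j => (ha C i j).differentiableAt_of_isOpen hU hx) (hflat x hx)
  have hSs := hS.smooth hU hA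
  let ev : ι → ι → ((ι → ℝ) →L[ℝ] (ι → ℝ)) →L[ℝ] ℝ := fun i k =>
    (ContinuousLinearMap.proj (R := ℝ) (φ := fun _ : ι => ℝ) i).comp
      (ContinuousLinearMap.apply ℝ (ι → ℝ) (Pi.single k 1))
  let toM : ((ι → ℝ) →L[ℝ] (ι → ℝ)) ≃ₐ[ℝ] Matrix ι ι ℝ :=
    (Module.End.toContinuousLinearMap (𝕜 := ℝ) (ι → ℝ)).symm.trans LinearMap.toMatrixAlgEquiv'
  have hev : ∀ T i k, toM T i k = ev i k T := fun T i k => LinearMap.toMatrix'_apply _ _ _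
  have htoM : ∀ m, toM (matrixToCLM m) = m := fun m => LinearMap.toMatrix'_toLin' m
  refine ⟨fun x => toM (S x), fun i k => ?_, fun x _ => ?_, fun x hx C i k => ?_⟩
  · simp only [hev]
    exact (ev i k).contDiff.comp_contDiffOn hSs
  · exact ((Matrix.isUnit_iff_isUnit_det _).1 ((S x).isUnit.map toM)).ne_zero
  · have h := ((ev i k).hasFDerivAt.comp x (hS x hx)).fderiv
    have e1 : (fun x => toM (S x) i k) = ev i k ∘ fun y => (S y : (ι → ℝ) →L[ℝ] (ι → ℝ)) :=
      funext fun y => hev _ i k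
    have e2 : connectionForm a x (Pi.single C 1) = matrixToCLM (a C x) := by
      rw [connectionForm_apply]
      fin_cases C <;> simp
    rw [partialD, e1, h]
    change ev i k (connectionForm a x (Pi.single C 1) * S x) = _
    rw [← hev, map_mul, e2, htoM]

end LinearSystem

/-! ### Flat projective structures are metrisable. -/

section FlatProjective

variable {U : Set Plane} (γ : TorsionFreeConnection U)

/-- The tractor connection matrix of the projective structure. -/
def tractorMatrix (C : Fin 2) (x : Plane) : Matrix (Fin 3) (Fin 3) ℝ :=
  !![thomas γ 0 C 0 x, thomas γ 1 C 0 x, epsLow C 0;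
     thomas γ 0 C 1 x, thomas γ 1 C 1 x, epsLow C 1;
     curvSymbol γ 0 C x, curvSymbol γ 1 C x, 0]

variable {γ}

theorem tractorMatrix_smooth (hU : IsOpen U) (C : Fin 2) (i j : Fin 3) :
    ContDiffOn ℝ ∞ (fun x => tractorMatrix γ C x i j) U := by
  have h1 := fun A B D => thomas_smooth γ A B D
  have h2 := fun A B => curvSymbol_smooth (γ := γ) hU A B
  fin_cases i <;> fin_cases j <;> simp only [tractorMatrix]
  exacts [h1 _ _ _, h1 _ _ _, contDiffOn_const, h1 _ _ _, h1 _ _ _, contDiffOn_const, h2 _ _,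
    h2 _ _, contDiffOn_const]

theorem partialD_const (C : Fin 2) (c : ℝ) (x : Plane) : partialD C (fun _ => c) x = 0 := by
  simp [partialD]

/-- The first two rows of the tractor curvature vanish by the definition of `curvSymbol` and the
trace-freeness of Π. The last row is the Cotton tensor and the trace of the curvature. -/
theorem tractorMatrix_flat (hU : IsOpen U) {x : Plane} (hx : x ∈ U)
    (hcot : ∀ C, cottonSymbol γ C x = 0) (i j : Fin 3) :
    partialD 0 (fun x => tractorMatrix γ 1 x i j) x + (tractorMatrix γ 1 x * tractorMatrix γ 0 x) i j =
      partialD 1 (fun x => tractorMatrix γ 0 x i j) x +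
        (tractorMatrix γ 0 x * tractorMatrix γ 1 x) i j := by
  have hs := fun C => thomas_symm γ C 1 0 (x := x) hx
  have htr := thomas_trace γ 0 hx
  have htr' := thomas_trace γ 1 hx
  have hR := curvSymbol_trace (γ := γ) hU hx
  have hd : ∀ C B, curvSymbol γ C B x = partialD 0 (thomas γ C 1 B) x - partialD 1 (thomas γ C 0 B) x
      + ∑ E, (thomas γ C 0 E x * thomas γ E 1 B x - thomas γ C 1 E x * thomas γ E 0 B x) :=
    fun C B => rfl
  have h0 := hcot 0
  have h1 := hcot 1
  simp only [cottonSymbol, Fin.sum_univ_two] at h0 h1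
  have d00 := hd 0 0
  have d01 := hd 0 1
  have d10 := hd 1 0
  have d11 := hd 1 1
  simp only [Fin.sum_univ_two] at d00 d01 d10 d11
  fin_cases i <;> fin_cases j <;>
    simp [tractorMatrix, Matrix.mul_apply, Fin.sum_univ_three, partialD_const, epsLow]
  · change partialD 0 (thomas γ 0 1 0) x + _ = partialD 1 (thomas γ 0 0 0) x + _
    linear_combination -d00
  · change partialD 0 (thomas γ 1 1 0) x + _ = partialD 1 (thomas γ 1 0 0) x + _
    linear_combination -d10
  · linear_combination htr
  · change partialD 0 (thomas γ 0 1 1) x + _ = partialD 1 (thomas γ 0 0 1) x + _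
    linear_combination -d01
  · change partialD 0 (thomas γ 1 1 1) x + _ = partialD 1 (thomas γ 1 0 1) x + _
    linear_combination -d11
  · linear_combination htr'
  · change partialD 0 (curvSymbol γ 0 1) x + _ = partialD 1 (curvSymbol γ 0 0) x + _
    linear_combination h0
  · change partialD 0 (curvSymbol γ 1 1) x + _ = partialD 1 (curvSymbol γ 1 0) x + _
    linear_combination h1
  · linear_combination hR

theorem partialD_zpow_neg_two {f : Plane → ℝ} {x : Plane} (hf : DifferentiableAt ℝ f x)
    (h0 : f x ≠ 0) (C : Fin 2) : partialD C (fun y => f y ^ (-2 : ℤ)) x =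
      -2 * (f x ^ (-2 : ℤ) / f x) * partialD C f x := by
  have h := ((hasDerivAt_zpow (-2) (f x) (Or.inl h0)).comp_hasFDerivAt x hf.hasFDerivAt).fderiv
  rw [partialD, show (fun y => f y ^ (-2 : ℤ)) = (fun z => z ^ (-2 : ℤ)) ∘ f from rfl, h,
    smul_apply, smul_eq_mul, zpow_sub_one₀ h0, partialD]
  push_cast
  ring

/-- A nondegenerate solution of the projectively invariant metrisability equation gives a metric
in the projective class. -/
theorem isMetrisable_of_metrisability_solution (hU : IsOpen U) {p q t m n : Plane → ℝ}
    (hp : ContDiffOn ℝ ∞ p U) (hq : ContDiffOn ℝ ∞ q U) (ht : ContDiffOn ℝ ∞ t U)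
    (hm : ContDiffOn ℝ ∞ m U) (hn : ContDiffOn ℝ ∞ n U)
    (hdet : ∀ x ∈ U, p x * t x - q x ^ 2 ≠ 0)
    (dp : ∀ x ∈ U, ∀ C, partialD C p x =
      2 * (thomas γ 0 C 0 x * p x + thomas γ 1 C 0 x * q x + epsLow C 0 * m x))
    (dq : ∀ x ∈ U, ∀ C, partialD C q x = thomas γ 0 C 0 x * q x + thomas γ 1 C 0 x * t x
      + epsLow C 0 * n x + thomas γ 0 C 1 x * p x + thomas γ 1 C 1 x * q x + epsLow C 1 * m x)
    (dt : ∀ x ∈ U, ∀ C, partialD C t x =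
      2 * (thomas γ 0 C 1 x * q x + thomas γ 1 C 1 x * t x + epsLow C 1 * n x)) :
    IsMetrisable γ := by
  set D : Plane → ℝ := fun x => p x * t x - q x ^ 2 with hD
  have hDs : ContDiffOn ℝ ∞ D U := (hp.mul ht).sub (hq.pow 2)
  have hr : ContDiffOn ℝ ∞ (fun x => D x ^ (-2 : ℤ)) U := by
    have : ContDiffOn ℝ ∞ (fun x => (D x ^ 2)⁻¹) U :=
      (hDs.pow 2).inv fun x hx => pow_ne_zero 2 (hdet x hx)
    refine this.congr fun x _ => ?_
    rw [zpow_neg]; rfl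
  let H : SurfaceMetric U :=
    { h := fun x => !![D x ^ (-2 : ℤ) * p x, D x ^ (-2 : ℤ) * q x;
        D x ^ (-2 : ℤ) * q x, D x ^ (-2 : ℤ) * t x]
      smooth := fun A B => by
        fin_cases A <;> fin_cases B
        exacts [hr.mul hp, hr.mul hq, hr.mul hq, hr.mul ht]
      symm := fun x _ => by
        ext i j
        fin_cases i <;> fin_cases j <;> rfl
      nondeg := fun x hx => by
        have h0 : D x ^ (-2 : ℤ) ≠ 0 := zpow_ne_zero _ (hdet x hx)
        rw [Matrix.det_fin_two_of, show D x ^ (-2 : ℤ) * p x * (D x ^ (-2 : ℤ) * t x) -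
          D x ^ (-2 : ℤ) * q x * (D x ^ (-2 : ℤ) * q x) =
            (D x ^ (-2 : ℤ)) ^ 2 * D x by simp only [hD]; ring]
        exact mul_ne_zero (pow_ne_zero 2 h0) (hdet x hx) }
  refine ⟨H, isMetrisedBy_of_projective_levi_civita γ
    -- This is β = -(d log |D|)/2, as it must be: the metric has determinant D⁻³, and the
    -- logarithmic derivative of the determinant is 6β.
    (β := ![fun x => (q x * m x - p x * n x) / D x, fun x => (m x * t x - q x * n x) / D x])
    (fun A => ?_) fun x hx C A B => ?_⟩
  · fin_cases A
    · exact ((hq.mul hm).sub (hp.mul hn)).div hDs hdet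
    · exact ((hm.mul ht).sub (hq.mul hn)).div hDs hdet
  have hD0 : D x ≠ 0 := hdet x hx
  have cp := hp.differentiableAt_of_isOpen hU hx
  have cq := hq.differentiableAt_of_isOpen hU hx
  have ct := ht.differentiableAt_of_isOpen hU hx
  have cD := hDs.differentiableAt_of_isOpen hU hx
  have cr := hr.differentiableAt_of_isOpen hU hx
  have hs := fun C => thomas_symm γ C 1 0 (x := x) hx
  have tr0 : thomas γ 1 0 1 x = -thomas γ 0 0 0 x := thomas_one_zero_one hx
  have tr1 : thomas γ 1 1 1 x = -thomas γ 0 0 1 x := thomas_one_one_one hx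
  have dD : ∀ C, partialD C D x =
      2 * (p x * epsLow C 1 * n x + t x * epsLow C 0 * m x
        - q x * (epsLow C 0 * n x + epsLow C 1 * m x)) := by
    intro C
    have e : partialD C D x = p x * partialD C t x + t x * partialD C p x -
        2 * q x * partialD C q x := by
      simp only [partialD, hD]
      rw [fderiv_fun_sub (cp.fun_mul ct) (cq.fun_pow 2), fderiv_fun_mul cp ct, fderiv_fun_pow 2 cq]
      simp
    rw [e, dp x hx, dq x hx, dt x hx]
    fin_cases C <;> simp only [Fin.zero_eta, Fin.mk_one, tr0, tr1, hs] <;> ring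
  have hρ := fun C => partialD_zpow_neg_two cD hD0 C
  have key : ∀ f : Plane → ℝ, DifferentiableAt ℝ f x → ∀ C,
      partialD C (fun y => D y ^ (-2 : ℤ) * f y) x =
        D x ^ (-2 : ℤ) * (partialD C f x - 2 * f x * partialD C D x / D x) := by
    intro f hf C
    rw [partialD_mul cr hf, hρ]
    field_simp
    ring
  have hc : ∀ A B, partialD C (fun y => H.h y A B) x =
      D x ^ (-2 : ℤ) * ((!![partialD C p x, partialD C q x; partialD C q x, partialD C t x] :
        Matrix (Fin 2) (Fin 2) ℝ) A B - 2 * (!![p x, q x; q x, t x] : Matrix _ _ ℝ) A B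
          * partialD C D x / D x) := by
    intro A B
    fin_cases A <;> fin_cases B
    exacts [key p cp C, key q cq C, key q cq C, key t ct C]
  have hH : ∀ A B, H.h x A B = D x ^ (-2 : ℤ) * (!![p x, q x; q x, t x] : Matrix _ _ ℝ) A B := by
    intro A B
    fin_cases A <;> fin_cases B <;> rfl
  rw [hc]
  simp only [hH, dp x hx, dq x hx, dt x hx, dD]
  generalize D x ^ (-2 : ℤ) = ρ
  fin_cases C <;> fin_cases A <;> fin_cases B <;>
    simp [epsLow, Fin.sum_univ_two, tr0, tr1, hs] <;> field_simp <;> simp only [hD] <;> ring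

/-- A parallel tractor consists of a one-form w_A with ∇_C w_A = ε_{CA} w_2 and the function w_2.
The products w_A w_B then solve the metrisability equation with auxiliary one-form w_2 w_B, and so
do sums over several tractors. -/
theorem isMetrisable_of_cotton_eq_zero (hU : IsOpen U) (hsc : IsSimplyConnected U)
    (hcot : ∀ x ∈ U, ∀ C, cottonSymbol γ C x = 0) : IsMetrisable γ := by
  obtain ⟨w, hw, hdet, hd⟩ := exists_fundamental_system hU hsc
    (tractorMatrix_smooth (γ := γ) hU) fun x hx => tractorMatrix_flat hU hx (hcot x hx)
  have hsum : ∀ i j, ContDiffOn ℝ ∞ (fun x => ∑ k, w x i k * w x j k) U := fun i j =>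
    ContDiffOn.sum fun k _ => (hw i k).mul (hw j k)
  have dsum : ∀ i j, ∀ x ∈ U, ∀ C, partialD C (fun x => ∑ k, w x i k * w x j k) x =
      ∑ k, (w x i k * (tractorMatrix γ C x * w x) j k +
        w x j k * (tractorMatrix γ C x * w x) i k) := by
    intro i j x hx C
    have c := fun i k => (hw i k).differentiableAt_of_isOpen hU hx
    rw [partialD, fderiv_fun_sum fun k _ => (c i k).fun_mul (c j k), sum_apply]
    refine Finset.sum_congr rfl fun k _ => ?_
    rw [← hd x hx C, ← hd x hx C, ← partialD_mul (c i k) (c j k), partialD]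
  refine isMetrisable_of_metrisability_solution hU (hsum 0 0) (hsum 0 1) (hsum 1 1) (hsum 0 2)
    (hsum 1 2) (fun x hx h0 => hdet x hx ?_) (fun x hx C => ?_) (fun x hx C => ?_) fun x hx C => ?_
  -- The Gram determinant of the first two rows of w is the squared length of their cross product
  -- (a, b, c). If it vanished, expansion along the third row would give det w = 0.
  · simp only [Fin.sum_univ_three] at h0
    rw [Matrix.det_fin_three]
    set a := w x 0 1 * w x 1 2 - w x 0 2 * w x 1 1 with ha
    set b := w x 0 2 * w x 1 0 - w x 0 0 * w x 1 2 with hb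
    set c := w x 0 0 * w x 1 1 - w x 0 1 * w x 1 0 with hc
    have e : a ^ 2 + b ^ 2 + c ^ 2 = 0 := by rw [← h0, ha, hb, hc]; ring
    have a0 : a = 0 := by nlinarith [sq_nonneg a, sq_nonneg b, sq_nonneg c]
    have b0 : b = 0 := by nlinarith [sq_nonneg a, sq_nonneg b, sq_nonneg c]
    have c0 : c = 0 := by nlinarith [sq_nonneg a, sq_nonneg b, sq_nonneg c]
    linear_combination w x 2 0 * a0 + w x 2 1 * b0 + w x 2 2 * c0
  all_goals
    rw [dsum _ _ x hx]
    simp [tractorMatrix, Matrix.mul_apply, Fin.sum_univ_three]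
    ring

end FlatProjective

theorem isMetrisable_of_isHermitianKahlerOn {U : Set Plane} {γ : TorsionFreeConnection U} {e : ℝ}
    (he : e ≠ 0) (hU : IsOpen U) (hsc : IsSimplyConnected U)
    {g' : Plane × Plane → Plane × Plane →L[ℝ] Plane × Plane →L[ℝ] ℝ}
    {J : Plane × Plane → Plane × Plane →L[ℝ] Plane × Plane}
    (hg' : InConformalClass (tangentTotal U) (riemannianExtension γ) g')
    (h : IsHermitianKahlerOn e (tangentTotal U) g' J) : IsMetrisable γ :=
  (h.isMetrisable_or_cotton_eq_zero he hU hsc.isPathConnected.isConnected.isPreconnected hg').elim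
    id (isMetrisable_of_cotton_eq_zero hU hsc)

end

theorem mainTheorem4 (U : Set Plane) (hU : IsOpen U) (hsc : IsSimplyConnected U)
    (γ : TorsionFreeConnection U) :
    (∀ γ' : TorsionFreeConnection U, ProjEquiv γ γ' →
      ∀ p ∈ tangentTotal U, riemannianExtension γ' p = riemannianExtension γ p) ∧
    IsMetricOn (tangentTotal U) (riemannianExtension γ) ∧
    (∀ p ∈ tangentTotal U, HasNeutralSignature (riemannianExtension γ p)) ∧
    (IsMetrisable γ ↔
      ContainsKahler (tangentTotal U) (riemannianExtension γ) ∨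
        ContainsParaKahler (tangentTotal U) (riemannianExtension γ)) ∧
    ((∃ h : SurfaceMetric U, h.IsRiemannian ∧ IsMetrisedBy γ h) →
      ContainsKahler (tangentTotal U) (riemannianExtension γ)) ∧
    ((∃ h : SurfaceMetric U, h.IsLorentzian ∧ IsMetrisedBy γ h) →
      ContainsParaKahler (tangentTotal U) (riemannianExtension γ)) := by
  have hM := isOpen_tangentTotal hU
  refine ⟨fun γ' h p hp => riemannianExtension_congr γ h hp, riemannianExtension_isMetricOn γ,
    fun p hp => riemannianExtension_neutral γ hp, ⟨?_, ?_⟩, ?_, ?_⟩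
  · rintro ⟨h, hm⟩
    exact (h.det_pos_or_det_neg hsc.isPathConnected.isConnected.isPreconnected).imp
      (containsKahler_of_det_pos hU hm) (containsParaKahler_of_det_neg hU hm)
  · rintro (⟨g', J, hg', hJ⟩ | ⟨g', J, hg', hJ⟩)
    · exact isMetrisable_of_isHermitianKahlerOn (by norm_num) hU hsc hg' ((isKahlerOn_iff hM).1 hJ)
    · exact isMetrisable_of_isHermitianKahlerOn one_ne_zero hU hsc hg'
        ((isParaKahlerOn_iff hM).1 hJ)
  · rintro ⟨h, hR, hm⟩
    exact containsKahler_of_det_pos hU hm fun x hx => (hR x hx).det_pos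
  · rintro ⟨h, hL, hm⟩
    exact containsParaKahler_of_det_neg hU hm hL
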